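/- Let $W=(W_t)_{t\in[0,1]}$ be a standard Brownian motion on a probability space $(\Omega,\mathcal F,P)$ whose $\sigma$-field $\mathcal F$ is generated by $W$ up to null sets. Write $L^2=L^2([0,1];\mathbb R)$ with norm $\|\cdot\|$, let $I:L^2\to L^2(\Omega)$ be the Wiener integral (the continuous linear extension of $1_{(0,t]}\mapsto W_t$), $e^{\diamond I(g)}:=\exp(I(g)-\|g\|^2/2)$ the Wick exponential, and $(SY)(g):=E[Y e^{\diamond I(g)}]$, $g\in L^2$, the S-transform of $Y\in L^2(\Omega)$. The Wick product $X\diamond Y\in L^2(\Omega)$ is characterized by $S(X\diamond Y)(g)=(SX)(g)(SY)(g)$ for all $g\in L^2$, and the Skorohod integral $Y=\int_0^1u_s\,dW_s\in L^2(\Omega)$ of $u\in L^2(\Omega\times[0,1])$ by $(SY)(g)=\int_0^1(Su_s)(g)g(s)\,ds$ for all $g\in L^2$; moreover $\int_0^t u_s\,dW_s:=\int_0^1 1_{[0,t)}(s)u_s\,dW_s$. Let $f,\sigma\in L^2$ be differentiable on $[0,1]$ with $f',\sigma'$ of bounded variation on $[0,1]$, and let $a$ be integrable on $[0,1]$. Consider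 the linear Skorohod SDE $$X_t=e^{\diamond I(f)}+\int_0^t a(s)X_s\,ds+\int_0^t\sigma(s)X_s\,dW_s\quad\text{a.s., for each }t\in[0,1],$$ where a solution is a process $X\in L^2(\Omega\times[0,1])$ with $\int_0^1|a(s)|\,\|X_s\|_{L^2(\Omega)}\,ds<\infty$. (1) A solution exists, and every solution satisfies, for each $t\in[0,1]$, almost surely $$X_t=\left(e^{\diamond I(f)}\diamond e^{\diamond I(1_{[0,t)}\sigma)}\right)e^{\int_0^t a(s)\,ds}=e^{\diamond I(f+1_{[0,t)}\sigma)}\,e^{\int_0^t a(s)\,ds}.$$ (2) With $\widehat{X_1}^n:=E[X_1\mid W_{1/n},W_{2/n},\dots,W_1]$, $$\lim_{n\to\infty}n\,E\big[(X_1-\widehat{X_1}^n)^2\big]^{1/2}=\frac{\|f'+\sigma'\|}{\sqrt{12}}\exp\Big(\tfrac12\|f+\sigma\|^2+\int_0^1a(s)\,ds\Big).$$ (3) $X_1$ is the terminal value of a solution of a linear Itô SDE: there is an adapted process $Z\in L^2(\Omega\times[0,1])$ with $\int_0^1|a(s)|\,\|Z_s\|_{L^2(\Omega)}\,ds<\infty$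 such that, for each $t\in[0,1]$, almost surely $Z_t=1+\int_0^ta(s)Z_s\,ds+\int_0^t(f(s)+\sigma(s))Z_s\,dW_s$ in the Itô sense, and $Z_1=X_1$ almost surely. -/

import Mathlib

open Set Filter Topology MeasureTheory ProbabilityTheory

namespace SkorohodSDE

/-- Lebesgue measure on the time interval `[0,1]`. -/
noncomputable abbrev unitMeasure : Measure ℝ := volume.restrict (Icc (0 : ℝ) 1)

/-- The Hilbert space `L² = L²([0,1]; ℝ)`. -/
abbrev L2Unit : Type := Lp ℝ 2 unitMeasure

/-- The norm of `L²([0,1]; ℝ)`, for a function. -/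
noncomputable def normL2 (g : ℝ → ℝ) : ℝ := Real.sqrt (∫ s in (0 : ℝ)..1, g s ^ 2)

/-- The assumption "`f' ∈ BV`": `f ∈ L²` is differentiable on `[0,1]` (one-sidedly at the end
points) and its derivative is of bounded variation on `[0,1]`. -/
structure HasBVDeriv (f : ℝ → ℝ) : Prop where
  memLp : MemLp f 2 unitMeasure
  differentiableOn : DifferentiableOn ℝ f (Icc 0 1)
  boundedVariationOn : BoundedVariationOn (derivWithin f (Icc 0 1)) (Icc 0 1)

/-- `1_{[0,t)} g` belongs to `L²` if `g` does. -/
theorem memLp_restrict {g : ℝ → ℝ} (hg : MemLp g 2 unitMeasure) (t : ℝ) :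
    MemLp ((Ico 0 t).indicator g) 2 unitMeasure :=
  hg.indicator measurableSet_Ico

variable {Ω : Type*} [MeasurableSpace Ω]

/-- `(W_t)_{t ∈ [0,1]}` is a standard Brownian motion under `P`. The values of `W` at times
outside of `[0,1]` are irrelevant. -/
structure IsBrownianMotion (W : ℝ → Ω → ℝ) (P : Measure Ω) : Prop where
  measurable : ∀ t ∈ Icc (0 : ℝ) 1, Measurable (W t)
  zero : ∀ᵐ ω ∂P, W 0 ω = 0
  indep : HasIndepIncrements (fun t : unitInterval => W t) P
  law : ∀ s t : ℝ, 0 ≤ s → s ≤ t → t ≤ 1 →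
    HasLaw (fun ω => W t ω - W s ω) (gaussianReal 0 (t - s).toNNReal) P
  cont : ∀ᵐ ω ∂P, ContinuousOn (fun t => W t ω) (Icc 0 1)

theorem IsBrownianMotion.memLp {W : ℝ → Ω → ℝ} {P : Measure Ω} (hW : IsBrownianMotion W P)
    (t : unitInterval) : MemLp (W t) 2 P := by
  have h : MemLp (fun ω => W t ω - W 0 ω) 2 P :=
    (hW.law 0 t le_rfl t.2.1 t.2.2).hasGaussianLaw.memLp_two
  refine h.ae_eq ?_
  filter_upwards [hW.zero] with ω hω
  simp [hω]

/-- The `σ`-field generated by `W_s`, `0 ≤ s ≤ t`. -/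
abbrev pastSigma (W : ℝ → Ω → ℝ) (t : ℝ) : MeasurableSpace Ω :=
  ⨆ s ∈ Icc (0 : ℝ) t, MeasurableSpace.comap (W s) inferInstance

/-- The `σ`-field generated by the observations `W_{1/n}, W_{2/n}, …, W_1`. -/
noncomputable abbrev gridSigma (W : ℝ → Ω → ℝ) (n : ℕ) : MeasurableSpace Ω :=
  ⨆ k ∈ Finset.Icc 1 n, MeasurableSpace.comap (W ((k : ℝ) / (n : ℝ))) inferInstance

/-- The `σ`-field of `Ω` is the one generated by `(W_t)_{t ∈ [0,1]}`, up to `P`-null sets: each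
measurable set agrees up to a null set with a set of the generated `σ`-field. -/
def IsGeneratedBy (W : ℝ → Ω → ℝ) (P : Measure Ω) : Prop :=
  ∀ s : Set Ω, MeasurableSet s → ∃ s', MeasurableSet[pastSigma W 1] s' ∧ s =ᵐ[P] s'

/-- The step function `∑ c_t 1_{(0,t]}` as an element of `L²`. -/
noncomputable def stepFunction : (unitInterval →₀ ℝ) →ₗ[ℝ] L2Unit :=
  Finsupp.linearCombination ℝ fun t : unitInterval =>
    indicatorConstLp 2 (measurableSet_Ioc (a := (0 : ℝ)) (b := (t : ℝ)))
      (measure_ne_top unitMeasure _) (1 : ℝ)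

variable {W : ℝ → Ω → ℝ} {P : Measure Ω}

/-- The random variable `∑ c_t W_t` as an element of `L²(Ω)`. -/
noncomputable def stepIntegral (hW : IsBrownianMotion W P) : (unitInterval →₀ ℝ) →ₗ[ℝ] Lp ℝ 2 P :=
  Finsupp.linearCombination ℝ fun t : unitInterval => (hW.memLp t).toLp (W t)

/-- The Wiener integral `I : L² → L²(Ω)`: the continuous linear extension of `1_{(0,t]} ↦ W_t`. -/
noncomputable def wienerIntegral (hW : IsBrownianMotion W P) : L2Unit →L[ℝ] Lp ℝ 2 P :=
  (stepIntegral hW).extendOfNorm stepFunction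

/-- The Wick exponential `e^{◇ I(g)} = exp (I(g) - ‖g‖² / 2)`. -/
noncomputable def wickExp (hW : IsBrownianMotion W P) (g : L2Unit) (ω : Ω) : ℝ :=
  Real.exp (wienerIntegral hW g ω - ‖g‖ ^ 2 / 2)

/-- The S-transform `(S Y)(g) = E[Y e^{◇ I(g)}]`. -/
noncomputable def sTransform (hW : IsBrownianMotion W P) (Y : Ω → ℝ) (g : L2Unit) : ℝ :=
  ∫ ω, Y ω * wickExp hW g ω ∂P

/-- `Z` is the Wick product `X ◇ Y` (in `L²(Ω)`). -/
def IsWickProduct (hW : IsBrownianMotion W P) (X Y Z : Ω → ℝ) : Prop :=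
  MemLp X 2 P ∧ MemLp Y 2 P ∧ MemLp Z 2 P ∧
    ∀ g : L2Unit, sTransform hW Z g = sTransform hW X g * sTransform hW Y g

/-- `Y ∈ L²(Ω)` is the Skorohod integral `∫_0^1 u_s dW_s` of the (possibly nonadapted) process
`u ∈ L²(Ω × [0,1])`. -/
def IsSkorohodIntegral (hW : IsBrownianMotion W P) (u : ℝ → Ω → ℝ) (Y : Ω → ℝ) : Prop :=
  MemLp (Function.uncurry u) 2 (unitMeasure.prod P) ∧ MemLp Y 2 P ∧
    ∀ g : L2Unit, sTransform hW Y g = ∫ s, sTransform hW (u s) g * g s ∂unitMeasure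

/-- An elementary process `∑ᵢ ξᵢ 1_{(tᵢ, tᵢ₊₁]}` where `0 ≤ t₀ ≤ … ≤ tₘ ≤ 1` and `ξᵢ` is square
integrable and measurable with respect to the past up to time `tᵢ`. -/
structure ElementaryProcess (W : ℝ → Ω → ℝ) (P : Measure Ω) where
  m : ℕ
  t : Fin (m + 1) → ℝ
  mono : Monotone t
  mem : ∀ i, t i ∈ Icc (0 : ℝ) 1
  ξ : Fin m → Ω → ℝ
  memLp : ∀ i, MemLp (ξ i) 2 P
  adapted : ∀ i, Measurable[pastSigma W (t i.castSucc)] (ξ i)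

/-- The value of an elementary process at time `s`. -/
noncomputable def ElementaryProcess.eval (H : ElementaryProcess W P) (s : ℝ) (ω : Ω) : ℝ :=
  ∑ i, (Ioc (H.t i.castSucc) (H.t i.succ)).indicator (fun _ => H.ξ i ω) s

/-- The stochastic integral `∑ᵢ ξᵢ (W_{tᵢ₊₁} - W_{tᵢ})` of an elementary process. -/
noncomputable def ElementaryProcess.integral (H : ElementaryProcess W P) (ω : Ω) : ℝ :=
  ∑ i, H.ξ i ω * (W (H.t i.succ) ω - W (H.t i.castSucc) ω)

/-- `Y ∈ L²(Ω)` is the Itô integral `∫_0^1 u_s dW_s` of `u ∈ L²(Ω × [0,1])`: there are elementary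
processes which converge to `u` in `L²(Ω × [0,1])` and whose integrals converge to `Y` in
`L²(Ω)`. -/
def IsItoIntegral (W : ℝ → Ω → ℝ) (P : Measure Ω) (u : ℝ → Ω → ℝ) (Y : Ω → ℝ) : Prop :=
  MemLp (Function.uncurry u) 2 (unitMeasure.prod P) ∧ MemLp Y 2 P ∧
    ∃ H : ℕ → ElementaryProcess W P,
      Tendsto (fun j => eLpNorm (fun p : ℝ × Ω => (H j).eval p.1 p.2 - u p.1 p.2) 2
        (unitMeasure.prod P)) atTop (𝓝 0) ∧
      Tendsto (fun j => eLpNorm (fun ω => (H j).integral ω - Y ω) 2 P) atTop (𝓝 0)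

/-- `X` is a process in `L²(Ω × [0,1])` which satisfies, for each `t ∈ [0,1]` almost surely,
`X_t = X₀ + ∫_0^t a(s) X_s ds + ∫_0^t σ(s) X_s dW_s`.
The relation `Int u Y` says that `Y` is the stochastic integral `∫_0^1 u_s dW_s`, and the integral
up to `t` is that of the process multiplied by `1_{[0,t)}`. The drift integral has to converge
absolutely in `L²(Ω)`, i.e. `∫_0^1 |a(s)| ‖X_s‖_{L²(Ω)} ds < ∞` (which is automatic for
`a ∈ L²`). -/
structure SolvesLinearSDE (Int : (ℝ → Ω → ℝ) → (Ω → ℝ) → Prop) (P : Measure Ω) (a σ : ℝ → ℝ)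
    (X₀ : Ω → ℝ) (X : ℝ → Ω → ℝ) : Prop where
  memLp : MemLp (Function.uncurry X) 2 (unitMeasure.prod P)
  drift : ∫⁻ s, ‖a s‖ₑ * eLpNorm (X s) 2 P ∂unitMeasure < ⊤
  eqn : ∀ t ∈ Icc (0 : ℝ) 1, ∃ Y : Ω → ℝ,
    Int (fun s ω => (Ico 0 t).indicator σ s * X s ω) Y ∧
    ∀ᵐ ω ∂P, X t ω = X₀ ω + (∫ s in (0 : ℝ)..t, a s * X s ω) + Y ω

/-- `X` solves the linear Skorohod SDE `dX_t = a(t) X_t dt + σ(t) X_t dW_t` with the initial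
value `X₀`. -/
def IsSkorohodSolution (hW : IsBrownianMotion W P) (a σ : ℝ → ℝ) (X₀ : Ω → ℝ)
    (X : ℝ → Ω → ℝ) : Prop :=
  SolvesLinearSDE (IsSkorohodIntegral hW) P a σ X₀ X

/-- `X` is an adapted solution of the linear Itô SDE `dX_t = a(t) X_t dt + σ(t) X_t dW_t` with the
initial value `X₀`. -/
def IsItoSolution (W : ℝ → Ω → ℝ) (P : Measure Ω) (a σ : ℝ → ℝ) (X₀ : Ω → ℝ)
    (X : ℝ → Ω → ℝ) : Prop :=
  SolvesLinearSDE (IsItoIntegral W P) P a σ X₀ X ∧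
    ∀ t ∈ Icc (0 : ℝ) 1, AEStronglyMeasurable[pastSigma W t] (X t) P

/-- The root mean square error `E[(Y - E[Y | W_{1/n}, …, W_1])²]^{1/2}` of the optimal
approximation of `Y` by the observations `W_{1/n}, …, W_1`. -/
noncomputable def optimalError (W : ℝ → Ω → ℝ) (P : Measure Ω) (n : ℕ) (Y : Ω → ℝ) : ℝ :=
  Real.sqrt (∫ ω, (Y ω - (P[Y | gridSigma W n]) ω) ^ 2 ∂P)

end SkorohodSDE

/-! The S-transform linearises everything. Since `e^{◇I(g)} e^{◇I(h)} = e^{⟨g,h⟩} e^{◇I(g+h)}`, one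
has `S(e^{◇I(h)})(g) = e^{⟨h,g⟩}`, so Wick products of Wick exponentials add their exponents.
Applied to the SDE, S gives for each fixed `g` the scalar equation `x(t) = e^{⟨f,g⟩} + ∫_0^t (a +
σg) x ds`, whose only solution is `e^{⟨f,g⟩} exp ∫_0^t (a + σg)`. This is the S-transform of
`e^{∫_0^t a} e^{◇I(f + 1_{[0,t)}σ)}`. Wick exponentials are total because `W` generates the σ-field
(`ae_eq_zero_of_sTransform_eq_zero`), which gives uniqueness (`IsSkorohodSolution.ae_eq`). For
existence, the candidate is continuous in `t` with values in `L²(Ω)`, hence has a jointly measurable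
version, and the same computation read backwards identifies its Skorohod integral
(`isSkorohodSolution_of_version`).

At time 1, `X_1 = e^{∫a} e^{◇I(h)}` with `h = f + σ`. Conditioning on the grid values replaces `h`
by its orthogonal projection `p_n h` onto the step functions of mesh `1/n` (`condExp_wickExp`), so
the squared error is `e^{2∫a} (e^{‖h‖²} - e^{‖p_n h‖²})`. With `δ_n = ‖h - p_n h‖` this is `e^{2∫a +
‖h‖²} (1 - e^{-δ_n²})`, and only the limit of `n δ_n` is needed. On each cell `h` is its tangent
line up to `1/n` times the variation of `h'` there. The step part of the tangent lies in the span,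
and the centred linear part is orthogonal to it and carries the factor `1/√12`
(`abs_mul_norm_sub_starProjection_sub_le`).

For the Itô statement, `Z` is the Skorohod solution with `f` replaced by 0 and `σ` by `f + σ`; its
value at time 1 is the same. It is adapted, and its Skorohod integrals are Itô integrals
(`IsSkorohodIntegral.isItoIntegral`): elementary approximations converge by the Itô isometry, their
integrals have the right S-transforms, and totality identifies the limit. -/

set_option linter.unusedSectionVars false

namespace SkorohodSDE

/-! ### The Wiener integral: isometry and Gaussian law. -/

section Gaussian

variable {Ω : Type*} [MeasurableSpace Ω] {P : Measure Ω} {W : ℝ → Ω → ℝ}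

instance : IsProbabilityMeasure unitMeasure := ⟨by simp [unitMeasure]⟩

/-- The indicator function of `(0, t]` in `L²([0,1])`. -/
noncomputable def initialSegment (t : unitInterval) : L2Unit :=
  indicatorConstLp 2 (measurableSet_Ioc (a := (0 : ℝ)) (b := (t : ℝ)))
    (measure_ne_top unitMeasure _) (1 : ℝ)

theorem stepFunction_single (t : unitInterval) (c : ℝ) :
    stepFunction (Finsupp.single t c) = c • initialSegment t := by
  simp [stepFunction, initialSegment]

theorem inner_initialSegment (s t : unitInterval) :
    inner ℝ (initialSegment s) (initialSegment t) = min (s : ℝ) t := by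
  rw [initialSegment, initialSegment, L2.real_inner_indicatorConstLp_one_indicatorConstLp_one,
    Ioc_inter_Ioc, max_self, measureReal_def, unitMeasure, Measure.restrict_apply measurableSet_Ioc,
    inter_eq_self_of_subset_left]
  · rw [Real.volume_Ioc, ENNReal.toReal_ofReal (by simpa using ⟨s.2.1, t.2.1⟩), sub_zero]
  · exact fun x hx => ⟨hx.1.le, hx.2.trans ((min_le_left _ _).trans s.2.2)⟩

/-- A vector orthogonal to every `1_{(0,t]}` has vanishing integral over every half-line. Half-lines
form a π-system generating the Borel sets, so the signed measure with this density is zero. -/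
theorem denseRange_stepFunction : DenseRange stepFunction := by
  have key : (LinearMap.range stepFunction).topologicalClosure = ⊤ := by
    rw [Submodule.topologicalClosure_eq_top_iff, Submodule.eq_bot_iff]
    intro g hg
    have h0 : ∀ t ∈ Icc (0 : ℝ) 1, ∫ x in Ioc 0 t, g x ∂unitMeasure = 0 := by
      intro t ht
      have h1 := (Submodule.mem_orthogonal _ g).1 hg (initialSegment ⟨t, ht⟩)
        ⟨Finsupp.single ⟨t, ht⟩ 1, by simp [stepFunction_single]⟩
      rwa [initialSegment, L2.inner_indicatorConstLp_one] at h1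
    have hint : Integrable g unitMeasure := (Lp.memLp g).integrable (by norm_num)
    have hIoc : ∀ t : ℝ, ∫ x in Iic t, g x ∂unitMeasure = 0 := by
      intro t
      rcases lt_or_ge t 0 with ht | ht
      · rw [setIntegral_measure_zero]
        rw [unitMeasure, Measure.restrict_apply measurableSet_Iic]
        convert measure_empty (μ := volume)
        ext x
        simp only [mem_inter_iff, mem_Iic, mem_Icc, mem_empty_iff_false, iff_false]
        intro h
        linarith [h.1, h.2.1]
      · have ht' : min t 1 ∈ Icc (0 : ℝ) 1 := ⟨by positivity, min_le_right _ _⟩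
        rw [← h0 _ ht']
        refine setIntegral_congr_set ?_
        have : ∀ᵐ x ∂unitMeasure, x ∈ Icc (0 : ℝ) 1 := ae_restrict_mem measurableSet_Icc
        have h3 : ∀ᵐ x ∂unitMeasure, x ≠ 0 := ae_restrict_of_ae (Measure.ae_ne volume 0)
        filter_upwards [this, h3] with x hx hx0
        apply propext
        change x ≤ t ↔ 0 < x ∧ x ≤ min t 1
        have : 0 < x := lt_of_le_of_ne hx.1 (Ne.symm hx0)
        simp [this, hx.2]
    have hz : g =ᵐ[unitMeasure] 0 := by
      have hν : (unitMeasure.withDensityᵥ (g : ℝ → ℝ)) = 0 := by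
        refine VectorMeasure.ext_of_generateFrom (range Iic) ?_
          (borel_eq_generateFrom_Iic ℝ ▸ BorelSpace.measurable_eq) isPiSystem_Iic ?_
        · rintro s ⟨t, rfl⟩
          rw [withDensityᵥ_apply hint measurableSet_Iic, hIoc]
          rfl
        · rw [withDensityᵥ_apply hint MeasurableSet.univ, setIntegral_univ]
          have := hIoc 1
          refine Eq.trans ?_ this
          congr 1
          rw [unitMeasure, Measure.restrict_restrict measurableSet_Iic,
            inter_eq_self_of_subset_right]
          exact Icc_subset_Iic_self
      have := hint.ae_eq_of_withDensityᵥ_eq (integrable_zero ℝ ℝ unitMeasure) (by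
        rw [hν]; simp)
      exact this
    exact (Lp.eq_zero_iff_ae_eq_zero).2 hz
  rw [DenseRange, dense_iff_closure_eq]
  have := congrArg (fun S : Submodule ℝ L2Unit => (S : Set L2Unit)) key
  rw [Submodule.topologicalClosure_coe, LinearMap.coe_range, Submodule.top_coe] at this
  exact this

theorem IsBrownianMotion.hasLaw (hW : IsBrownianMotion W P) (t : unitInterval) :
    HasLaw (W t) (gaussianReal 0 (t : ℝ).toNNReal) P := by
  have h := hW.law 0 t le_rfl t.2.1 t.2.2
  rw [sub_zero] at h
  refine h.congr ?_
  filter_upwards [hW.zero] with ω hω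
  simp [hω]

theorem stepIntegral_single (hW : IsBrownianMotion W P) (t : unitInterval) (c : ℝ) :
    stepIntegral hW (Finsupp.single t c) = c • (hW.memLp t).toLp (W t) := by
  simp [stepIntegral]

theorem stepIntegral_coeFn (hW : IsBrownianMotion W P) (c : unitInterval →₀ ℝ) :
    stepIntegral hW c =ᵐ[P] fun ω => ∑ t ∈ c.support, c t * W t ω := by
  rw [stepIntegral, Finsupp.linearCombination_apply, Finsupp.sum]
  refine (Lp.coeFn_finsetSum _ _).trans ?_
  have h : ∀ᵐ ω ∂P, ∀ t ∈ c.support,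
      (c t • (hW.memLp t).toLp (W t) : Lp ℝ 2 P) ω = c t * W t ω := by
    rw [Filter.eventually_all_finset]
    intro t _
    filter_upwards [Lp.coeFn_smul (c t) ((hW.memLp t).toLp (W t)), (hW.memLp t).coeFn_toLp]
      with ω h1 h2
    rw [h1, Pi.smul_apply, h2, smul_eq_mul]
  filter_upwards [h] with ω hω
  rw [Finset.sum_apply]
  exact Finset.sum_congr rfl hω

theorem IsBrownianMotion.isGaussianProcess (hW : IsBrownianMotion W P) :
    IsGaussianProcess (fun t : unitInterval => W t) P :=
  HasIndepIncrements.isGaussianProcess (fun t => (hW.hasLaw t).hasGaussianLaw) hW.zero hW.indep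

theorem IsBrownianMotion.integral_eq_zero (hW : IsBrownianMotion W P) (t : unitInterval) :
    ∫ ω, W t ω ∂P = 0 := by
  rw [(hW.hasLaw t).integral_eq, integral_id_gaussianReal]

variable [IsProbabilityMeasure P]

theorem IsBrownianMotion.integral_mul (hW : IsBrownianMotion W P) (s t : unitInterval) :
    ∫ ω, W s ω * W t ω ∂P = min (s : ℝ) t := by
  wlog hst : s ≤ t generalizing s t
  · simp_rw [min_comm (s : ℝ), mul_comm (W s _)]
    exact this t s (le_of_not_ge hst)
  rw [min_eq_left (Subtype.coe_le_coe.2 hst)]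
  have hind := hW.indep.indepFun_eval_sub (r := 0) (s := s) (t := t) s.2.1 hst hW.zero
  have h1 : cov[W s, W t; P] = ∫ ω, W s ω * W t ω ∂P := by
    rw [covariance_eq_sub (hW.memLp s) (hW.memLp t), hW.integral_eq_zero, zero_mul, sub_zero]
    rfl
  have h2 : W t = W s + ((fun ω => W t ω) - fun ω => W s ω) := by ext; simp
  have h3 : Var[W s; P] = s := by
    rw [(hW.hasLaw s).variance_eq, variance_id_gaussianReal, Real.coe_toNNReal _ s.2.1]
  rw [← h1, h2, covariance_add_right (hW.memLp s) (hW.memLp s) ((hW.memLp t).sub (hW.memLp s)),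
    hind.covariance_eq_zero (hW.memLp s) ((hW.memLp t).sub (hW.memLp s)), add_zero,
    covariance_self (hW.memLp s).aemeasurable, h3]

/-- By bilinearity this reduces to `E[W_s W_t] = min s t = ⟨1_{(0,s]}, 1_{(0,t]}⟩`. Together with
density it is what makes `extendOfNorm` a genuine extension. -/
theorem inner_stepIntegral (hW : IsBrownianMotion W P) (c d : unitInterval →₀ ℝ) :
    inner ℝ (stepIntegral hW c) (stepIntegral hW d) =
      inner ℝ (stepFunction c) (stepFunction d) := by
  induction c using Finsupp.induction_linear with
  | zero => simp
  | add c c' h h' => simp [inner_add_left, h, h']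
  | single s x =>
    induction d using Finsupp.induction_linear with
    | zero => simp
    | add c c' h h' => simp [inner_add_right, h, h']
    | single t y =>
      rw [stepFunction_single, stepFunction_single, stepIntegral_single, stepIntegral_single,
        real_inner_smul_left, real_inner_smul_left, real_inner_smul_right, real_inner_smul_right,
        inner_initialSegment, ← hW.integral_mul s t, L2.inner_def]
      congr 2
      refine integral_congr_ae ?_
      filter_upwards [(hW.memLp s).coeFn_toLp, (hW.memLp t).coeFn_toLp] with ω h1 h2
      simp [h1, h2, mul_comm]

theorem norm_stepIntegral (hW : IsBrownianMotion W P) (c : unitInterval →₀ ℝ) :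
    ‖stepIntegral hW c‖ = ‖stepFunction c‖ := by
  rw [← sq_eq_sq₀ (norm_nonneg _) (norm_nonneg _), ← real_inner_self_eq_norm_sq,
    ← real_inner_self_eq_norm_sq, inner_stepIntegral]

theorem wienerIntegral_stepFunction (hW : IsBrownianMotion W P) (c : unitInterval →₀ ℝ) :
    wienerIntegral hW (stepFunction c) = stepIntegral hW c :=
  LinearMap.extendOfNorm_eq denseRange_stepFunction
    ⟨1, fun x => by rw [one_mul, norm_stepIntegral]⟩ c

theorem wienerIntegral_initialSegment (hW : IsBrownianMotion W P) (t : unitInterval) :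
    wienerIntegral hW (initialSegment t) = (hW.memLp t).toLp (W t) := by
  have := wienerIntegral_stepFunction hW (Finsupp.single t 1)
  rwa [stepFunction_single, stepIntegral_single, one_smul, one_smul] at this

theorem norm_wienerIntegral_le (hW : IsBrownianMotion W P) (g : L2Unit) :
    ‖wienerIntegral hW g‖ ≤ ‖g‖ := by
  have := LinearMap.norm_extendOfNorm_apply_le (f := stepIntegral hW) (e := stepFunction)
    denseRange_stepFunction 1 (fun x => by rw [one_mul, norm_stepIntegral]) g
  rwa [one_mul] at this

theorem map_stepIntegral (hW : IsBrownianMotion W P) (c : unitInterval →₀ ℝ) :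
    P.map (stepIntegral hW c) = gaussianReal 0 (‖stepFunction c‖ ^ 2).toNNReal := by
  have hg : HasGaussianLaw (stepIntegral hW c) P := by
    let L : (c.support → ℝ) →L[ℝ] ℝ := ∑ t : c.support, c t • ContinuousLinearMap.proj t
    refine ((hW.isGaussianProcess.hasGaussianLaw c.support).map L).congr ?_
    refine EventuallyEq.trans ?_ (stepIntegral_coeFn hW c).symm
    refine .of_eq ?_
    ext ω
    simp only [L, Function.comp_apply, _root_.sum_apply,
      _root_.smul_apply, ContinuousLinearMap.proj_apply, Finset.restrict, smul_eq_mul]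
    exact Finset.sum_coe_sort c.support (fun t => c t * W t ω)
  have hmean : ∫ ω, stepIntegral hW c ω ∂P = 0 := by
    rw [integral_congr_ae (stepIntegral_coeFn hW c), integral_finsetSum]
    · refine Finset.sum_eq_zero fun t _ => ?_
      rw [integral_const_mul, hW.integral_eq_zero, mul_zero]
    · exact fun t _ => ((hW.memLp t).integrable (by norm_num)).const_mul _
  rw [hg.map_eq_gaussianReal, hmean, variance_eq_sub hg.memLp_two, hmean, ← norm_stepIntegral hW,
    ← real_inner_self_eq_norm_sq, L2.inner_def]
  congr 2
  simp [sq]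

/-- The random variable `I(g)` has the law `N(0, ‖g‖²)`. -/
theorem map_wienerIntegral (hW : IsBrownianMotion W P) (g : L2Unit) :
    P.map (wienerIntegral hW g) = gaussianReal 0 (‖g‖ ^ 2).toNNReal := by
  have hmeas : ∀ g, AEStronglyMeasurable (wienerIntegral hW g) P := fun g =>
    Lp.aestronglyMeasurable _
  have hint : ∀ g, Integrable (fun ω => Complex.exp (wienerIntegral hW g ω * Complex.I)) P := by
    intro g
    refine Integrable.of_bound (C := 1) ?_ (ae_of_all _ fun ω => ?_)
    · have := (hmeas g).aemeasurable
      exact AEMeasurable.aestronglyMeasurable (by fun_prop)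
    · rw [Complex.norm_exp_ofReal_mul_I]
  -- `φ` is 1-Lipschitz because `|e^{ix} - e^{iy}| ≤ |x - y|` and `I` is a contraction, so its
  -- Gaussian formula need only be checked on the dense step functions.
  let φ : L2Unit → ℂ := fun g => ∫ ω, Complex.exp (wienerIntegral hW g ω * Complex.I) ∂P
  have hφc : Continuous φ := by
    refine LipschitzWith.continuous (K := 1) (LipschitzWith.of_dist_le_mul fun g h => ?_)
    rw [NNReal.coe_one, one_mul, dist_eq_norm, dist_eq_norm, ← integral_sub (hint g) (hint h)]
    have hmem : MemLp (fun ω => wienerIntegral hW g ω - wienerIntegral hW h ω) 2 P :=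
      (Lp.memLp _).sub (Lp.memLp _)
    calc ‖∫ ω, (Complex.exp (wienerIntegral hW g ω * Complex.I) -
          Complex.exp (wienerIntegral hW h ω * Complex.I)) ∂P‖
        ≤ ∫ ω, ‖wienerIntegral hW g ω - wienerIntegral hW h ω‖ ∂P := by
          refine norm_integral_le_of_norm_le (hmem.integrable (by norm_num)).norm
            (ae_of_all _ fun ω => ?_)
          have h1 : Complex.exp (wienerIntegral hW g ω * Complex.I) -
              Complex.exp (wienerIntegral hW h ω * Complex.I) =
              Complex.exp (wienerIntegral hW h ω * Complex.I) *
              (Complex.exp (Complex.I * ((wienerIntegral hW g ω - wienerIntegral hW h ω : ℝ) : ℂ))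
                - 1) := by
            rw [mul_sub, ← Complex.exp_add, mul_one]
            congr 2
            push_cast
            ring
          rw [h1, norm_mul, Complex.norm_exp_ofReal_mul_I, one_mul]
          exact Real.norm_exp_I_mul_ofReal_sub_one_le
      _ = (eLpNorm (fun ω => wienerIntegral hW g ω - wienerIntegral hW h ω) 1 P).toReal := by
          rw [eLpNorm_one_eq_lintegral_enorm, integral_norm_eq_lintegral_enorm hmem.1]
      _ ≤ (eLpNorm (fun ω => wienerIntegral hW g ω - wienerIntegral hW h ω) 2 P).toReal :=
          ENNReal.toReal_mono hmem.2.ne (eLpNorm_le_eLpNorm_of_exponent_le (by norm_num) hmem.1)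
      _ = ‖wienerIntegral hW (g - h)‖ := by
          rw [map_sub, Lp.norm_def]
          congr 1
          exact eLpNorm_congr_ae (Lp.coeFn_sub _ _).symm
      _ ≤ ‖g - h‖ := norm_wienerIntegral_le hW _
  have hφ : φ = fun g => Complex.exp (-(‖g‖ : ℂ) ^ 2 / 2) := by
    refine denseRange_stepFunction.equalizer hφc (by fun_prop) ?_
    ext c
    have h1 : charFun (P.map (stepIntegral hW c)) 1 = φ (stepFunction c) := by
      rw [charFun_apply_real, integral_map (Lp.aestronglyMeasurable _).aemeasurable
        (by fun_prop)]
      simp [φ, wienerIntegral_stepFunction]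
    rw [Function.comp_apply, Function.comp_apply, ← h1, map_stepIntegral, charFun_gaussianReal]
    simp [neg_div]
  -- By linearity of `I` the characteristic function at `t` is `φ (t • g)`, so the value of `φ`
  -- suffices.
  refine Measure.ext_of_charFun ?_
  ext t
  have h1 : charFun (P.map (wienerIntegral hW g)) t = φ (t • g) := by
    rw [charFun_apply_real, integral_map (hmeas g).aemeasurable (by fun_prop)]
    refine integral_congr_ae ?_
    have h2 := Lp.coeFn_smul t (wienerIntegral hW g)
    rw [← map_smul] at h2
    filter_upwards [h2] with ω hω
    rw [hω]
    simp
  rw [h1, hφ, charFun_gaussianReal]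
  simp [norm_smul, mul_pow, ← Complex.ofReal_pow]
  ring_nf

end Gaussian

/-! ### Exponentials of linear combinations determine integrals over generated events. -/

section Totality

variable {Ω : Type*} [MeasurableSpace Ω] {P : Measure Ω}

/-- A moment generating function finite on all of ℝ continues analytically to ℂ, and on the
imaginary axis it is the characteristic function. The measures are not assumed normalised; the value
at `t = 0` compares their masses. -/
theorem map_eq_of_forall_integral_exp_eq {Ω' : Type*} [MeasurableSpace Ω'] {μ : Measure Ω}
    {ν : Measure Ω'} [IsFiniteMeasure μ] [IsFiniteMeasure ν] {X : Ω → ℝ} {Y : Ω' → ℝ}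
    (hX : AEMeasurable X μ) (hY : AEMeasurable Y ν)
    (hμ : ∀ t, Integrable (fun ω => Real.exp (t * X ω)) μ)
    (h : ∀ t, ∫ ω, Real.exp (t * X ω) ∂μ = ∫ ω, Real.exp (t * Y ω) ∂ν) :
    μ.map X = ν.map Y := by
  have hmgf : mgf X μ = mgf Y ν := funext h
  have huniv : μ.real univ = ν.real univ := by simpa using h 0
  have hzero : μ = 0 ↔ ν = 0 := by
    rw [← Measure.measure_univ_eq_zero, ← Measure.measure_univ_eq_zero (μ := ν),
      ← measureReal_eq_zero_iff, ← measureReal_eq_zero_iff, huniv]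
  refine Measure.ext_of_complexMGF_eq hX hY ?_
  ext z
  refine eqOn_complexMGF_of_mgf' hmgf hzero ?_
  have : integrableExpSet X μ = univ := eq_univ_of_forall hμ
  simp [this]

/-- The positive and negative parts of `D` are densities of finite measures `μ` and `ν`. The
hypothesis says that each linear combination of the `V i` has the same moment generating function
under both. Testing all linear forms (Cramér–Wold) gives equal finite-dimensional laws, and
uniqueness of projective limits gives equal laws of the whole family. -/
theorem setIntegral_eq_zero_of_forall_integral_exp_eq_zero {ι : Type*} {V : ι → Ω → ℝ}
    (hV : ∀ i, Measurable (V i)) {D : Ω → ℝ}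
    (hD : ∀ c : ι →₀ ℝ, Integrable (fun ω => D ω * Real.exp (∑ i ∈ c.support, c i * V i ω)) P)
    (h0 : ∀ c : ι →₀ ℝ, ∫ ω, D ω * Real.exp (∑ i ∈ c.support, c i * V i ω) ∂P = 0)
    {s : Set Ω} (hs : MeasurableSet[⨆ i, MeasurableSpace.comap (V i) inferInstance] s) :
    ∫ ω in s, D ω ∂P = 0 := by
  have hDi : Integrable D P := by simpa using hD 0
  let μ : Measure Ω := P.withDensity fun ω => ENNReal.ofReal (D ω)
  let ν : Measure Ω := P.withDensity fun ω => ENNReal.ofReal (-D ω)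
  have : IsFiniteMeasure μ := isFiniteMeasure_withDensity_ofReal hDi.2
  have : IsFiniteMeasure ν := isFiniteMeasure_withDensity_ofReal hDi.neg.2
  have hDm := hDi.1.aemeasurable
  have hVm : Measurable fun ω i => V i ω := measurable_pi_lambda _ hV
  have hlin : ∀ c : ι →₀ ℝ, μ.map (fun ω => ∑ i ∈ c.support, c i * V i ω) =
      ν.map (fun ω => ∑ i ∈ c.support, c i * V i ω) := by
    intro c
    have hmeas : Measurable fun ω => ∑ i ∈ c.support, c i * V i ω := by fun_prop
    have hsc : ∀ t : ℝ, Integrable (fun ω => D ω *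
        Real.exp (t * ∑ i ∈ c.support, c i * V i ω)) P ∧
        ∫ ω, D ω * Real.exp (t * ∑ i ∈ c.support, c i * V i ω) ∂P = 0 := by
      intro t
      have : ∀ ω, t * ∑ i ∈ c.support, c i * V i ω =
          ∑ i ∈ (t • c).support, (t • c) i * V i ω := by
        intro ω
        rcases eq_or_ne t 0 with rfl | ht
        · simp
        · rw [Finsupp.support_smul_eq ht, Finset.mul_sum]
          simp [mul_assoc]
      simp_rw [this]
      exact ⟨hD _, h0 _⟩
    have hpos : ∀ t : ℝ, Integrable (fun ω => (ENNReal.ofReal (D ω)).toReal •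
        Real.exp (t * ∑ i ∈ c.support, c i * V i ω)) P := by
      intro t
      refine (hsc t).1.mono ?_ (ae_of_all _ fun ω => ?_)
      · exact AEMeasurable.aestronglyMeasurable (by fun_prop)
      · rw [norm_smul, norm_mul, ENNReal.toReal_ofReal']
        gcongr
        rw [Real.norm_of_nonneg (le_max_right _ _)]
        exact max_le (le_abs_self _) (abs_nonneg _)
    have hneg : ∀ t : ℝ, Integrable (fun ω => (ENNReal.ofReal (-D ω)).toReal •
        Real.exp (t * ∑ i ∈ c.support, c i * V i ω)) P := by
      intro t
      refine (hsc t).1.mono ?_ (ae_of_all _ fun ω => ?_)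
      · exact AEMeasurable.aestronglyMeasurable (by fun_prop)
      · rw [norm_smul, norm_mul, ENNReal.toReal_ofReal']
        gcongr
        rw [Real.norm_of_nonneg (le_max_right _ _)]
        exact max_le (neg_le_abs _) (abs_nonneg _)
    refine map_eq_of_forall_integral_exp_eq hmeas.aemeasurable hmeas.aemeasurable ?_ ?_
    · intro t
      rw [integrable_withDensity_iff_integrable_smul₀' (by fun_prop) (by simp)]
      exact hpos t
    · intro t
      rw [integral_withDensity_eq_integral_toReal_smul₀ (by fun_prop) (by simp),
        integral_withDensity_eq_integral_toReal_smul₀ (by fun_prop) (by simp), ← sub_eq_zero,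
        ← integral_sub (hpos t) (hneg t), ← (hsc t).2]
      refine integral_congr_ae (ae_of_all _ fun ω => ?_)
      simp only [ENNReal.toReal_ofReal', smul_eq_mul, ← sub_mul]
      congr 1
      rcases le_total 0 (D ω) with h | h
      · simp [h]
      · simp [h]
  have hproj : μ.map (fun ω i => V i ω) = ν.map (fun ω i => V i ω) := by
    refine IsProjectiveLimit.unique (isProjectiveLimit_map hVm.aemeasurable) (fun J => ?_)
    rw [Measure.map_map (by fun_prop) hVm]
    refine (Measure.ext_of_charFunDual ?_).symm
    ext L
    have hJ : Measurable fun ω => J.restrict (fun i => V i ω) := by fun_prop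
    rw [charFunDual_eq_charFun_map_one, charFunDual_eq_charFun_map_one]
    congr 1
    have hJ' : Function.comp J.restrict (fun ω i => V i ω) =
      fun ω => J.restrict (fun i => V i ω) := rfl
    rw [hJ', Measure.map_map (by fun_prop) hJ, Measure.map_map (by fun_prop) hJ]
    classical
    let c : ι →₀ ℝ := Finsupp.onFinset J
      (fun i => if hi : i ∈ J then L (Pi.single ⟨i, hi⟩ 1) else 0) (by grind)
    have hc : L ∘ (fun ω => J.restrict (fun i => V i ω)) =
        fun ω => ∑ i ∈ c.support, c i * V i ω := by
      ext ω
      have h1 : ∑ i ∈ c.support, c i * V i ω = ∑ i ∈ J, c i * V i ω := by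
        refine Finset.sum_subset Finsupp.support_onFinset_subset fun i _ hi => ?_
        rw [Finsupp.notMem_support_iff.1 hi, zero_mul]
      rw [h1, ← Finset.sum_coe_sort J, Function.comp_apply]
      conv_lhs => rw [← Finset.univ_sum_single (J.restrict fun i => V i ω), map_sum]
      refine Finset.sum_congr rfl fun i _ => ?_
      have : (Pi.single i (J.restrict (fun i => V i ω) i) : J → ℝ) =
          V i ω • Pi.single i (1 : ℝ) := by
        rw [← Pi.single_smul]
        simp
      have hci : c i = L (Pi.single i 1) := dif_pos i.2
      rw [this, map_smul, smul_eq_mul, mul_comm, hci]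
    rw [hc]
    exact hlin c
  have hs' : MeasurableSet[MeasurableSpace.comap (fun ω i => V i ω) MeasurableSpace.pi] s := by
    convert hs using 1
    simp only [MeasurableSpace.pi, MeasurableSpace.comap_iSup, MeasurableSpace.comap_comp]
    rfl
  obtain ⟨B, hB, rfl⟩ := hs'
  have hsm := hVm hB
  have key : μ ((fun ω i => V i ω) ⁻¹' B) = ν ((fun ω i => V i ω) ⁻¹' B) := by
    rw [← Measure.map_apply hVm hB, hproj, Measure.map_apply hVm hB]
  rw [integral_eq_lintegral_pos_part_sub_lintegral_neg_part hDi.integrableOn,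
    ← withDensity_apply _ hsm, ← withDensity_apply _ hsm]
  exact sub_eq_zero.2 (congrArg _ key)

end Totality

/-! ### Wick exponentials, the S-transform and its injectivity. -/

section WickExponential

variable {Ω : Type*} [MeasurableSpace Ω] {P : Measure Ω} {W : ℝ → Ω → ℝ} [IsProbabilityMeasure P]

theorem aestronglyMeasurable_wickExp (hW : IsBrownianMotion W P) (g : L2Unit) :
    AEStronglyMeasurable (wickExp hW g) P := by
  have := (Lp.aestronglyMeasurable (wienerIntegral hW g)).aemeasurable
  exact AEMeasurable.aestronglyMeasurable (by unfold wickExp; fun_prop)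

theorem wickExp_pos (hW : IsBrownianMotion W P) (g : L2Unit) (ω : Ω) : 0 < wickExp hW g ω :=
  Real.exp_pos _

theorem integrable_wickExp (hW : IsBrownianMotion W P) (g : L2Unit) :
    Integrable (wickExp hW g) P := by
  have h := integrable_exp_mul_gaussianReal (μ := 0) (v := (‖g‖ ^ 2).toNNReal) 1
  rw [← map_wienerIntegral hW, integrable_map_measure (by fun_prop)
    (Lp.aestronglyMeasurable _).aemeasurable] at h
  refine (h.mul_const (Real.exp (-(‖g‖ ^ 2 / 2)))).congr (ae_of_all _ fun ω => ?_)
  simp [wickExp, sub_eq_add_neg, Real.exp_add]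

theorem integral_wickExp (hW : IsBrownianMotion W P) (g : L2Unit) :
    ∫ ω, wickExp hW g ω ∂P = 1 := by
  have h := mgf_gaussianReal (map_wienerIntegral hW g) 1
  rw [mgf, Real.coe_toNNReal _ (sq_nonneg _)] at h
  simp only [wickExp, sub_eq_add_neg, Real.exp_add]
  rw [integral_mul_const]
  simp only [one_mul] at h
  rw [h, ← Real.exp_add]
  simp

/-- The cross term of `‖g + h‖²` produces the factor. With `E e^{◇I(g)} = 1` it yields the
S-transform, the Gram matrix and the change of measure used below. -/
theorem wickExp_mul (hW : IsBrownianMotion W P) (g h : L2Unit) :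
    (fun ω => wickExp hW g ω * wickExp hW h ω) =ᵐ[P]
      fun ω => Real.exp (inner ℝ g h) * wickExp hW (g + h) ω := by
  have h1 := Lp.coeFn_add (wienerIntegral hW g) (wienerIntegral hW h)
  rw [← map_add] at h1
  filter_upwards [h1] with ω hω
  rw [wickExp, wickExp, wickExp, ← Real.exp_add, ← Real.exp_add, hω, norm_add_sq_real,
    Pi.add_apply]
  congr 1
  ring

theorem integrable_wickExp_mul_wickExp (hW : IsBrownianMotion W P) (g h : L2Unit) :
    Integrable (fun ω => wickExp hW g ω * wickExp hW h ω) P :=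
  ((integrable_wickExp hW _).const_mul _).congr (wickExp_mul hW g h).symm

theorem memLp_wickExp (hW : IsBrownianMotion W P) (g : L2Unit) : MemLp (wickExp hW g) 2 P := by
  rw [memLp_two_iff_integrable_sq (aestronglyMeasurable_wickExp hW g)]
  simpa [sq] using integrable_wickExp_mul_wickExp hW g g

theorem sTransform_wickExp (hW : IsBrownianMotion W P) (f g : L2Unit) :
    sTransform hW (wickExp hW f) g = Real.exp (inner ℝ f g) := by
  rw [sTransform, integral_congr_ae (wickExp_mul hW f g), integral_const_mul, integral_wickExp,
    mul_one]

theorem wickExp_zero (hW : IsBrownianMotion W P) : wickExp hW 0 =ᵐ[P] fun _ => 1 := by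
  have h := Lp.coeFn_zero ℝ 2 P
  filter_upwards [h] with ω hω
  rw [wickExp, map_zero, hω]
  simp

theorem isWickProduct_wickExp (hW : IsBrownianMotion W P) (f g : L2Unit) :
    IsWickProduct hW (wickExp hW f) (wickExp hW g) (wickExp hW (f + g)) :=
  ⟨memLp_wickExp hW f, memLp_wickExp hW g, memLp_wickExp hW _, fun k => by
    rw [sTransform_wickExp, sTransform_wickExp, sTransform_wickExp, inner_add_left, Real.exp_add]⟩

/-- The Wick exponential as an element of `L²(Ω)`. -/
noncomputable def wickLp (hW : IsBrownianMotion W P) (g : L2Unit) : Lp ℝ 2 P :=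
  (memLp_wickExp hW g).toLp (wickExp hW g)

theorem wickLp_coeFn (hW : IsBrownianMotion W P) (g : L2Unit) :
    wickLp hW g =ᵐ[P] wickExp hW g :=
  (memLp_wickExp hW g).coeFn_toLp

theorem inner_toLp {Y Z : Ω → ℝ} (hY : MemLp Y 2 P) (hZ : MemLp Z 2 P) :
    inner ℝ (hY.toLp Y) (hZ.toLp Z) = ∫ ω, Y ω * Z ω ∂P := by
  rw [L2.inner_def]
  refine integral_congr_ae ?_
  filter_upwards [hY.coeFn_toLp, hZ.coeFn_toLp] with ω h1 h2
  simp [h1, h2, mul_comm]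

theorem sTransform_eq_inner (hW : IsBrownianMotion W P) {Y : Ω → ℝ} (hY : MemLp Y 2 P)
    (g : L2Unit) : sTransform hW Y g = inner ℝ (hY.toLp Y) (wickLp hW g) :=
  (inner_toLp hY (memLp_wickExp hW g)).symm

theorem sTransform_coeFn (hW : IsBrownianMotion W P) (Y : Lp ℝ 2 P) (g : L2Unit) :
    sTransform hW Y g = inner ℝ Y (wickLp hW g) := by
  rw [sTransform_eq_inner hW (Lp.memLp Y), Lp.toLp_coeFn]

theorem sTransform_congr (hW : IsBrownianMotion W P) {Y Z : Ω → ℝ} (h : Y =ᵐ[P] Z)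
    (g : L2Unit) : sTransform hW Y g = sTransform hW Z g :=
  integral_congr_ae (by filter_upwards [h] with ω hω; rw [hω])

theorem inner_wickLp (hW : IsBrownianMotion W P) (g h : L2Unit) :
    inner ℝ (wickLp hW g) (wickLp hW h) = Real.exp (inner ℝ g h) := by
  rw [wickLp, ← sTransform_eq_inner, sTransform_wickExp]

theorem norm_wickLp_sq (hW : IsBrownianMotion W P) (g : L2Unit) :
    ‖wickLp hW g‖ ^ 2 = Real.exp (‖g‖ ^ 2) := by
  rw [← real_inner_self_eq_norm_sq, inner_wickLp, real_inner_self_eq_norm_sq]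

/-- The Gram formula expresses the distance of two Wick exponentials through norms and inner
products of their exponents alone. -/
theorem continuous_wickLp (hW : IsBrownianMotion W P) : Continuous (wickLp hW) := by
  rw [continuous_iff_continuousAt]
  intro g
  rw [ContinuousAt, tendsto_iff_norm_sub_tendsto_zero]
  have h : ∀ h, ‖wickLp hW h - wickLp hW g‖ = Real.sqrt (Real.exp (‖h‖ ^ 2) -
      2 * Real.exp (inner ℝ h g) + Real.exp (‖g‖ ^ 2)) := by
    intro h
    rw [← norm_wickLp_sq hW, ← norm_wickLp_sq hW, ← inner_wickLp hW, ← norm_sub_sq_real,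
      Real.sqrt_sq (norm_nonneg _)]
  simp_rw [h]
  have hc : Continuous fun h : L2Unit => Real.sqrt (Real.exp (‖h‖ ^ 2) -
      2 * Real.exp (inner ℝ h g) + Real.exp (‖g‖ ^ 2)) := by fun_prop
  convert hc.tendsto g using 2
  rw [real_inner_self_eq_norm_sq]
  ring_nf
  simp

theorem IsBrownianMotion.pastSigma_le (hW : IsBrownianMotion W P) {t : ℝ} (ht : t ≤ 1) :
    pastSigma W t ≤ ‹MeasurableSpace Ω› :=
  iSup₂_le fun s hs => (hW.measurable s ⟨hs.1, hs.2.trans ht⟩).comap_le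

/-- The Wick exponentials are total: a random variable with vanishing S-transform vanishes. -/
theorem ae_eq_zero_of_sTransform_eq_zero (hW : IsBrownianMotion W P) (hgen : IsGeneratedBy W P)
    {D : Ω → ℝ} (hD : ∀ g, Integrable (fun ω => D ω * wickExp hW g ω) P)
    (h0 : ∀ g, sTransform hW D g = 0) : D =ᵐ[P] 0 := by
  -- Exponentials of linear combinations of values of `W` are multiples of Wick exponentials of step
  -- functions, which links `h0` with the totality criterion.
  have hstep : ∀ c : unitInterval →₀ ℝ,
      (fun ω => D ω * Real.exp (∑ t ∈ c.support, c t * W t ω)) =ᵐ[P] fun ω =>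
        Real.exp (‖stepFunction c‖ ^ 2 / 2) * (D ω * wickExp hW (stepFunction c) ω) := by
    intro c
    filter_upwards [stepIntegral_coeFn hW c] with ω hω
    rw [wickExp, wienerIntegral_stepFunction, hω, mul_left_comm, ← Real.exp_add]
    congr 2
    ring
  have hDi : Integrable D P := by
    refine (hD 0).congr ?_
    filter_upwards [wickExp_zero hW] with ω hω
    rw [hω, mul_one]
  refine hDi.ae_eq_zero_of_forall_setIntegral_eq_zero fun s hs _ => ?_
  obtain ⟨s', hs', hss'⟩ := hgen s hs
  rw [setIntegral_congr_set hss']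
  refine setIntegral_eq_zero_of_forall_integral_exp_eq_zero
    (V := fun t : unitInterval => W t) (fun t => hW.measurable t t.2) ?_ ?_ ?_
  · exact fun c => ((hD _).const_mul _).congr (hstep c).symm
  · intro c
    rw [integral_congr_ae (hstep c), integral_const_mul]
    exact mul_eq_zero_of_right _ (h0 _)
  · rwa [pastSigma, iSup_subtype'] at hs'

end WickExponential

/-! ### Scalar linear integral equations with integrable coefficients. -/

section LinearODE

/-- `f` is bounded by some `C` on the interval, and `exp` is Lipschitz with constant `e^C` on `(-∞,
C]`. -/
theorem absolutelyContinuousOnInterval_exp {f : ℝ → ℝ} {a b : ℝ}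
    (hf : AbsolutelyContinuousOnInterval f a b) :
    AbsolutelyContinuousOnInterval (fun x => Real.exp (f x)) a b := by
  obtain ⟨C, hC⟩ := hf.exists_bound
  have hlip : ∀ x ∈ uIcc a b, ∀ y ∈ uIcc a b,
      dist (Real.exp (f x)) (Real.exp (f y)) ≤ Real.exp C * dist (f x) (f y) := by
    intro x hx y hy
    have h := Convex.norm_image_sub_le_of_norm_deriv_le (f := Real.exp) (s := Iic C)
      (C := Real.exp C) (fun _ _ => Real.differentiableAt_exp)
      (fun z hz => by
        rw [Real.deriv_exp, Real.norm_of_nonneg (Real.exp_pos _).le]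
        exact Real.exp_le_exp.2 hz) (convex_Iic C)
      ((le_abs_self _).trans (hC y hy)) ((le_abs_self _).trans (hC x hx))
    simpa [dist_eq_norm] using h
  have hf' := hf.const_mul (Real.exp C)
  rw [AbsolutelyContinuousOnInterval] at hf ⊢
  have h0 := Tendsto.const_mul (Real.exp C) hf
  rw [mul_zero] at h0
  refine squeeze_zero' (.of_forall fun _ => Finset.sum_nonneg fun _ _ => dist_nonneg) ?_ h0
  filter_upwards [mem_inf_of_right (mem_principal_self _)] with E hE
  rw [Finset.mul_sum]
  exact Finset.sum_le_sum fun i hi => hlip _ (hE.1 i hi).1 _ (hE.1 i hi).2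

variable {b : ℝ → ℝ}

theorem ae_hasDerivAt_integral (hb : IntervalIntegrable b volume 0 1) :
    ∀ᵐ x, x ∈ uIcc (0 : ℝ) 1 → HasDerivAt (fun t => ∫ s in (0 : ℝ)..t, b s) (b x) x := by
  filter_upwards [hb.ae_hasDerivAt_integral] with x hx hxm
  exact hx hxm 0 (by simp)

/-- As `b` is only integrable, the exponential has the expected derivative only almost everywhere;
absolute continuity restores the fundamental theorem of calculus. -/
theorem integral_mul_exp_integral (hb : IntervalIntegrable b volume 0 1) {t : ℝ}
    (ht : t ∈ Icc (0 : ℝ) 1) :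
    ∫ s in (0 : ℝ)..t, b s * Real.exp (∫ r in (0 : ℝ)..s, b r) =
      Real.exp (∫ s in (0 : ℝ)..t, b s) - 1 := by
  have hsub : uIcc 0 t ⊆ uIcc (0 : ℝ) 1 := by
    rw [uIcc_of_le ht.1, uIcc_of_le zero_le_one]
    exact Icc_subset_Icc_right ht.2
  have hac := (absolutelyContinuousOnInterval_exp
    (hb.absolutelyContinuousOnInterval_intervalIntegral (c := 0) (by simp))).mono hsub
  have h := hac.integral_deriv_eq_sub
  simp only [intervalIntegral.integral_same, Real.exp_zero] at h
  rw [← h]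
  refine intervalIntegral.integral_congr_ae ?_
  filter_upwards [ae_hasDerivAt_integral hb] with x hx hxm
  rw [((hx (hsub (uIoc_subset_uIcc hxm))).exp).deriv, mul_comm]

/-- Integrating factor: `y e^{-B}` is absolutely continuous with derivative zero almost everywhere,
hence constant. The primitive `y` stands in for `x`, which agrees with it on `[0,1]` but is
unconstrained elsewhere. -/
theorem eq_mul_exp_of_integral_eq (hb : IntervalIntegrable b volume 0 1) {x : ℝ → ℝ} {x₀ : ℝ}
    (hbx : IntervalIntegrable (fun s => b s * x s) volume 0 1)
    (hx : ∀ t ∈ Icc (0 : ℝ) 1, x t = x₀ + ∫ s in (0 : ℝ)..t, b s * x s) {t : ℝ}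
    (ht : t ∈ Icc (0 : ℝ) 1) : x t = x₀ * Real.exp (∫ s in (0 : ℝ)..t, b s) := by
  let B : ℝ → ℝ := fun t => ∫ s in (0 : ℝ)..t, b s
  let y : ℝ → ℝ := fun t => x₀ + ∫ s in (0 : ℝ)..t, b s * x s
  have hBac : AbsolutelyContinuousOnInterval B 0 1 :=
    hb.absolutelyContinuousOnInterval_intervalIntegral (by simp)
  have hyac : AbsolutelyContinuousOnInterval y 0 1 :=
    AbsolutelyContinuousOnInterval.add
      (LipschitzOnWith.absolutelyContinuousOnInterval (K := 0)
        (LipschitzWith.const x₀).lipschitzOnWith)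
      (hbx.absolutelyContinuousOnInterval_intervalIntegral (by simp))
  have hzac := hyac.mul (absolutelyContinuousOnInterval_exp hBac.neg)
  obtain ⟨C, hC⟩ := hzac.const_of_ae_hasDerivAt_zero (by
    filter_upwards [ae_hasDerivAt_integral hb, ae_hasDerivAt_integral hbx] with s h1 h2 hs
    have h3 : HasDerivAt y (b s * x s) s := (h2 hs).const_add x₀
    convert! h3.mul (h1 hs).neg.exp using 1
    have hs' : s ∈ Icc (0 : ℝ) 1 := by rwa [uIcc_of_le zero_le_one] at hs
    have : y s = x s := (hx s hs').symm
    rw [this]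
    simp only [Pi.neg_apply]
    ring)
  have h0 := hC 0 (by simp)
  have h1 := hC t (by rwa [uIcc_of_le zero_le_one])
  rw [← h0] at h1
  simp only [Pi.mul_apply, Pi.neg_apply, B, y, intervalIntegral.integral_same, Real.exp_zero,
    inv_one, mul_one, add_zero, Real.exp_neg] at h1
  rw [hx t ht]
  exact (mul_inv_eq_iff_eq_mul₀ (Real.exp_ne_zero _)).1 h1

end LinearODE

/-! ### Measurable versions of processes and the drift integral. -/

section Processes

variable {Ω : Type*} [MeasurableSpace Ω] {P : Measure Ω} [IsProbabilityMeasure P]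

/-- The geometric rate makes the expected sum of the errors finite, so almost surely the errors are
summable. -/
theorem ae_tendsto_of_norm_sub_le {F : ℕ → Lp ℝ 2 P} {G : Lp ℝ 2 P}
    (h : ∀ k, ‖F k - G‖ ≤ (1 / 2 : ℝ) ^ k) :
    ∀ᵐ ω ∂P, Tendsto (fun k => F k ω) atTop (𝓝 (G ω)) := by
  have hmeas : ∀ k, AEMeasurable (fun ω => ‖F k ω - G ω‖ₑ) P := fun k =>
    ((Lp.aestronglyMeasurable (F k)).sub (Lp.aestronglyMeasurable G)).enorm
  have hle : ∀ k, ∫⁻ ω, ‖F k ω - G ω‖ₑ ∂P ≤ ENNReal.ofReal ((1 / 2 : ℝ) ^ k) := by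
    intro k
    calc ∫⁻ ω, ‖F k ω - G ω‖ₑ ∂P = eLpNorm (fun ω => F k ω - G ω) 1 P :=
          eLpNorm_one_eq_lintegral_enorm.symm
      _ ≤ eLpNorm (fun ω => F k ω - G ω) 2 P :=
          eLpNorm_le_eLpNorm_of_exponent_le (by norm_num)
            ((Lp.aestronglyMeasurable (F k)).sub (Lp.aestronglyMeasurable G))
      _ = ENNReal.ofReal ‖F k - G‖ := by
          rw [Lp.norm_def, ENNReal.ofReal_toReal (Lp.eLpNorm_ne_top _)]
          exact eLpNorm_congr_ae (Lp.coeFn_sub _ _).symm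
      _ ≤ _ := ENNReal.ofReal_le_ofReal (h k)
  have hsum : ∫⁻ ω, ∑' k, ‖F k ω - G ω‖ₑ ∂P ≠ ⊤ := by
    rw [lintegral_tsum hmeas]
    refine ne_top_of_le_ne_top ?_ (ENNReal.tsum_le_tsum hle)
    rw [← ENNReal.ofReal_tsum_of_nonneg (fun k => by positivity) summable_geometric_two]
    exact ENNReal.ofReal_ne_top
  filter_upwards [ae_lt_top' (AEMeasurable.tsum hmeas) hsum] with ω hω
  have h0 := ENNReal.tendsto_atTop_zero_of_tsum_ne_top hω.ne
  rw [tendsto_iff_edist_tendsto_0]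
  simpa [edist_eq_enorm_sub] using h0

/-- A continuous `L²(Ω)`-valued function on `[0,1]` has a jointly measurable version. -/
theorem exists_stronglyMeasurable_version {F : ℝ → Lp ℝ 2 P} (hF : ContinuousOn F (Icc 0 1)) :
    ∃ X : ℝ → Ω → ℝ, StronglyMeasurable (Function.uncurry X) ∧
      ∀ t ∈ Icc (0 : ℝ) 1, X t =ᵐ[P] F t := by
  have huc := isCompact_Icc.uniformContinuousOn_of_continuous hF
  rw [Metric.uniformContinuousOn_iff] at huc
  have hN : ∀ k : ℕ, ∃ N : ℕ, 0 < N ∧ ∀ s ∈ Icc (0 : ℝ) 1, ∀ t ∈ Icc (0 : ℝ) 1,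
      dist s t < 1 / N → dist (F s) (F t) < (1 / 2 : ℝ) ^ k := by
    intro k
    obtain ⟨δ, hδ, h⟩ := huc ((1 / 2 : ℝ) ^ k) (by positivity)
    obtain ⟨n, hn⟩ := exists_nat_one_div_lt hδ
    refine ⟨n + 1, n.succ_pos, fun s hs t ht hst => h s hs t ht (hst.trans ?_)⟩
    exact_mod_cast hn
  choose N hN0 hN using hN
  -- `F` is sampled at the left end of a cell of length `1 / N k`, chosen so that the `L²` error is
  -- below `2^{-k}`. Countably many sampled values give joint measurability, and `limUnder` is
  -- measurable even where the limit fails to exist.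
  let V : ℕ → ℝ × Ω → ℝ := fun k p => F ((⌊N k * p.1⌋₊ : ℝ) / N k) p.2
  have hV : ∀ k, StronglyMeasurable (V k) := by
    intro k
    have h1 : Measurable fun q : ℕ × Ω => F ((q.1 : ℝ) / N k) q.2 :=
      measurable_from_prod_countable_right fun m =>
        (Lp.stronglyMeasurable (F ((m : ℝ) / N k))).measurable
    have h2 : Measurable fun p : ℝ × Ω => (⌊(N k : ℝ) * p.1⌋₊, p.2) :=
      (Nat.measurable_floor.comp (measurable_fst.const_mul _)).prodMk measurable_snd
    exact (h1.comp h2).stronglyMeasurable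
  refine ⟨fun t ω => limUnder atTop fun k => V k (t, ω), ?_, fun t ht => ?_⟩
  · exact StronglyMeasurable.limUnder hV
  · have h := ae_tendsto_of_norm_sub_le (P := P)
      (F := fun k => F ((⌊N k * t⌋₊ : ℝ) / N k)) (G := F t) (fun k => ?_)
    · filter_upwards [h] with ω hω
      exact hω.limUnder_eq
    · have hNk : (0 : ℝ) < N k := Nat.cast_pos.2 (hN0 k)
      have hle : (⌊N k * t⌋₊ : ℝ) ≤ N k * t := Nat.floor_le (mul_nonneg hNk.le ht.1)
      have hlt := Nat.lt_floor_add_one (N k * t)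
      have hle' : (⌊N k * t⌋₊ : ℝ) / N k ≤ t := by
        rw [div_le_iff₀ hNk]
        linarith
      rw [← dist_eq_norm]
      refine (hN k _ ⟨by positivity, hle'.trans ht.2⟩ t ht ?_).le
      rw [dist_comm, Real.dist_eq, abs_of_nonneg (sub_nonneg.2 hle'), sub_lt_iff_lt_add,
        ← add_div, lt_div_iff₀ hNk]
      linarith

theorem eLpNorm_uncurry_le {u : ℝ → Ω → ℝ}
    (hm : AEStronglyMeasurable (Function.uncurry u) (unitMeasure.prod P)) {C : ENNReal}
    (h : ∀ᵐ s ∂unitMeasure, eLpNorm (u s) 2 P ≤ C) :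
    eLpNorm (Function.uncurry u) 2 (unitMeasure.prod P) ≤ C := by
  rw [eLpNorm_eq_lintegral_rpow_enorm_toReal (by norm_num) (by norm_num),
    lintegral_prod _ (by fun_prop)]
  have h2 : ∫⁻ s, ∫⁻ ω, ‖Function.uncurry u (s, ω)‖ₑ ^ (ENNReal.toReal 2) ∂P ∂unitMeasure ≤
      C ^ (2 : ℝ) := by
    refine (lintegral_mono_ae (g := fun _ => C ^ (2 : ℝ)) ?_).trans (by simp)
    filter_upwards [h] with s hs
    rw [eLpNorm_eq_lintegral_rpow_enorm_toReal (by norm_num) (by norm_num)] at hs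
    have := ENNReal.rpow_le_rpow (z := 2) hs (by norm_num)
    rw [← ENNReal.rpow_mul] at this
    simpa using this
  refine (ENNReal.rpow_le_rpow h2 (by norm_num)).trans ?_
  rw [← ENNReal.rpow_mul]
  simp

theorem memLp_uncurry {u : ℝ → Ω → ℝ}
    (hm : AEStronglyMeasurable (Function.uncurry u) (unitMeasure.prod P)) {C : ENNReal}
    (hC : C ≠ ⊤) (h : ∀ᵐ s ∂unitMeasure, eLpNorm (u s) 2 P ≤ C) :
    MemLp (Function.uncurry u) 2 (unitMeasure.prod P) :=
  ⟨hm, (eLpNorm_uncurry_le hm h).trans_lt hC.lt_top⟩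

/-- Cauchy–Schwarz in `ω` for fixed `s` leaves exactly the drift condition. This is the Fubini
hypothesis behind every exchange of expectation and drift integral. -/
theorem integrable_drift {X : ℝ → Ω → ℝ} {a : ℝ → ℝ} {Z : Ω → ℝ}
    (hX : AEStronglyMeasurable (Function.uncurry X) (unitMeasure.prod P))
    (ha : AEStronglyMeasurable a unitMeasure)
    (hd : ∫⁻ s, ‖a s‖ₑ * eLpNorm (X s) 2 P ∂unitMeasure < ⊤) (hZ : MemLp Z 2 P) :
    Integrable (fun p : ℝ × Ω => a p.1 * X p.1 p.2 * Z p.2) (unitMeasure.prod P) := by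
  have hm : AEStronglyMeasurable (fun p : ℝ × Ω => a p.1 * X p.1 p.2 * Z p.2)
      (unitMeasure.prod P) := (ha.comp_fst.mul hX).mul hZ.1.comp_snd
  refine ⟨hm, ?_⟩
  rw [hasFiniteIntegral_iff_enorm, lintegral_prod _ hm.enorm]
  have hle : ∀ᵐ s ∂unitMeasure, ∫⁻ ω, ‖a s * X s ω * Z ω‖ₑ ∂P ≤
      ‖a s‖ₑ * eLpNorm (X s) 2 P * eLpNorm Z 2 P := by
    filter_upwards [hX.prodMk_left] with s hs
    have h1 := eLpNorm_smul_le_mul_eLpNorm (p := 2) (q := 2) (r := 1) hZ.1 hs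
    rw [eLpNorm_one_eq_lintegral_enorm] at h1
    calc ∫⁻ ω, ‖a s * X s ω * Z ω‖ₑ ∂P = ∫⁻ ω, ‖a s‖ₑ * ‖((X s) • Z) ω‖ₑ ∂P := by
          refine lintegral_congr fun ω => ?_
          rw [mul_assoc, enorm_mul]
          rfl
      _ = ‖a s‖ₑ * ∫⁻ ω, ‖((X s) • Z) ω‖ₑ ∂P := lintegral_const_mul' _ _ (by simp)
      _ ≤ _ := by
          rw [mul_assoc]
          gcongr
          exact h1
  refine (lintegral_mono_ae hle).trans_lt ?_
  rw [lintegral_mul_const' _ _ hZ.2.ne]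
  exact ENNReal.mul_lt_top hd hZ.2

/-- An integral against `1_{[0,t)}` over `[0,1]` is an integral over `[0,t]`. -/
theorem integral_indicator_Ico {φ : ℝ → ℝ} {t : ℝ} (ht : t ∈ Icc (0 : ℝ) 1) :
    ∫ s, (Ico 0 t).indicator φ s ∂unitMeasure = ∫ s in (0 : ℝ)..t, φ s := by
  rw [integral_indicator measurableSet_Ico, unitMeasure,
    Measure.restrict_restrict measurableSet_Ico,
    inter_eq_self_of_subset_left (Ico_subset_Icc_self.trans (Icc_subset_Icc_right ht.2)),
    intervalIntegral.integral_of_le ht.1, integral_Ico_eq_integral_Ioc]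

theorem intervalIntegral_mul_eq {a : ℝ → ℝ} {x : ℝ → ℝ} {t : ℝ} (ht : t ∈ Icc (0 : ℝ) 1) :
    ∫ s in (0 : ℝ)..t, a s * x s = ∫ s, (Ico 0 t).indicator a s * x s ∂unitMeasure := by
  rw [← integral_indicator_Ico ht]
  refine integral_congr_ae (ae_of_all _ fun s => ?_)
  simp [indicator_mul_left]

theorem drift_indicator_lt_top {X : ℝ → Ω → ℝ} {a : ℝ → ℝ}
    (hd : ∫⁻ s, ‖a s‖ₑ * eLpNorm (X s) 2 P ∂unitMeasure < ⊤) (t : ℝ) :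
    ∫⁻ s, ‖(Ico 0 t).indicator a s‖ₑ * eLpNorm (X s) 2 P ∂unitMeasure < ⊤ := by
  refine (lintegral_mono fun s => ?_).trans_lt hd
  dsimp only
  gcongr
  rw [enorm_indicator_eq_indicator_enorm]
  exact indicator_le_self _ _ _

theorem integrable_drift_mul {X : ℝ → Ω → ℝ} {a : ℝ → ℝ} {Z : Ω → ℝ}
    (hX : AEStronglyMeasurable (Function.uncurry X) (unitMeasure.prod P))
    (ha : AEStronglyMeasurable a unitMeasure)
    (hd : ∫⁻ s, ‖a s‖ₑ * eLpNorm (X s) 2 P ∂unitMeasure < ⊤) (hZ : MemLp Z 2 P)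
    {t : ℝ} (ht : t ∈ Icc (0 : ℝ) 1) :
    Integrable (fun ω => (∫ s in (0 : ℝ)..t, a s * X s ω) * Z ω) P := by
  have h := (integrable_drift hX (ha.indicator (measurableSet_Ico (a := (0 : ℝ)) (b := t)))
    (drift_indicator_lt_top hd t) hZ).integral_prod_right
  refine h.congr (ae_of_all _ fun ω => ?_)
  dsimp only
  rw [integral_mul_const, intervalIntegral_mul_eq (x := fun s => X s ω) ht]

theorem integral_drift_mul {X : ℝ → Ω → ℝ} {a : ℝ → ℝ} {Z : Ω → ℝ}
    (hX : AEStronglyMeasurable (Function.uncurry X) (unitMeasure.prod P))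
    (ha : AEStronglyMeasurable a unitMeasure)
    (hd : ∫⁻ s, ‖a s‖ₑ * eLpNorm (X s) 2 P ∂unitMeasure < ⊤) (hZ : MemLp Z 2 P)
    {t : ℝ} (ht : t ∈ Icc (0 : ℝ) 1) :
    ∫ ω, (∫ s in (0 : ℝ)..t, a s * X s ω) * Z ω ∂P =
      ∫ s in (0 : ℝ)..t, a s * ∫ ω, X s ω * Z ω ∂P := by
  have h := integral_integral_swap
    (f := fun s ω => (Ico 0 t).indicator a s * X s ω * Z ω) (integrable_drift hX
    (ha.indicator (measurableSet_Ico (a := (0 : ℝ)) (b := t))) (drift_indicator_lt_top hd t) hZ)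
  rw [intervalIntegral_mul_eq (x := fun s => ∫ ω, X s ω * Z ω ∂P) ht]
  simp_rw [mul_assoc, integral_const_mul] at h
  rw [h]
  refine integral_congr_ae (ae_of_all _ fun ω => ?_)
  dsimp only
  rw [intervalIntegral_mul_eq (x := fun s => X s ω) ht, ← integral_mul_const]
  simp_rw [mul_assoc]

/-- The drift of a process with a continuous `L²(Ω)`-valued version is square integrable. -/
theorem memLp_drift {X : ℝ → Ω → ℝ} {a : ℝ → ℝ}
    (hX : AEStronglyMeasurable (Function.uncurry X) (unitMeasure.prod P))
    (ha : Integrable a unitMeasure)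
    (hd : ∫⁻ s, ‖a s‖ₑ * eLpNorm (X s) 2 P ∂unitMeasure < ⊤)
    {F : ℝ → Lp ℝ 2 P} (hF : ContinuousOn F (Icc 0 1))
    (hXF : ∀ t ∈ Icc (0 : ℝ) 1, X t =ᵐ[P] F t) {t : ℝ} (ht : t ∈ Icc (0 : ℝ) 1) :
    MemLp (fun ω => ∫ s in (0 : ℝ)..t, a s * X s ω) 2 P := by
  have hai : Integrable ((Ico 0 t).indicator a) unitMeasure := ha.indicator measurableSet_Ico
  have haF : Integrable (fun s => (Ico 0 t).indicator a s • F s) unitMeasure := by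
    obtain ⟨C, hC⟩ := isCompact_Icc.exists_bound_of_continuousOn hF
    refine hai.smul_bdd C (hF.aestronglyMeasurable measurableSet_Icc) ?_
    filter_upwards [ae_restrict_mem measurableSet_Icc] with s hs using hC s hs
  -- The Bochner integral lies in `L²(Ω)` by construction; it is matched with the pathwise integral
  -- by comparing integrals over all events.
  let G : Lp ℝ 2 P := ∫ s, (Ico 0 t).indicator a s • F s ∂unitMeasure
  have hone : MemLp (fun _ : Ω => (1 : ℝ)) 2 P := memLp_const 1
  have hint : Integrable (fun ω => ∫ s in (0 : ℝ)..t, a s * X s ω) P := by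
    simpa using integrable_drift_mul hX ha.1 hd hone ht
  refine (Lp.memLp G).ae_eq ?_
  refine Integrable.ae_eq_of_forall_setIntegral_eq _ _ ((Lp.memLp G).integrable (by norm_num))
    hint fun A hA _ => ?_
  have hZ : MemLp (A.indicator fun _ : Ω => (1 : ℝ)) 2 P := hone.indicator hA
  have h1 : ∀ Y : Ω → ℝ, ∫ ω in A, Y ω ∂P = ∫ ω, Y ω * A.indicator (fun _ => 1) ω ∂P := by
    intro Y
    rw [← integral_indicator hA]
    congr 1
    ext ω
    by_cases h : ω ∈ A <;> simp [h]
  have h2 : ∀ Y : Lp ℝ 2 P, ∫ ω, Y ω * A.indicator (fun _ => 1) ω ∂P = inner ℝ (hZ.toLp _) Y := by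
    intro Y
    have := inner_toLp hZ (Lp.memLp Y)
    rw [Lp.toLp_coeFn] at this
    rw [this]
    simp_rw [mul_comm]
  rw [h1, h1, h2, integral_drift_mul hX ha.1 hd hZ ht,
    intervalIntegral_mul_eq (x := fun s => ∫ ω, X s ω * A.indicator (fun _ => 1) ω ∂P) ht,
    ← integral_inner haF]
  refine integral_congr_ae ?_
  filter_upwards [ae_restrict_mem measurableSet_Icc] with s hs
  rw [real_inner_smul_right, ← h2]
  congr 1
  refine integral_congr_ae ?_
  filter_upwards [hXF s hs] with ω hω
  rw [hω]

end Processes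

/-! ### The functions `1_{[0,t)} σ` and their continuity in `t`. -/

section Cutoff

/-- The element `1_{[0,t)} σ` of `L²([0,1])`. -/
noncomputable def cutoff {σ : ℝ → ℝ} (hσ : MemLp σ 2 unitMeasure) (t : ℝ) : L2Unit :=
  (memLp_restrict hσ t).toLp ((Ico 0 t).indicator σ)

variable {σ : ℝ → ℝ} (hσ : MemLp σ 2 unitMeasure)

theorem cutoff_coeFn (t : ℝ) : cutoff hσ t =ᵐ[unitMeasure] (Ico 0 t).indicator σ :=
  (memLp_restrict hσ t).coeFn_toLp

theorem inner_cutoff (g : L2Unit) {t : ℝ} (ht : t ∈ Icc (0 : ℝ) 1) :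
    inner ℝ g (cutoff hσ t) = ∫ s in (0 : ℝ)..t, σ s * g s := by
  rw [L2.inner_def, intervalIntegral_mul_eq (x := g) ht]
  refine integral_congr_ae ?_
  filter_upwards [cutoff_coeFn hσ t] with s hs
  simp [hs]

theorem inner_cutoff_cutoff {τ : ℝ → ℝ} (hτ : MemLp τ 2 unitMeasure) {s t : ℝ}
    (hs : s ∈ Icc (0 : ℝ) 1) (hst : s ≤ t) :
    inner ℝ (cutoff hτ t) (cutoff hσ s) = ∫ r in (0 : ℝ)..s, σ r * τ r := by
  rw [inner_cutoff hσ _ hs, intervalIntegral_mul_eq (x := cutoff hτ t) hs,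
    intervalIntegral_mul_eq (x := τ) hs]
  refine integral_congr_ae ?_
  filter_upwards [cutoff_coeFn hτ t] with r hr
  rw [hr]
  by_cases h : r ∈ Ico 0 s
  · rw [indicator_of_mem (s := Ico 0 t) ⟨h.1, h.2.trans_le hst⟩]
  · simp [h]

theorem norm_cutoff_sub_sq {s t : ℝ} (hs : s ∈ Icc (0 : ℝ) 1) (ht : t ∈ Icc (0 : ℝ) 1) :
    ‖cutoff hσ t - cutoff hσ s‖ ^ 2 =
      |(∫ r in (0 : ℝ)..t, σ r * σ r) - ∫ r in (0 : ℝ)..s, σ r * σ r| := by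
  wlog hst : s ≤ t generalizing s t
  · rw [norm_sub_rev, abs_sub_comm]
    exact this ht hs (le_of_not_ge hst)
  have h := norm_sub_sq_real (cutoff hσ t) (cutoff hσ s)
  rw [inner_cutoff_cutoff hσ hσ hs hst, ← real_inner_self_eq_norm_sq (cutoff hσ t),
    ← real_inner_self_eq_norm_sq (cutoff hσ s), inner_cutoff_cutoff hσ hσ hs le_rfl,
    inner_cutoff_cutoff hσ hσ ht le_rfl] at h
  have h2 : ‖cutoff hσ t - cutoff hσ s‖ ^ 2 =
      (∫ r in (0 : ℝ)..t, σ r * σ r) - ∫ r in (0 : ℝ)..s, σ r * σ r := by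
    rw [h]
    ring
  rw [← h2, abs_of_nonneg (sq_nonneg _)]

theorem continuousOn_integral {φ : ℝ → ℝ} (hφ : Integrable φ unitMeasure) :
    ContinuousOn (fun t => ∫ s in (0 : ℝ)..t, φ s) (Icc 0 1) := by
  have h := intervalIntegral.continuousOn_primitive_interval (f := φ) (μ := volume)
    (a := (0 : ℝ)) (b := 1) (by rwa [uIcc_of_le zero_le_one])
  rwa [uIcc_of_le zero_le_one] at h

theorem intervalIntegrable_of_unitMeasure {φ : ℝ → ℝ} (hφ : Integrable φ unitMeasure) :
    IntervalIntegrable φ volume 0 1 :=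
  (intervalIntegrable_iff_integrableOn_Icc_of_le zero_le_one).2 hφ

theorem continuousOn_cutoff : ContinuousOn (cutoff hσ) (Icc 0 1) := by
  have hq := continuousOn_integral (hσ.integrable_mul hσ)
  intro s hs
  have h := hq s hs
  rw [ContinuousWithinAt, tendsto_iff_norm_sub_tendsto_zero] at h ⊢
  have h' := h.sqrt
  rw [Real.sqrt_zero] at h'
  refine h'.congr' ?_
  filter_upwards [self_mem_nhdsWithin] with t ht
  rw [Real.norm_eq_abs]
  simp only [Pi.mul_apply]
  rw [← norm_cutoff_sub_sq hσ hs ht, Real.sqrt_sq (norm_nonneg _)]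

end Cutoff

/-! ### Existence and uniqueness for the Skorohod equation. -/

section Solution

variable {Ω : Type*} [MeasurableSpace Ω] {P : Measure Ω} [IsProbabilityMeasure P]
  {W : ℝ → Ω → ℝ}

theorem sTransform_const_mul (hW : IsBrownianMotion W P) (c : ℝ) (Y : Ω → ℝ) (g : L2Unit) :
    sTransform hW (fun ω => c * Y ω) g = c * sTransform hW Y g := by
  simp_rw [sTransform, mul_assoc, integral_const_mul]

/-- The solution of the linear Skorohod SDE, as a function with values in `L²(Ω)`. -/
noncomputable def wickSolution (hW : IsBrownianMotion W P) (f : L2Unit) {σ : ℝ → ℝ}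
    (hσ : MemLp σ 2 unitMeasure) (a : ℝ → ℝ) (t : ℝ) : Lp ℝ 2 P :=
  Real.exp (∫ s in (0 : ℝ)..t, a s) • wickLp hW (f + cutoff hσ t)

variable (hW : IsBrownianMotion W P) (f : L2Unit) {σ : ℝ → ℝ} (hσ : MemLp σ 2 unitMeasure)
  {a : ℝ → ℝ}

theorem wickSolution_coeFn (t : ℝ) : wickSolution hW f hσ a t =ᵐ[P] fun ω =>
    wickExp hW (f + cutoff hσ t) ω * Real.exp (∫ s in (0 : ℝ)..t, a s) := by
  rw [wickSolution]
  filter_upwards [Lp.coeFn_smul (Real.exp (∫ s in (0 : ℝ)..t, a s)) (wickLp hW (f + cutoff hσ t)),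
    wickLp_coeFn hW (f + cutoff hσ t)] with ω h1 h2
  rw [h1, Pi.smul_apply, h2, smul_eq_mul, mul_comm]

theorem continuousOn_wickSolution (ha : Integrable a unitMeasure) :
    ContinuousOn (wickSolution hW f hσ a) (Icc 0 1) :=
  (continuousOn_integral ha).rexp.smul ((continuous_wickLp hW).comp_continuousOn
    (continuousOn_const.add (continuousOn_cutoff hσ)))

theorem sTransform_wickSolution (ha : Integrable a unitMeasure) (g : L2Unit) {t : ℝ}
    (ht : t ∈ Icc (0 : ℝ) 1) :
    sTransform hW (wickSolution hW f hσ a t) g =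
      Real.exp (inner ℝ f g) * Real.exp (∫ s in (0 : ℝ)..t, (a s + σ s * g s)) := by
  have hsub : uIcc 0 t ⊆ uIcc (0 : ℝ) 1 := by
    rw [uIcc_of_le ht.1, uIcc_of_le zero_le_one]
    exact Icc_subset_Icc_right ht.2
  have hσg : IntervalIntegrable (fun s => σ s * g s) volume 0 1 :=
    intervalIntegrable_of_unitMeasure (hσ.integrable_mul (Lp.memLp g))
  rw [intervalIntegral.integral_add ((intervalIntegrable_of_unitMeasure ha).mono_set hsub)
    (hσg.mono_set hsub),
    sTransform_coeFn, wickSolution, real_inner_smul_left, inner_wickLp, inner_add_left,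
    real_inner_comm g (cutoff hσ t), inner_cutoff hσ g ht, Real.exp_add, Real.exp_add]
  ring

theorem eLpNorm_coeFn (Y : Lp ℝ 2 P) : eLpNorm Y 2 P = ENNReal.ofReal ‖Y‖ := by
  rw [Lp.norm_def, ENNReal.ofReal_toReal (Lp.eLpNorm_ne_top _)]

theorem exists_eLpNorm_le {F : ℝ → Lp ℝ 2 P} (hF : ContinuousOn F (Icc 0 1)) {X : ℝ → Ω → ℝ}
    (hXF : ∀ t ∈ Icc (0 : ℝ) 1, X t =ᵐ[P] F t) :
    ∃ C : ENNReal, C ≠ ⊤ ∧ ∀ t ∈ Icc (0 : ℝ) 1, eLpNorm (X t) 2 P ≤ C := by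
  obtain ⟨C, hC⟩ := isCompact_Icc.exists_bound_of_continuousOn hF
  refine ⟨ENNReal.ofReal C, ENNReal.ofReal_ne_top, fun t ht => ?_⟩
  rw [eLpNorm_congr_ae (hXF t ht), eLpNorm_coeFn]
  exact ENNReal.ofReal_le_ofReal (hC t ht)

/-- The Skorohod integral is taken to be the residual of the equation, which then holds trivially;
the content is that this residual has the S-transform of the integral. The bound on `σ` puts the
integrand in `L²(Ω × [0,1])`. -/
theorem isSkorohodSolution_of_version {C : ℝ} (hC : ∀ s ∈ Icc (0 : ℝ) 1, |σ s| ≤ C)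
    (ha : Integrable a unitMeasure) {X : ℝ → Ω → ℝ}
    (hXm : StronglyMeasurable (Function.uncurry X))
    (hX : ∀ t ∈ Icc (0 : ℝ) 1, X t =ᵐ[P] wickSolution hW f hσ a t) :
    IsSkorohodSolution hW a σ (wickExp hW f) X := by
  have hF := continuousOn_wickSolution hW f hσ ha
  obtain ⟨K, hK, hKX⟩ := exists_eLpNorm_le hF hX
  have hXm' : AEStronglyMeasurable (Function.uncurry X) (unitMeasure.prod P) :=
    hXm.aestronglyMeasurable
  have hdrift : ∫⁻ s, ‖a s‖ₑ * eLpNorm (X s) 2 P ∂unitMeasure < ⊤ := by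
    refine (lintegral_mono_ae (g := fun s => ‖a s‖ₑ * K) ?_).trans_lt ?_
    · filter_upwards [ae_restrict_mem measurableSet_Icc] with s hs
      gcongr
      exact hKX s hs
    · rw [lintegral_mul_const' _ _ hK]
      exact ENNReal.mul_lt_top ha.2 hK.lt_top
  refine ⟨memLp_uncurry hXm' hK (by
    filter_upwards [ae_restrict_mem measurableSet_Icc] with s hs using hKX s hs), hdrift,
    fun t ht => ?_⟩
  have hXt : MemLp (X t) 2 P := (Lp.memLp _).ae_eq (hX t ht).symm
  have hf := memLp_wickExp hW f
  have hD := memLp_drift hXm' ha hdrift hF hX ht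
  refine ⟨fun ω => X t ω - wickExp hW f ω - ∫ s in (0 : ℝ)..t, a s * X s ω,
    ⟨?_, (hXt.sub hf).sub hD, fun g => ?_⟩, ae_of_all _ fun ω => by ring⟩
  · refine memLp_uncurry (C := ENNReal.ofReal C * K)
      ((hσ.1.indicator measurableSet_Ico).comp_fst.mul hXm')
      (ENNReal.mul_ne_top ENNReal.ofReal_ne_top hK) ?_
    filter_upwards [ae_restrict_mem measurableSet_Icc] with s hs
    refine (eLpNorm_const_smul_le (c := (Ico 0 t).indicator σ s) (f := X s)).trans ?_
    gcongr
    · rw [enorm_indicator_eq_indicator_enorm]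
      refine (indicator_le_self _ _ _).trans ?_
      rw [← ofReal_norm]
      exact ENNReal.ofReal_le_ofReal (hC s hs)
    · exact hKX s hs
  · have hg := memLp_wickExp hW g
    have hx : ∀ s ∈ Icc (0 : ℝ) 1, sTransform hW (X s) g =
        Real.exp (inner ℝ f g) * Real.exp (∫ s in (0 : ℝ)..s, (a s + σ s * g s)) := fun s hs => by
      rw [sTransform_congr hW (hX s hs), sTransform_wickSolution hW f hσ ha g hs]
    have hS : sTransform hW
        (fun ω => X t ω - wickExp hW f ω - ∫ s in (0 : ℝ)..t, a s * X s ω) g =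
        sTransform hW (X t) g - sTransform hW (wickExp hW f) g -
          ∫ s in (0 : ℝ)..t, a s * sTransform hW (X s) g := by
      simp only [sTransform]
      have h1 : Integrable (fun ω => X t ω * wickExp hW g ω) P := hXt.integrable_mul hg
      have h2 := integrable_wickExp_mul_wickExp hW f g
      have h3 : Integrable (fun ω => X t ω * wickExp hW g ω - wickExp hW f ω * wickExp hW g ω) P :=
        h1.sub h2
      simp_rw [sub_mul]
      rw [← integral_drift_mul hXm' ha.1 hdrift hg ht,
        integral_sub h3 (integrable_drift_mul hXm' ha.1 hdrift hg ht), integral_sub h1 h2]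
    have hR : ∫ s, sTransform hW (fun ω => (Ico 0 t).indicator σ s * X s ω) g * g s ∂unitMeasure =
        ∫ s in (0 : ℝ)..t, (σ s * g s) * sTransform hW (X s) g := by
      rw [intervalIntegral_mul_eq (a := fun s => σ s * g s)
        (x := fun s => sTransform hW (X s) g) ht]
      refine integral_congr_ae (ae_of_all _ fun s => ?_)
      dsimp only
      rw [sTransform_const_mul]
      by_cases hs : s ∈ Ico 0 t <;> simp [hs]
      ring
    have hsub : uIcc 0 t ⊆ uIcc (0 : ℝ) 1 := by
      rw [uIcc_of_le ht.1, uIcc_of_le zero_le_one]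
      exact Icc_subset_Icc_right ht.2
    have hai := intervalIntegrable_of_unitMeasure ha
    have hσi : IntervalIntegrable (fun s => σ s * g s) volume 0 1 :=
      intervalIntegrable_of_unitMeasure (hσ.integrable_mul (Lp.memLp g))
    have hxc : ContinuousOn (fun s => sTransform hW (X s) g) (uIcc 0 1) := by
      rw [uIcc_of_le zero_le_one]
      refine ContinuousOn.congr ?_ hx
      exact continuousOn_const.mul (continuousOn_integral
        (ha.add (hσ.integrable_mul (Lp.memLp g)))).rexp
    rw [hS, hR, sub_eq_iff_eq_add, ← intervalIntegral.integral_add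
      ((hσi.mul_continuousOn hxc).mono_set hsub) ((hai.mul_continuousOn hxc).mono_set hsub),
      hx t ht, sTransform_wickExp]
    have key := integral_mul_exp_integral (hai.add hσi) ht
    have : ∫ s in (0 : ℝ)..t, ((σ s * g s) * sTransform hW (X s) g +
        a s * sTransform hW (X s) g) = Real.exp (inner ℝ f g) *
        ∫ s in (0 : ℝ)..t, (a s + σ s * g s) *
          Real.exp (∫ r in (0 : ℝ)..s, (a r + σ r * g r)) := by
      rw [← intervalIntegral.integral_const_mul]
      refine intervalIntegral.integral_congr fun s hs => ?_
      rw [uIcc_of_le ht.1] at hs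
      rw [hx s ⟨hs.1, hs.2.trans ht.2⟩]
      ring
    rw [this, key]
    ring

theorem exists_isSkorohodSolution {C : ℝ} (hC : ∀ s ∈ Icc (0 : ℝ) 1, |σ s| ≤ C)
    (ha : Integrable a unitMeasure) :
    ∃ X : ℝ → Ω → ℝ, IsSkorohodSolution hW a σ (wickExp hW f) X ∧
      ∀ t ∈ Icc (0 : ℝ) 1, X t =ᵐ[P] wickSolution hW f hσ a t := by
  obtain ⟨X, hXm, hX⟩ :=
    exists_stronglyMeasurable_version (continuousOn_wickSolution hW f hσ ha)
  exact ⟨X, isSkorohodSolution_of_version hW f hσ hC ha hXm hX, hX⟩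

/-- For each `g` the S-transform of a solution satisfies a scalar linear integral equation with
coefficient `a + σ g`, and totality of the Wick exponentials concludes. -/
theorem IsSkorohodSolution.ae_eq (hgen : IsGeneratedBy W P) (ha : Integrable a unitMeasure)
    {X : ℝ → Ω → ℝ} (hX : IsSkorohodSolution hW a σ (wickExp hW f) X) {t : ℝ}
    (ht : t ∈ Icc (0 : ℝ) 1) : X t =ᵐ[P] wickSolution hW f hσ a t := by
  have hXm := hX.memLp.1
  -- At an individual `t` the square integrability of `X t` is not part of the definition of a
  -- solution. Integrability against each Wick exponential is therefore derived along with the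
  -- equation, and it is all that totality requires.
  have hsplit : ∀ g : L2Unit, ∀ t ∈ Icc (0 : ℝ) 1,
      Integrable (fun ω => X t ω * wickExp hW g ω) P ∧
      sTransform hW (X t) g = Real.exp (inner ℝ f g) +
        (∫ s in (0 : ℝ)..t, a s * sTransform hW (X s) g) +
        ∫ s in (0 : ℝ)..t, (σ s * g s) * sTransform hW (X s) g := by
    intro g t ht
    have hg := memLp_wickExp hW g
    obtain ⟨Y, ⟨-, hY, hSY⟩, hYX⟩ := hX.eqn t ht
    have h1 := integrable_wickExp_mul_wickExp hW f g
    have h2 := integrable_drift_mul hXm ha.1 hX.drift hg ht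
    have h3 : Integrable (fun ω => Y ω * wickExp hW g ω) P := hY.integrable_mul hg
    have h4 : (fun ω => X t ω * wickExp hW g ω) =ᵐ[P] fun ω =>
        wickExp hW f ω * wickExp hW g ω + (∫ s in (0 : ℝ)..t, a s * X s ω) * wickExp hW g ω +
          Y ω * wickExp hW g ω := by
      filter_upwards [hYX] with ω hω
      rw [hω]
      ring
    have h12 : Integrable (fun ω => wickExp hW f ω * wickExp hW g ω +
        (∫ s in (0 : ℝ)..t, a s * X s ω) * wickExp hW g ω) P := h1.add h2
    refine ⟨(h12.add h3).congr h4.symm, ?_⟩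
    rw [sTransform, integral_congr_ae h4, integral_add h12 h3, integral_add h1 h2,
      integral_drift_mul hXm ha.1 hX.drift hg ht]
    congr 1
    · congr 1
      exact sTransform_wickExp hW f g
    · refine (hSY g).trans ?_
      rw [intervalIntegral_mul_eq (a := fun s => σ s * g s)
        (x := fun s => sTransform hW (X s) g) ht]
      refine integral_congr_ae (ae_of_all _ fun s => ?_)
      dsimp only
      rw [sTransform_const_mul]
      by_cases hs : s ∈ Ico 0 t <;> simp [hs]
      ring
  have hSX : ∀ g : L2Unit, sTransform hW (X t) g =
      Real.exp (inner ℝ f g) * Real.exp (∫ s in (0 : ℝ)..t, (a s + σ s * g s)) := by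
    intro g
    have hg := memLp_wickExp hW g
    have hax : IntervalIntegrable (fun s => a s * sTransform hW (X s) g) volume 0 1 := by
      refine intervalIntegrable_of_unitMeasure
        ((integrable_drift hXm ha.1 hX.drift hg).integral_prod_left.congr (ae_of_all _ fun s => ?_))
      simp_rw [mul_assoc, integral_const_mul]
      rfl
    -- At `t = 1` the definition of the Skorohod integral includes `σ X ∈ L²(Ω × [0,1])`; pairing
    -- with `g ⊗ e^{◇I(g)}` gives the claim. The cut-off `[0,1)` omits only a null set.
    have hσx : IntervalIntegrable (fun s => (σ s * g s) * sTransform hW (X s) g) volume 0 1 := by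
      obtain ⟨Y, ⟨hu, -, -⟩, -⟩ := hX.eqn 1 (by simp)
      have hgZ : MemLp (fun p : ℝ × Ω => g p.1 * wickExp hW g p.2) 2 (unitMeasure.prod P) := by
        have hm : AEStronglyMeasurable (fun p : ℝ × Ω => g p.1 * wickExp hW g p.2)
          (unitMeasure.prod P) := (Lp.memLp g).1.comp_fst.mul hg.1.comp_snd
        rw [memLp_two_iff_integrable_sq hm]
        simp_rw [mul_pow]
        exact (Lp.memLp g).integrable_sq.mul_prod hg.integrable_sq
      refine intervalIntegrable_of_unitMeasure
        ((hu.integrable_mul hgZ).integral_prod_left.congr ?_)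
      have h1 : ∀ᵐ s ∂unitMeasure, s ≠ 1 := ae_restrict_of_ae (Measure.ae_ne volume 1)
      filter_upwards [ae_restrict_mem measurableSet_Icc, h1] with s hs hs1
      have hs' : s ∈ Ico (0 : ℝ) 1 := ⟨hs.1, lt_of_le_of_ne hs.2 hs1⟩
      simp only [Pi.mul_apply, Function.uncurry_apply_pair, indicator_of_mem hs', sTransform]
      rw [← integral_const_mul]
      refine integral_congr_ae (ae_of_all _ fun ω => ?_)
      dsimp only
      ring
    have hbx : (fun s => (a s + σ s * g s) * sTransform hW (X s) g) = fun s =>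
        a s * sTransform hW (X s) g + (σ s * g s) * sTransform hW (X s) g := by
      ext s
      ring
    refine eq_mul_exp_of_integral_eq (b := fun s => a s + σ s * g s)
      (x := fun s => sTransform hW (X s) g)
      (intervalIntegrable_of_unitMeasure (ha.add (hσ.integrable_mul (Lp.memLp g)))) ?_ ?_ ht
    · rw [hbx]
      exact hax.add hσx
    · intro t ht
      have hsub : uIcc 0 t ⊆ uIcc (0 : ℝ) 1 := by
        rw [uIcc_of_le ht.1, uIcc_of_le zero_le_one]
        exact Icc_subset_Icc_right ht.2
      rw [(hsplit g t ht).2, hbx, intervalIntegral.integral_add (hax.mono_set hsub)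
        (hσx.mono_set hsub), add_assoc]
  have hFi : ∀ g, Integrable (fun ω => wickSolution hW f hσ a t ω * wickExp hW g ω) P :=
    fun g => (Lp.memLp _).integrable_mul (memLp_wickExp hW g)
  have h0 := ae_eq_zero_of_sTransform_eq_zero hW hgen
    (D := fun ω => X t ω - wickSolution hW f hσ a t ω) (fun g => by
      simp_rw [sub_mul]
      exact (hsplit g t ht).1.sub (hFi g)) (fun g => by
      simp_rw [sTransform, sub_mul]
      rw [integral_sub (hsplit g t ht).1 (hFi g), sub_eq_zero]
      exact (hSX g).trans (sTransform_wickSolution hW f hσ ha g ht).symm)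
  filter_upwards [h0] with ω hω
  exact sub_eq_zero.1 hω

end Solution

/-! ### Conditional expectations given the grid values. -/

section Grid

/-- The grid point `k / n` of `[0,1]`. -/
noncomputable def gridPoint (n : ℕ) (k : Finset.Icc 1 n) : unitInterval :=
  ⟨(k : ℕ) / n, by positivity,
    div_le_one_of_le₀ (Nat.cast_le.2 (Finset.mem_Icc.1 k.2).2) (Nat.cast_nonneg n)⟩

/-- The step functions on the equidistant grid of mesh size `1 / n`. -/
noncomputable def gridSpan (n : ℕ) : Submodule ℝ L2Unit :=
  Submodule.span ℝ (range fun k : Finset.Icc 1 n => initialSegment (gridPoint n k))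

instance (n : ℕ) : FiniteDimensional ℝ (gridSpan n) :=
  FiniteDimensional.span_of_finite ℝ (finite_range _)

variable {Ω : Type*} {m : MeasurableSpace Ω} [mΩ : MeasurableSpace Ω] {P : Measure Ω}
  [IsProbabilityMeasure P] {W : ℝ → Ω → ℝ}

/-- The `g` for which `I(g)` is measurable with respect to `m` form a closed subspace. This serves
both the grid σ-field and the past of `W`. -/
theorem aestronglyMeasurable_wienerIntegral (hW : IsBrownianMotion W P)
    (hm : m ≤ mΩ) {T : Set L2Unit}
    (hT : ∀ g ∈ T, AEStronglyMeasurable[m] (wienerIntegral hW g) P) {g : L2Unit}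
    (hg : g ∈ (Submodule.span ℝ T).topologicalClosure) :
    AEStronglyMeasurable[m] (wienerIntegral hW g) P := by
  rw [← mem_lpMeas_iff_aestronglyMeasurable (𝕜 := ℝ)]
  have hle : Submodule.span ℝ T ≤
      (lpMeas ℝ ℝ m 2 P).comap (wienerIntegral hW).toLinearMap :=
    Submodule.span_le.2 fun x hx =>
      (mem_lpMeas_iff_aestronglyMeasurable (𝕜 := ℝ)).2 (hT x hx)
  have hcl : IsClosed ((lpMeas ℝ ℝ m 2 P).comap (wienerIntegral hW).toLinearMap : Set L2Unit) :=
    IsClosed.preimage (t := {Y : Lp ℝ 2 P | AEStronglyMeasurable[m] Y P})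
      (wienerIntegral hW).continuous (isClosed_aestronglyMeasurable hm)
  exact (Submodule.topologicalClosure_minimal _ hle hcl) hg

theorem aestronglyMeasurable_wickExp_of_wienerIntegral (hW : IsBrownianMotion W P)
    {g : L2Unit}
    (h : AEStronglyMeasurable[m] (wienerIntegral hW g) P) :
    AEStronglyMeasurable[m] (wickExp hW g) P :=
  Real.continuous_exp.comp_aestronglyMeasurable (h.sub (aestronglyMeasurable_const (m := m)))

theorem aestronglyMeasurable_wienerIntegral_initialSegment (hW : IsBrownianMotion W P)
    {t : unitInterval} (ht : Measurable[m] (W t)) :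
    AEStronglyMeasurable[m] (wienerIntegral hW (initialSegment t)) P := by
  rw [wienerIntegral_initialSegment]
  exact ⟨W t, ht.stronglyMeasurable, (hW.memLp t).coeFn_toLp⟩

theorem IsBrownianMotion.gridSigma_le (hW : IsBrownianMotion W P) (n : ℕ) :
    gridSigma W n ≤ ‹MeasurableSpace Ω› :=
  iSup₂_le fun k hk => (hW.measurable _ (gridPoint n ⟨k, hk⟩).2).comap_le

/-- `I(p)` is a function of the observations. For `k` in the span, `⟨p,k⟩ = ⟨h,k⟩`, so `e^{◇I(p)} -
e^{◇I(h)}` has vanishing S-transform at `k`. The totality criterion, applied to the observations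
only, makes its integral vanish over every event of the grid σ-field. -/
theorem condExp_wickExp (hW : IsBrownianMotion W P) (n : ℕ) (h : L2Unit) :
    wickExp hW ((gridSpan n).starProjection h) =ᵐ[P] P[wickExp hW h | gridSigma W n] := by
  have hm := hW.gridSigma_le n
  set p := (gridSpan n).starProjection h with hp
  have hpmem : p ∈ gridSpan n := Submodule.starProjection_apply_mem _ _
  refine ae_eq_condExp_of_forall_setIntegral_eq hm (integrable_wickExp hW h)
    (fun s _ _ => (integrable_wickExp hW p).integrableOn) (fun s hs _ => ?_) ?_
  · let V : Finset.Icc 1 n → Ω → ℝ := fun k => W (gridPoint n k)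
    let stp : (Finset.Icc 1 n →₀ ℝ) → L2Unit := fun c =>
      stepFunction (c.mapDomain (gridPoint n))
    have hstp : ∀ c, stp c ∈ gridSpan n := by
      intro c
      simp only [stp]
      induction c using Finsupp.induction_linear with
      | zero => simp
      | add c d hc hd =>
        rw [Finsupp.mapDomain_add, map_add]
        exact Submodule.add_mem _ hc hd
      | single k x =>
        rw [Finsupp.mapDomain_single, stepFunction_single]
        exact Submodule.smul_mem _ _ (Submodule.subset_span ⟨k, rfl⟩)
    have hI : ∀ c, (fun ω => ∑ k ∈ c.support, c k * V k ω) =ᵐ[P]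
        wienerIntegral hW (stp c) := by
      intro c
      simp only [stp]
      rw [wienerIntegral_stepFunction, stepIntegral, Finsupp.linearCombination_mapDomain,
        Finsupp.linearCombination_apply, Finsupp.sum]
      refine EventuallyEq.trans ?_ (Lp.coeFn_finsetSum _ _).symm
      have h : ∀ᵐ ω ∂P, ∀ k ∈ c.support,
          (c k • (hW.memLp (gridPoint n k)).toLp (W (gridPoint n k)) : Lp ℝ 2 P) ω =
            c k * V k ω := by
        rw [Filter.eventually_all_finset]
        intro k _
        filter_upwards [Lp.coeFn_smul (c k) ((hW.memLp (gridPoint n k)).toLp (W (gridPoint n k))),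
          (hW.memLp (gridPoint n k)).coeFn_toLp] with ω h1 h2
        rw [h1, Pi.smul_apply, h2, smul_eq_mul]
      filter_upwards [h] with ω hω
      rw [Finset.sum_apply]
      exact (Finset.sum_congr rfl hω).symm
    have hexp : ∀ (c : Finset.Icc 1 n →₀ ℝ),
        (fun ω => (wickExp hW p ω - wickExp hW h ω) *
          Real.exp (∑ k ∈ c.support, c k * V k ω)) =ᵐ[P] fun ω =>
          Real.exp (‖stp c‖ ^ 2 / 2) * (wickExp hW p ω * wickExp hW (stp c) ω -
            wickExp hW h ω * wickExp hW (stp c) ω) := by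
      intro c
      filter_upwards [hI c] with ω hω
      rw [hω, ← sub_mul, mul_left_comm]
      congr 1
      rw [wickExp, ← Real.exp_add]
      congr 1
      ring
    have hsub := setIntegral_eq_zero_of_forall_integral_exp_eq_zero (P := P) (V := V)
      (fun k => hW.measurable _ (gridPoint n k).2)
      (D := fun ω => wickExp hW p ω - wickExp hW h ω) (s := s) ?_ ?_ ?_
    · rwa [integral_sub (integrable_wickExp hW p).integrableOn
        (integrable_wickExp hW h).integrableOn, sub_eq_zero] at hsub
    · exact fun c => (((integrable_wickExp_mul_wickExp hW _ _).sub
        (integrable_wickExp_mul_wickExp hW _ _)).const_mul _).congr (hexp c).symm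
    · intro c
      have h1 := sTransform_wickExp hW p (stp c)
      have h2 := sTransform_wickExp hW h (stp c)
      have h3 : inner ℝ p (stp c) = inner ℝ h (stp c) := by
        rw [hp, Submodule.inner_starProjection_left_eq_right,
          Submodule.starProjection_eq_self_iff.2 (hstp c)]
      rw [sTransform] at h1 h2
      rw [integral_congr_ae (hexp c), integral_const_mul, integral_sub
        (integrable_wickExp_mul_wickExp hW _ _) (integrable_wickExp_mul_wickExp hW _ _), h1, h2,
        h3, sub_self, mul_zero]
    · rw [gridSigma, iSup_subtype'] at hs
      exact hs
  · refine aestronglyMeasurable_wickExp_of_wienerIntegral hW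
      (aestronglyMeasurable_wienerIntegral hW hm (T := range fun k : Finset.Icc 1 n =>
        initialSegment (gridPoint n k)) ?_ (Submodule.le_topologicalClosure _ hpmem))
    rintro _ ⟨k, rfl⟩
    refine aestronglyMeasurable_wienerIntegral_initialSegment hW ?_
    refine Measurable.mono (comap_measurable _) ?_ le_rfl
    exact le_iSup₂_of_le (f := fun (k : ℕ) (_ : k ∈ Finset.Icc 1 n) =>
      MeasurableSpace.comap (W ((k : ℝ) / (n : ℝ))) inferInstance) (k : ℕ) k.2 le_rfl

/-- Since `⟨h,p⟩ = ‖p‖²`, the cross term in `‖e^{◇I(h)} - e^{◇I(p)}‖²` is `-2 e^{‖p‖²}`. -/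
theorem optimalError_eq (hW : IsBrownianMotion W P) (n : ℕ) (h : L2Unit) {c : ℝ} (hc : 0 ≤ c)
    {Y : Ω → ℝ} (hY : Y =ᵐ[P] fun ω => c * wickExp hW h ω) :
    optimalError W P n Y = c * Real.sqrt (Real.exp (‖h‖ ^ 2) -
      Real.exp (‖(gridSpan n).starProjection h‖ ^ 2)) := by
  set p := (gridSpan n).starProjection h with hp
  have h1 : P[Y | gridSigma W n] =ᵐ[P] fun ω => c * wickExp hW p ω := by
    have h2 : P[Y | gridSigma W n] =ᵐ[P] P[c • wickExp hW h | gridSigma W n] :=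
      condExp_congr_ae hY
    filter_upwards [h2, condExp_smul c (wickExp hW h) (gridSigma W n) (μ := P),
      condExp_wickExp hW n h] with ω e1 e2 e3
    rw [e1, e2, Pi.smul_apply, ← e3, smul_eq_mul]
  have h2 : ∫ ω, (Y ω - (P[Y | gridSigma W n]) ω) ^ 2 ∂P =
      c ^ 2 * ‖wickLp hW h - wickLp hW p‖ ^ 2 := by
    rw [← real_inner_self_eq_norm_sq, L2.inner_def, ← integral_const_mul]
    refine integral_congr_ae ?_
    filter_upwards [hY, h1, Lp.coeFn_sub (wickLp hW h) (wickLp hW p), wickLp_coeFn hW h,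
      wickLp_coeFn hW p] with ω e1 e2 e3 e4 e5
    rw [e1, e2, e3, Pi.sub_apply, e4, e5]
    simp only [real_inner_self_eq_norm_sq, Real.norm_eq_abs, sq_abs]
    ring
  have h3 : inner ℝ h p = ‖p‖ ^ 2 := by
    rw [← real_inner_self_eq_norm_sq p, hp, Submodule.inner_starProjection_left_eq_right,
      Submodule.starProjection_eq_self_iff.2 (Submodule.starProjection_apply_mem _ _)]
  rw [optimalError, h2, norm_sub_sq_real, inner_wickLp, norm_wickLp_sq, norm_wickLp_sq, h3,
    Real.sqrt_mul (sq_nonneg c), Real.sqrt_sq hc]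
  congr 2
  ring

theorem norm_starProjection_sq {E : Type*} [NormedAddCommGroup E] [InnerProductSpace ℝ E]
    (K : Submodule ℝ E) [K.HasOrthogonalProjection] (h : E) :
    ‖K.starProjection h‖ ^ 2 = ‖h‖ ^ 2 - ‖h - K.starProjection h‖ ^ 2 := by
  have h3 : inner ℝ h (K.starProjection h) = ‖K.starProjection h‖ ^ 2 := by
    rw [← real_inner_self_eq_norm_sq (K.starProjection h),
      Submodule.inner_starProjection_left_eq_right,
      Submodule.starProjection_eq_self_iff.2 (Submodule.starProjection_apply_mem _ _)]
  rw [norm_sub_sq_real, h3]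
  ring

/-- After factoring out `e^A`, the squeeze is `x/(1+x) ≤ 1 - e^{-x} ≤ x` with `x = δ_n²`. -/
theorem tendsto_mul_sqrt_exp_sub {A L : ℝ} {δ : ℕ → ℝ} (hδ : ∀ n, 0 ≤ δ n)
    (h : Tendsto (fun n : ℕ => n * δ n) atTop (𝓝 L)) :
    Tendsto (fun n : ℕ => n * Real.sqrt (Real.exp A - Real.exp (A - δ n ^ 2))) atTop
      (𝓝 (L * Real.exp (A / 2))) := by
  have hδ0 : Tendsto δ atTop (𝓝 0) := by
    have h1 := h.mul (tendsto_inv_atTop_nhds_zero_nat (𝕜 := ℝ))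
    rw [mul_zero] at h1
    refine h1.congr' ?_
    filter_upwards [eventually_gt_atTop 0] with n hn
    have : (n : ℝ) ≠ 0 := Nat.cast_ne_zero.2 hn.ne'
    field_simp
  have hL : 0 ≤ L := ge_of_tendsto' h fun n => mul_nonneg (Nat.cast_nonneg n) (hδ n)
  have hsq : Tendsto (fun n : ℕ => (n : ℝ) ^ 2 * (1 - Real.exp (-δ n ^ 2))) atTop
      (𝓝 (L ^ 2)) := by
    have hlow : Tendsto (fun n : ℕ => (n * δ n) ^ 2 / (1 + δ n ^ 2)) atTop (𝓝 (L ^ 2)) := by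
      have := (h.pow 2).div ((hδ0.pow 2).const_add 1) (by norm_num)
      rw [zero_pow two_ne_zero] at this
      rw [add_zero, div_one] at this
      exact this
    refine tendsto_of_tendsto_of_tendsto_of_le_of_le hlow (h.pow 2) (fun n => ?_) (fun n => ?_)
    · have h1 : 1 / (1 + δ n ^ 2) ≥ Real.exp (-δ n ^ 2) := by
        rw [Real.exp_neg, ge_iff_le, ← one_div]
        exact one_div_le_one_div_of_le (by positivity) (by linarith [Real.add_one_le_exp (δ n ^ 2)])
      have h2 : (n * δ n) ^ 2 / (1 + δ n ^ 2) = (n : ℝ) ^ 2 * (1 - 1 / (1 + δ n ^ 2)) := by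
        have : 1 + δ n ^ 2 ≠ 0 := by positivity
        field_simp
        ring
      dsimp only
      rw [h2]
      gcongr
    · have h1 := Real.add_one_le_exp (-δ n ^ 2)
      simp only [mul_pow]
      gcongr
      linarith
  have h3 := (hsq.sqrt).mul_const (Real.exp (A / 2))
  rw [Real.sqrt_sq hL] at h3
  refine h3.congr fun n => ?_
  have h4 : Real.exp A - Real.exp (A - δ n ^ 2) =
      Real.exp (A / 2) ^ 2 * (1 - Real.exp (-δ n ^ 2)) := by
    rw [mul_sub, ← Real.exp_nat_mul, ← Real.exp_add]
    push_cast
    ring_nf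
  rw [h4, Real.sqrt_mul (sq_nonneg _), Real.sqrt_mul (sq_nonneg _),
    Real.sqrt_sq (Nat.cast_nonneg n), Real.sqrt_sq (Real.exp_pos _).le]
  ring

end Grid

/-! ### The rate of `L²` approximation by step functions. -/

section Asymptotics

/-- The index `k` of the grid interval `(k / n, (k + 1) / n]` which contains `s`. -/
noncomputable def gridIndex (n : ℕ) (s : ℝ) : ℕ := ⌈(n : ℝ) * s⌉₊ - 1

theorem measurable_gridIndex (n : ℕ) : Measurable (gridIndex n) :=
  (measurable_from_top (f := fun m : ℕ => m - 1)).comp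
    (Nat.measurable_ceil.comp (measurable_id.const_mul _))

theorem gridIndex_eq {n k : ℕ} (hn : 0 < n) {s : ℝ}
    (hs : s ∈ Ioc ((k : ℝ) / n) ((k + 1 : ℕ) / n)) : gridIndex n s = k := by
  have hn' : (0 : ℝ) < n := Nat.cast_pos.2 hn
  have h1 := hs.1
  have h2 := hs.2
  rw [div_lt_iff₀ hn'] at h1
  rw [le_div_iff₀ hn'] at h2
  have : ⌈(n : ℝ) * s⌉₊ = k + 1 := by
    rw [Nat.ceil_eq_iff (Nat.succ_ne_zero k)]
    exact ⟨by simpa [mul_comm] using h1, by simpa [mul_comm] using h2⟩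
  rw [gridIndex, this, Nat.add_sub_cancel]

theorem grid_le_succ (n k : ℕ) : (k : ℝ) / n ≤ (k + 1 : ℕ) / n := by
  gcongr
  exact Nat.le_succ k

theorem integral_grid {n : ℕ} {φ : ℝ → ℝ} {ψ : ℕ → ℝ → ℝ} {j : ℕ}
    (hψ : ∀ k < j, IntervalIntegrable (ψ k) volume ((k : ℝ) / n) ((k + 1 : ℕ) / n))
    (h : ∀ k < j, ∀ s ∈ Ioc ((k : ℝ) / n) ((k + 1 : ℕ) / n), φ s = ψ k s) :
    ∫ s in (0 : ℝ)..(j / n), φ s =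
      ∑ k ∈ Finset.range j, ∫ s in ((k : ℝ) / n)..((k + 1 : ℕ) / n), ψ k s := by
  have hu : ∀ k < j, EqOn (ψ k) φ (uIoc ((k : ℝ) / n) ((k + 1 : ℕ) / n)) := by
    intro k hk s hs
    rw [uIoc_of_le (grid_le_succ n k)] at hs
    exact (h k hk s hs).symm
  have h1 := intervalIntegral.sum_integral_adjacent_intervals (f := φ) (μ := volume)
    (a := fun k : ℕ => (k : ℝ) / n) (n := j) fun k hk => (hψ k hk).congr (hu k hk)
  simp only [Nat.cast_zero, zero_div] at h1
  rw [← h1]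
  refine Finset.sum_congr rfl fun k hk => ?_
  exact intervalIntegral.integral_congr_ae (ae_of_all _ fun s hs =>
    (hu k (Finset.mem_range.1 hk) hs).symm)

theorem integral_grid_unit {n : ℕ} (hn : 0 < n) {φ : ℝ → ℝ} {ψ : ℕ → ℝ → ℝ}
    (hψ : ∀ k < n, IntervalIntegrable (ψ k) volume ((k : ℝ) / n) ((k + 1 : ℕ) / n))
    (h : ∀ k < n, ∀ s ∈ Ioc ((k : ℝ) / n) ((k + 1 : ℕ) / n), φ s = ψ k s) :
    ∫ s in (0 : ℝ)..1, φ s =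
      ∑ k ∈ Finset.range n, ∫ s in ((k : ℝ) / n)..((k + 1 : ℕ) / n), ψ k s := by
  have := integral_grid hψ h
  rwa [div_self (Nat.cast_ne_zero.2 hn.ne')] at this

theorem integral_unitMeasure (φ : ℝ → ℝ) : ∫ s, φ s ∂unitMeasure = ∫ s in (0 : ℝ)..1, φ s := by
  rw [intervalIntegral.integral_of_le zero_le_one, integral_Icc_eq_integral_Ioc]

theorem norm_toLp_sq {φ : ℝ → ℝ} (hφ : MemLp φ 2 unitMeasure) :
    ‖hφ.toLp φ‖ ^ 2 = ∫ s in (0 : ℝ)..1, φ s ^ 2 := by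
  rw [← real_inner_self_eq_norm_sq, inner_toLp, integral_unitMeasure]
  simp_rw [sq]

theorem norm_toLp {φ : ℝ → ℝ} (hφ : MemLp φ 2 unitMeasure) : ‖hφ.toLp φ‖ = normL2 φ := by
  rw [normL2, ← norm_toLp_sq hφ, Real.sqrt_sq (norm_nonneg _)]

theorem exists_grid_interval {n : ℕ} (hn : 0 < n) {s : ℝ} (hs : s ∈ Ioc (0 : ℝ) 1) :
    ∃ k < n, s ∈ Ioc ((k : ℝ) / n) ((k + 1 : ℕ) / n) := by
  have hn' : (0 : ℝ) < n := Nat.cast_pos.2 hn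
  have h0 : 0 < (n : ℝ) * s := mul_pos hn' hs.1
  have hc : 0 < ⌈(n : ℝ) * s⌉₊ := Nat.ceil_pos.2 h0
  obtain ⟨k, hk⟩ := Nat.exists_eq_succ_of_ne_zero hc.ne'
  have h1 := (Nat.ceil_eq_iff (Nat.succ_ne_zero k)).1 hk
  have h2 : ⌈(n : ℝ) * s⌉₊ ≤ n := Nat.ceil_le.2 (by nlinarith [hs.2])
  refine ⟨k, by omega, ?_, ?_⟩
  · rw [div_lt_iff₀ hn']
    simpa [mul_comm] using h1.1
  · rw [le_div_iff₀ hn']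
    simpa [mul_comm] using h1.2

theorem ae_mem_Ioc : ∀ᵐ s ∂unitMeasure, s ∈ Ioc (0 : ℝ) 1 := by
  have h3 : ∀ᵐ x ∂unitMeasure, x ≠ 0 := ae_restrict_of_ae (Measure.ae_ne volume 0)
  filter_upwards [ae_restrict_mem measurableSet_Icc, h3] with s hs hs0
  exact ⟨lt_of_le_of_ne hs.1 (Ne.symm hs0), hs.2⟩

/-- A function which is bounded on each grid interval is square integrable. -/
theorem memLp_of_grid {n : ℕ} (hn : 0 < n) {φ : ℝ → ℝ} (hφ : AEStronglyMeasurable φ unitMeasure)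
    (C : ℕ → ℝ) (h : ∀ k < n, ∀ s ∈ Ioc ((k : ℝ) / n) ((k + 1 : ℕ) / n), |φ s| ≤ C k) :
    MemLp φ 2 unitMeasure := by
  refine MemLp.of_bound hφ (∑ k ∈ Finset.range n, |C k|) ?_
  filter_upwards [ae_mem_Ioc] with s hs
  obtain ⟨k, hk, hks⟩ := exists_grid_interval hn hs
  exact ((h k hk s hks).trans (le_abs_self _)).trans
    (Finset.single_le_sum (f := fun k => |C k|) (fun _ _ => abs_nonneg _) (Finset.mem_range.2 hk))

theorem measurable_comp_gridIndex (n : ℕ) (c : ℕ → ℝ) : Measurable fun s => c (gridIndex n s) :=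
  (measurable_from_top (f := c)).comp (measurable_gridIndex n)

theorem memLp_step {n : ℕ} (hn : 0 < n) (c : ℕ → ℝ) :
    MemLp (fun s => c (gridIndex n s)) 2 unitMeasure :=
  memLp_of_grid hn (measurable_comp_gridIndex n c).aestronglyMeasurable (fun k => |c k|)
    fun k _ s hs => by rw [gridIndex_eq hn hs]

theorem memLp_slope {n : ℕ} (hn : 0 < n) (c : ℕ → ℝ) :
    MemLp (fun s => c (gridIndex n s) * (s - (gridIndex n s : ℝ) / n - 1 / (2 * n))) 2
      unitMeasure := by
  have hn' : (0 : ℝ) < n := Nat.cast_pos.2 hn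
  refine memLp_of_grid hn ?_ (fun k => |c k| * (1 / n)) fun k _ s hs => ?_
  · exact ((measurable_comp_gridIndex n c).mul ((measurable_id.sub (measurable_comp_gridIndex n
      fun k => (k : ℝ) / n)).sub_const _)).aestronglyMeasurable
  · rw [gridIndex_eq hn hs, abs_mul]
    have h1 := hs.1
    have h2 := hs.2
    push_cast at h2
    rw [add_div] at h2
    gcongr
    rw [abs_le]
    have h3 : 1 / (2 * (n : ℝ)) = 1 / n / 2 := by field_simp
    rw [h3]
    have h4 : 0 < 1 / (n : ℝ) := by positivity
    constructor <;> linarith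

/-- The step function with the value `c k` on the grid interval `(k / n, (k + 1) / n]`. -/
noncomputable def stepLp {n : ℕ} (hn : 0 < n) (c : ℕ → ℝ) : L2Unit := (memLp_step hn c).toLp _

/-- The function which is linear with slope `c k` on the grid interval `(k / n, (k + 1) / n]` and
vanishes at its midpoint. -/
noncomputable def slopeLp {n : ℕ} (hn : 0 < n) (c : ℕ → ℝ) : L2Unit := (memLp_slope hn c).toLp _

theorem stepLp_coeFn {n : ℕ} (hn : 0 < n) (c : ℕ → ℝ) :
    stepLp hn c =ᵐ[unitMeasure] fun s => c (gridIndex n s) :=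
  (memLp_step hn c).coeFn_toLp

theorem slopeLp_coeFn {n : ℕ} (hn : 0 < n) (c : ℕ → ℝ) :
    slopeLp hn c =ᵐ[unitMeasure] fun s =>
      c (gridIndex n s) * (s - (gridIndex n s : ℝ) / n - 1 / (2 * n)) :=
  (memLp_slope hn c).coeFn_toLp

theorem inner_initialSegment_left (t : unitInterval) (g : L2Unit) :
    inner ℝ (initialSegment t) g = ∫ s in (0 : ℝ)..t, g s := by
  rw [initialSegment, L2.inner_indicatorConstLp_one,
    Measure.restrict_restrict measurableSet_Ioc, inter_eq_self_of_subset_left,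
    intervalIntegral.integral_of_le t.2.1]
  exact fun s hs => ⟨hs.1.le, hs.2.trans t.2.2⟩

theorem intervalIntegral_congr_unitMeasure {φ ψ : ℝ → ℝ} (h : φ =ᵐ[unitMeasure] ψ) {s t : ℝ}
    (hs : s ∈ Icc (0 : ℝ) 1) (ht : t ∈ Icc (0 : ℝ) 1) : ∫ r in s..t, φ r = ∫ r in s..t, ψ r := by
  have h' := (ae_restrict_iff' measurableSet_Icc).1 h
  refine intervalIntegral.integral_congr_ae ?_
  filter_upwards [h'] with r hr hrm
  refine hr ?_
  have := uIoc_subset_uIcc hrm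
  exact ⟨(le_min hs.1 ht.1).trans this.1, this.2.trans (max_le hs.2 ht.2)⟩

theorem grid_mem {n k : ℕ} (hk : k ≤ n) : (k : ℝ) / n ∈ Icc (0 : ℝ) 1 :=
  ⟨by positivity, div_le_one_of_le₀ (Nat.cast_le.2 hk) (Nat.cast_nonneg n)⟩

/-- A finite-dimensional subspace is its own double orthogonal complement. A vector orthogonal to
the grid segments has zero integral over each cell, hence is orthogonal to every grid step function.
-/
theorem step_mem_gridSpan {n : ℕ} (hn : 0 < n) (c : ℕ → ℝ) :
    stepLp hn c ∈ gridSpan n := by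
  rw [← Submodule.orthogonal_orthogonal (gridSpan n), Submodule.mem_orthogonal]
  intro w hw
  have hint : ∀ k ≤ n, IntervalIntegrable w volume 0 ((k : ℝ) / n) := by
    intro k hk
    refine (intervalIntegrable_of_unitMeasure
      ((Lp.memLp w).integrable (by norm_num))).mono_set ?_
    rw [uIcc_of_le (grid_mem hk).1, uIcc_of_le zero_le_one]
    exact Icc_subset_Icc_right (grid_mem hk).2
  have h0 : ∀ k ≤ n, ∫ s in (0 : ℝ)..((k : ℝ) / n), w s = 0 := by
    intro k hk
    rcases Nat.eq_zero_or_pos k with rfl | hk0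
    · simp
    · have h1 := (Submodule.mem_orthogonal _ w).1 hw
        (initialSegment (gridPoint n ⟨k, Finset.mem_Icc.2 ⟨hk0, hk⟩⟩))
        (Submodule.subset_span ⟨_, rfl⟩)
      rwa [inner_initialSegment_left] at h1
  have h1 : inner ℝ w (stepLp hn c) =
      ∫ s in (0 : ℝ)..1, w s * c (gridIndex n s) := by
    have := inner_toLp (Lp.memLp w) (memLp_step hn c)
    rwa [Lp.toLp_coeFn, integral_unitMeasure] at this
  have hk1 : ∀ k < n, IntervalIntegrable w volume ((k : ℝ) / n) ((k + 1 : ℕ) / n) :=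
    fun k hk => (hint k hk.le).symm.trans (hint (k + 1) hk)
  rw [h1, integral_grid_unit hn (ψ := fun k s => w s * c k)
    (fun k hk => (hk1 k hk).mul_const _) (fun k _ s hs => by rw [gridIndex_eq hn hs])]
  refine Finset.sum_eq_zero fun k hk => ?_
  have hk' := Finset.mem_range.1 hk
  rw [intervalIntegral.integral_mul_const,
    ← intervalIntegral.integral_interval_sub_left (hint (k + 1) hk') (hint k hk'.le),
    h0 _ hk', h0 _ hk'.le, sub_self, zero_mul]

theorem integral_slope (c x m : ℝ) :
    ∫ s in x..(x + 2 * m), c * (s - x - m) = 0 := by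
  have h : ∀ s, HasDerivAt (fun s => c * (s - x - m) ^ 2 / 2) (c * (s - x - m)) s := by
    intro s
    have := (((((hasDerivAt_id s).sub_const x).sub_const m).pow 2).const_mul c).div_const 2
    convert! this using 1
    simp
    ring
  rw [intervalIntegral.integral_eq_sub_of_hasDerivAt (fun s _ => h s)
    (by apply Continuous.intervalIntegrable; fun_prop)]
  ring

/-- Here `m` is half the cell length; `m = 1/(2n)` gives `c² / (12 n³)`, the source of the constant
12. -/
theorem integral_slope_sq (c x m : ℝ) :
    ∫ s in x..(x + 2 * m), (c * (s - x - m)) ^ 2 = 2 / 3 * c ^ 2 * m ^ 3 := by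
  have h : ∀ s, HasDerivAt (fun s => c ^ 2 * (s - x - m) ^ 3 / 3) ((c * (s - x - m)) ^ 2) s := by
    intro s
    have := (((((hasDerivAt_id s).sub_const x).sub_const m).pow 3).const_mul (c ^ 2)).div_const 3
    convert! this using 1
    simp
    ring
  rw [intervalIntegral.integral_eq_sub_of_hasDerivAt (fun s _ => h s)
    (by apply Continuous.intervalIntegrable; fun_prop)]
  ring

theorem grid_succ {n : ℕ} (hn : 0 < n) (k : ℕ) :
    ((k + 1 : ℕ) : ℝ) / n = (k : ℝ) / n + 2 * (1 / (2 * n)) := by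
  have hn' : (n : ℝ) ≠ 0 := Nat.cast_ne_zero.2 hn.ne'
  push_cast
  field_simp

/-- The function is odd about each cell midpoint, so its integral from 0 to any grid point vanishes.
-/
theorem slope_mem_orthogonal {n : ℕ} (hn : 0 < n) (c : ℕ → ℝ) :
    slopeLp hn c ∈ (gridSpan n)ᗮ := by
  rw [Submodule.mem_orthogonal]
  intro u hu
  induction hu using Submodule.span_induction with
  | zero => exact inner_zero_left _
  | add x y _ _ hx hy => rw [inner_add_left, hx, hy, add_zero]
  | smul a x _ hx => rw [real_inner_smul_left, hx, mul_zero]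
  | mem x hx =>
    obtain ⟨k, rfl⟩ := hx
    have hk := (Finset.mem_Icc.1 k.2).2
    dsimp only
    rw [inner_initialSegment_left, intervalIntegral_congr_unitMeasure
      (slopeLp_coeFn hn c) (by simp) (gridPoint n k).2]
    refine (integral_grid (j := k)
      (ψ := fun k s => c k * (s - (k : ℝ) / n - 1 / (2 * n))) (fun i _ => ?_)
      (fun i _ s hs => by rw [gridIndex_eq hn hs])).trans (Finset.sum_eq_zero fun i _ => ?_)
    · apply Continuous.intervalIntegrable
      fun_prop
    · rw [grid_succ hn, integral_slope]

theorem norm_step_sq {n : ℕ} (hn : 0 < n) (c : ℕ → ℝ) :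
    ‖stepLp hn c‖ ^ 2 = ∑ k ∈ Finset.range n, c k ^ 2 / n := by
  rw [stepLp, norm_toLp_sq, integral_grid_unit hn (ψ := fun k _ => c k ^ 2)
    (fun k _ => by simp) (fun k _ s hs => by rw [gridIndex_eq hn hs])]
  refine Finset.sum_congr rfl fun k _ => ?_
  rw [intervalIntegral.integral_const, smul_eq_mul]
  push_cast
  ring

theorem norm_slope {n : ℕ} (hn : 0 < n) (c : ℕ → ℝ) :
    n * ‖slopeLp hn c‖ = ‖stepLp hn c‖ / Real.sqrt 12 := by
  have hn' : (n : ℝ) ≠ 0 := Nat.cast_ne_zero.2 hn.ne'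
  rw [← sq_eq_sq₀ (by positivity) (by positivity), mul_pow, div_pow, norm_step_sq hn,
    Real.sq_sqrt (by norm_num), slopeLp, norm_toLp_sq,
    integral_grid_unit hn (ψ := fun k s => (c k * (s - (k : ℝ) / n - 1 / (2 * n))) ^ 2)
    (fun k _ => by apply Continuous.intervalIntegrable; fun_prop)
    (fun k _ s hs => by rw [gridIndex_eq hn hs]), Finset.mul_sum, Finset.sum_div]
  refine Finset.sum_congr rfl fun k _ => ?_
  rw [grid_succ hn, integral_slope_sq]
  field_simp
  norm_num
  ring

/-- Mean value inequality for `u ↦ h u - h'(x) u`, whose derivative `h'(u) - h'(x)` is at most the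
variation of `h'` on `[x, y]`. -/
theorem abs_taylor_le {h : ℝ → ℝ} (hh : HasBVDeriv h) {x y s : ℝ} (hx : 0 ≤ x) (hy : y ≤ 1)
    (hxs : x ≤ s) (hsy : s ≤ y) :
    |h s - h x - derivWithin h (Icc 0 1) x * (s - x)| ≤
      (eVariationOn (derivWithin h (Icc 0 1)) (Icc x y)).toReal * (s - x) := by
  set d := derivWithin h (Icc 0 1)
  have hbv : BoundedVariationOn d (Icc x y) :=
    hh.boundedVariationOn.mono (Icc_subset_Icc hx hy)
  have hsub : Icc x s ⊆ Icc (0 : ℝ) 1 := Icc_subset_Icc hx (hsy.trans hy)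
  have hd : ∀ u ∈ Icc x s, HasDerivWithinAt (fun u => h u - d x * u) (d u - d x) (Icc x s) u := by
    intro u hu
    have h1 := ((hh.differentiableOn u (hsub hu)).hasDerivWithinAt).mono hsub
    have h2 := h1.sub ((hasDerivWithinAt_id u _).const_mul (d x))
    rw [mul_one] at h2
    exact h2
  have hb : ∀ u ∈ Icc x s, ‖d u - d x‖ ≤ (eVariationOn d (Icc x y)).toReal := by
    intro u hu
    rw [← dist_eq_norm]
    exact hbv.dist_le ⟨hu.1, hu.2.trans hsy⟩ ⟨le_rfl, hxs.trans hsy⟩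
  have := (convex_Icc x s).norm_image_sub_le_of_norm_hasDerivWithin_le hd hb
    (left_mem_Icc.2 hxs) (right_mem_Icc.2 hxs)
  rw [Real.norm_eq_abs, Real.norm_of_nonneg (sub_nonneg.2 hxs)] at this
  convert this using 2
  ring

theorem HasBVDeriv.memLp_derivWithin {h : ℝ → ℝ} (hh : HasBVDeriv h) :
    MemLp (derivWithin h (Icc 0 1)) 2 unitMeasure := by
  have hbv := hh.boundedVariationOn
  refine MemLp.of_bound ?_ (|derivWithin h (Icc 0 1) 0| +
    (eVariationOn (derivWithin h (Icc 0 1)) (Icc 0 1)).toReal) ?_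
  · obtain ⟨p, q, hp, hq, hpq⟩ :=
      hbv.locallyBoundedVariationOn.exists_monotoneOn_sub_monotoneOn
    rw [hpq]
    exact ((aemeasurable_restrict_of_monotoneOn measurableSet_Icc hp).sub
      (aemeasurable_restrict_of_monotoneOn measurableSet_Icc hq)).aestronglyMeasurable
  · filter_upwards [ae_restrict_mem measurableSet_Icc] with s hs
    have h1 := hbv.dist_le hs (left_mem_Icc.2 zero_le_one)
    rw [Real.dist_eq] at h1
    have h2 := abs_sub_abs_le_abs_sub (derivWithin h (Icc 0 1) s) (derivWithin h (Icc 0 1) 0)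
    rw [Real.norm_eq_abs]
    linarith

/-- The cell variations `v k` add up to `V` and each is at most `V`, so `∑ v_k² ≤ V²`; the cell
length contributes the factor `1/n`. -/
theorem norm_step_variation_le {d : ℝ → ℝ} (hd : BoundedVariationOn d (Icc 0 1)) {n : ℕ}
    (hn : 0 < n) :
    ‖stepLp hn fun k => (eVariationOn d (Icc ((k : ℝ) / n) ((k + 1 : ℕ) / n))).toReal‖ ≤
      (eVariationOn d (Icc 0 1)).toReal / Real.sqrt n := by
  have hn' : (0 : ℝ) < n := Nat.cast_pos.2 hn
  set v : ℕ → ℝ := fun k => (eVariationOn d (Icc ((k : ℝ) / n) ((k + 1 : ℕ) / n))).toReal with hv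
  set V := (eVariationOn d (Icc 0 1)).toReal with hV
  have hsum : ∑ k ∈ Finset.range n, v k = V := by
    have h1 := eVariationOn.sum' d (I := fun k : ℕ => (k : ℝ) / n) (n := n)
      (fun i j hij => by dsimp only; gcongr)
    simp only [Nat.cast_zero, zero_div, div_self hn'.ne'] at h1
    rw [hV, ← h1, ENNReal.toReal_sum]
    intro k hk
    exact hd.mono (Icc_subset_Icc (by positivity)
      (grid_mem (Finset.mem_range.1 hk : k + 1 ≤ n)).2)
  have hv0 : ∀ k, 0 ≤ v k := fun k => ENNReal.toReal_nonneg
  have hvV : ∀ k ∈ Finset.range n, v k ≤ V := fun k hk =>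
    hsum ▸ Finset.single_le_sum (fun i _ => hv0 i) hk
  refine le_of_sq_le_sq ?_ (by positivity)
  rw [norm_step_sq, div_pow, Real.sq_sqrt hn'.le, ← Finset.sum_div]
  gcongr
  calc ∑ k ∈ Finset.range n, v k ^ 2 ≤ ∑ k ∈ Finset.range n, V * v k :=
        Finset.sum_le_sum fun k hk => by
          rw [sq]
          exact mul_le_mul_of_nonneg_right (hvV k hk) (hv0 k)
    _ = V ^ 2 := by rw [← Finset.mul_sum, hsum, sq]

/-- `H` is a grid step function plus a centred slope plus a remainder. Subtracting the projection
removes the first, keeps the second and does not enlarge the third. The two errors, Taylor remainder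
and sampling of `h'`, are each at most `V/√n`, hence the factor 2. -/
theorem abs_mul_norm_sub_starProjection_sub_le {h : ℝ → ℝ} (hh : HasBVDeriv h) {n : ℕ}
    (hn : 0 < n) :
    |n * ‖hh.memLp.toLp h - (gridSpan n).starProjection (hh.memLp.toLp h)‖ -
      normL2 (derivWithin h (Icc 0 1)) / Real.sqrt 12| ≤
      2 * ((eVariationOn (derivWithin h (Icc 0 1)) (Icc 0 1)).toReal / Real.sqrt n) := by
  have hn' : (0 : ℝ) < n := Nat.cast_pos.2 hn
  set d := derivWithin h (Icc 0 1) with hd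
  set v : ℕ → ℝ := fun k => (eVariationOn d (Icc ((k : ℝ) / n) ((k + 1 : ℕ) / n))).toReal with hv
  set H := hh.memLp.toLp h with hH
  let D : ℕ → ℝ := fun k => d (k / n)
  -- The constant is the tangent at the left end of the cell evaluated at the midpoint, so that `st
  -- + sl` is exactly this tangent.
  let st := stepLp hn fun k => h (k / n) + d (k / n) / (2 * n)
  let sl := slopeLp hn D
  let vs := stepLp hn v
  let Ds := stepLp hn D
  let dL : L2Unit := hh.memLp_derivWithin.toLp d
  have hvs := norm_step_variation_le hh.boundedVariationOn hn
  have hgrid : ∀ k < n, (k : ℝ) / n ∈ Icc (0 : ℝ) 1 ∧ ((k + 1 : ℕ) : ℝ) / n ∈ Icc (0 : ℝ) 1 :=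
    fun k hk => ⟨grid_mem hk.le, grid_mem hk⟩
  have hDd : ‖Ds - dL‖ ≤ ‖vs‖ := by
    refine Lp.norm_le_norm_of_ae_le ?_
    filter_upwards [ae_mem_Ioc, Lp.coeFn_sub Ds dL, stepLp_coeFn hn v,
      stepLp_coeFn hn D, hh.memLp_derivWithin.coeFn_toLp] with
      s hs e1  e2 e3 e4
    obtain ⟨k, hk, hks⟩ := exists_grid_interval hn hs
    rw [e1, Pi.sub_apply, e2, e3, e4, gridIndex_eq hn hks, ← dist_eq_norm,
      Real.norm_of_nonneg ENNReal.toReal_nonneg]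
    have hbv : BoundedVariationOn d (Icc ((k : ℝ) / n) ((k + 1 : ℕ) / n)) :=
      hh.boundedVariationOn.mono (Icc_subset_Icc (hgrid k hk).1.1 (hgrid k hk).2.2)
    exact hbv.dist_le (left_mem_Icc.2 (grid_le_succ n k)) ⟨hks.1.le, hks.2⟩
  have hr : ‖H - st - sl‖ ≤ 1 / n * ‖vs‖ := by
    refine Lp.norm_le_mul_norm_of_ae_le_mul ?_
    filter_upwards [ae_mem_Ioc, Lp.coeFn_sub (H - st) sl, Lp.coeFn_sub H st,
      stepLp_coeFn hn v, slopeLp_coeFn hn D, hh.memLp.coeFn_toLp,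
      stepLp_coeFn hn fun k => h (k / n) + d (k / n) / (2 * n)]
      with s hs e1 e2 e3 e4 e5 e6
    obtain ⟨k, hk, hks⟩ := exists_grid_interval hn hs
    rw [e1, Pi.sub_apply, e2, Pi.sub_apply, e3, e4, e5, e6, gridIndex_eq hn hks,
      Real.norm_eq_abs, Real.norm_of_nonneg ENNReal.toReal_nonneg]
    have h1 := abs_taylor_le hh (hgrid k hk).1.1 (hgrid k hk).2.2 hks.1.le hks.2
    have h2 : s - (k : ℝ) / n ≤ 1 / n := by
      have := hks.2
      push_cast at this
      rw [add_div] at this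
      linarith
    calc _ = |h s - h (k / n) - d (k / n) * (s - k / n)| := by
          congr 1
          simp only [D]
          field_simp
          ring
      _ ≤ v k * (s - k / n) := h1
      _ ≤ v k * (1 / n) := mul_le_mul_of_nonneg_left h2 ENNReal.toReal_nonneg
      _ = _ := mul_comm _ _
  set K := gridSpan n
  have hsplit : H - K.starProjection H = sl + ((H - st - sl) - K.starProjection (H - st - sl)) := by
    have h1 : K.starProjection st = st :=
      Submodule.starProjection_eq_self_iff.2 (step_mem_gridSpan hn _)
    have h2 : K.starProjection sl = 0 :=
      (Submodule.starProjection_apply_eq_zero_iff K).2 (slope_mem_orthogonal hn D)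
    rw [map_sub, map_sub, h1, h2]
    abel
  have hcontr : ‖(H - st - sl) - K.starProjection (H - st - sl)‖ ≤ ‖H - st - sl‖ := by
    refine le_of_sq_le_sq ?_ (norm_nonneg _)
    have := norm_starProjection_sq K (H - st - sl)
    nlinarith [sq_nonneg ‖K.starProjection (H - st - sl)‖]
  have h1 : |n * ‖H - K.starProjection H‖ - n * ‖sl‖| ≤ ‖vs‖ := by
    rw [← mul_sub, abs_mul, abs_of_pos hn']
    have h2 := abs_norm_sub_norm_le (H - K.starProjection H) sl
    have h3 : (H - K.starProjection H) - sl =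
        (H - st - sl) - K.starProjection (H - st - sl) := by
      rw [hsplit]
      abel
    rw [h3] at h2
    calc (n : ℝ) * |‖H - K.starProjection H‖ - ‖sl‖| ≤ n * (1 / n * ‖vs‖) := by
          gcongr
          exact h2.trans (hcontr.trans hr)
      _ = ‖vs‖ := by field_simp
  have h12 : 1 ≤ Real.sqrt 12 := by
    rw [Real.one_le_sqrt]
    norm_num
  have h4 : |n * ‖sl‖ - normL2 d / Real.sqrt 12| ≤ ‖vs‖ := by
    rw [norm_slope hn D, ← norm_toLp hh.memLp_derivWithin, ← sub_div, abs_div,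
      abs_of_pos (by positivity : 0 < Real.sqrt 12)]
    refine (div_le_self (abs_nonneg _) h12).trans ?_
    exact (abs_norm_sub_norm_le Ds dL).trans hDd
  have h5 := abs_sub_le (n * ‖H - K.starProjection H‖) (n * ‖sl‖) (normL2 d / Real.sqrt 12)
  linarith

theorem tendsto_mul_norm_sub_starProjection {h : ℝ → ℝ} (hh : HasBVDeriv h) :
    Tendsto (fun n : ℕ => n *
      ‖hh.memLp.toLp h - (gridSpan n).starProjection (hh.memLp.toLp h)‖) atTop
      (𝓝 (normL2 (derivWithin h (Icc 0 1)) / Real.sqrt 12)) := by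
  rw [tendsto_iff_norm_sub_tendsto_zero]
  have h0 : Tendsto (fun n : ℕ => 2 *
      ((eVariationOn (derivWithin h (Icc 0 1)) (Icc 0 1)).toReal / Real.sqrt n)) atTop (𝓝 0) := by
    have h1 : Tendsto (fun n : ℕ => Real.sqrt n) atTop atTop :=
      Real.tendsto_sqrt_atTop.comp tendsto_natCast_atTop_atTop
    simpa using (h1.const_div_atTop _).const_mul 2
  refine squeeze_zero' (.of_forall fun _ => norm_nonneg _) ?_ h0
  filter_upwards [eventually_gt_atTop 0] with n hn
  exact abs_mul_norm_sub_starProjection_sub_le hh hn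

end Asymptotics

/-! ### Moments of Wiener integrals under Wick exponential densities. -/

section Moments

variable {Ω : Type*} [MeasurableSpace Ω] {P : Measure Ω} [IsProbabilityMeasure P]
  {W : ℝ → Ω → ℝ} (hW : IsBrownianMotion W P)

theorem wienerIntegral_add_coeFn (p q : L2Unit) : wienerIntegral hW (p + q) =ᵐ[P]
    fun ω => wienerIntegral hW p ω + wienerIntegral hW q ω := by
  rw [map_add]
  exact Lp.coeFn_add _ _

/-- `e^{t I(q)}` is a multiple of `e^{◇I(tq)}`, so the product rule gives the moment generating
function of `I(q)` under the density `e^{◇I(k)}`: the Gaussian mean shifts by `⟨k,q⟩`. -/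
theorem exp_mul_wienerIntegral_mul_wickExp (k q : L2Unit) (t : ℝ) :
    (fun ω => wickExp hW k ω * Real.exp (t * wienerIntegral hW q ω)) =ᵐ[P] fun ω =>
      Real.exp (t * inner ℝ k q + t ^ 2 * ‖q‖ ^ 2 / 2) * wickExp hW (k + t • q) ω := by
  have h := Lp.coeFn_smul t (wienerIntegral hW q)
  rw [← map_smul] at h
  filter_upwards [wickExp_mul hW k (t • q), h] with ω h1 h2
  have h3 : Real.exp (t * wienerIntegral hW q ω) =
      Real.exp (t ^ 2 * ‖q‖ ^ 2 / 2) * wickExp hW (t • q) ω := by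
    rw [wickExp, ← Real.exp_add, h2, norm_smul, mul_pow, Real.norm_eq_abs, sq_abs, Pi.smul_apply,
      smul_eq_mul]
    congr 1
    ring
  rw [h3, mul_left_comm, h1, real_inner_smul_right, ← mul_assoc, ← Real.exp_add, add_comm]

/-- The law of a Wiener integral after a change of measure by a Wick exponential. -/
theorem map_wienerIntegral_withDensity (k q : L2Unit) :
    (P.withDensity fun ω => ENNReal.ofReal (wickExp hW k ω)).map (wienerIntegral hW q) =
      gaussianReal (inner ℝ k q) (‖q‖ ^ 2).toNNReal := by
  have hk := (aestronglyMeasurable_wickExp hW k).aemeasurable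
  have hq : AEMeasurable (wienerIntegral hW q) P := (Lp.aestronglyMeasurable _).aemeasurable
  have : IsFiniteMeasure (P.withDensity fun ω => ENNReal.ofReal (wickExp hW k ω)) :=
    isFiniteMeasure_withDensity_ofReal (integrable_wickExp hW k).2
  have htr : ∀ ω, (ENNReal.ofReal (wickExp hW k ω)).toReal = wickExp hW k ω := fun ω =>
    ENNReal.toReal_ofReal (wickExp_pos hW k ω).le
  rw [← Measure.map_id (μ := gaussianReal _ _)]
  refine map_eq_of_forall_integral_exp_eq
    (hq.mono_ac (withDensity_absolutelyContinuous _ _)) aemeasurable_id (fun t => ?_) fun t => ?_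
  · rw [integrable_withDensity_iff_integrable_smul₀' (by fun_prop) (by simp)]
    simp only [htr, smul_eq_mul]
    exact ((integrable_wickExp hW _).const_mul _).congr
      (exp_mul_wienerIntegral_mul_wickExp hW k q t).symm
  · rw [integral_withDensity_eq_integral_toReal_smul₀ (by fun_prop) (by simp)]
    simp only [htr, smul_eq_mul]
    rw [integral_congr_ae (exp_mul_wienerIntegral_mul_wickExp hW k q t), integral_const_mul,
      integral_wickExp, mul_one]
    have h := congrFun (mgf_id_gaussianReal (μ := inner ℝ k q) (v := (‖q‖ ^ 2).toNNReal)) t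
    rw [mgf, Real.coe_toNNReal _ (sq_nonneg _)] at h
    rw [h]
    congr 1
    ring

theorem integrable_comp_mul_wickExp (k q : L2Unit) {φ : ℝ → ℝ} (hφ : Measurable φ)
    (hi : Integrable φ (gaussianReal (inner ℝ k q) (‖q‖ ^ 2).toNNReal)) :
    Integrable (fun ω => wickExp hW k ω * φ (wienerIntegral hW q ω)) P ∧
      ∫ ω, wickExp hW k ω * φ (wienerIntegral hW q ω) ∂P =
        ∫ x, φ x ∂(gaussianReal (inner ℝ k q) (‖q‖ ^ 2).toNNReal) := by
  have hk := (aestronglyMeasurable_wickExp hW k).aemeasurable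
  have hq : AEMeasurable (wienerIntegral hW q) P := (Lp.aestronglyMeasurable _).aemeasurable
  have htr : ∀ ω, (ENNReal.ofReal (wickExp hW k ω)).toReal = wickExp hW k ω := fun ω =>
    ENNReal.toReal_ofReal (wickExp_pos hW k ω).le
  have hq' := hq.mono_ac (withDensity_absolutelyContinuous P
    fun ω => ENNReal.ofReal (wickExp hW k ω))
  rw [← map_wienerIntegral_withDensity hW] at hi ⊢
  rw [integrable_map_measure hφ.aestronglyMeasurable hq',
    integrable_withDensity_iff_integrable_smul₀' (by fun_prop) (by simp)] at hi
  rw [integral_map hq' hφ.aestronglyMeasurable,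
    integral_withDensity_eq_integral_toReal_smul₀ (by fun_prop) (by simp)]
  simp only [htr, smul_eq_mul, Function.comp_apply] at hi ⊢
  exact ⟨hi, trivial⟩

theorem integral_wienerIntegral_mul_wickExp (k q : L2Unit) :
    Integrable (fun ω => wickExp hW k ω * wienerIntegral hW q ω) P ∧
      ∫ ω, wickExp hW k ω * wienerIntegral hW q ω ∂P = inner ℝ k q := by
  have h := integrable_comp_mul_wickExp hW k q measurable_id
    ((memLp_id_gaussianReal 1).integrable (by simp))
  refine ⟨h.1, h.2.trans ?_⟩
  exact integral_id_gaussianReal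

theorem integral_sq_wienerIntegral_mul_wickExp (k q : L2Unit) :
    Integrable (fun ω => wickExp hW k ω * wienerIntegral hW q ω ^ 2) P ∧
      ∫ ω, wickExp hW k ω * wienerIntegral hW q ω ^ 2 ∂P = ‖q‖ ^ 2 + inner ℝ k q ^ 2 := by
  have h2 : MemLp id 2 (gaussianReal (inner ℝ k q) (‖q‖ ^ 2).toNNReal) := memLp_id_gaussianReal 2
  have h := integrable_comp_mul_wickExp hW k q (φ := fun x => x ^ 2) (by fun_prop) h2.integrable_sq
  refine ⟨h.1, h.2.trans ?_⟩
  have hv := variance_eq_sub h2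
  rw [variance_id_gaussianReal, Real.coe_toNNReal _ (sq_nonneg _)] at hv
  simp only [Pi.pow_apply, id_eq, integral_id_gaussianReal] at hv
  linarith

/-- Polarisation of the second moment formula. -/
theorem integral_wienerIntegral_mul_wienerIntegral_mul_wickExp (k p q : L2Unit) :
    Integrable (fun ω => wickExp hW k ω * (wienerIntegral hW p ω * wienerIntegral hW q ω)) P ∧
      ∫ ω, wickExp hW k ω * (wienerIntegral hW p ω * wienerIntegral hW q ω) ∂P =
        inner ℝ p q + inner ℝ k p * inner ℝ k q := by
  have h1 := integral_sq_wienerIntegral_mul_wickExp hW k (p + q)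
  have h2 := integral_sq_wienerIntegral_mul_wickExp hW k p
  have h3 := integral_sq_wienerIntegral_mul_wickExp hW k q
  have h : (fun ω => wickExp hW k ω * (wienerIntegral hW p ω * wienerIntegral hW q ω)) =ᵐ[P]
      fun ω => (1 / 2) * (wickExp hW k ω * wienerIntegral hW (p + q) ω ^ 2 -
        wickExp hW k ω * wienerIntegral hW p ω ^ 2 -
        wickExp hW k ω * wienerIntegral hW q ω ^ 2) := by
    filter_upwards [wienerIntegral_add_coeFn hW p q] with ω hω
    rw [hω]
    ring
  refine ⟨(((h1.1.sub h2.1).sub h3.1).const_mul _).congr h.symm, ?_⟩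
  rw [integral_congr_ae h, integral_const_mul, integral_sub (by exact h1.1.sub h2.1) h3.1,
    integral_sub h1.1 h2.1, h1.2, h2.2, h3.2, norm_add_sq_real, inner_add_right]
  ring

theorem wickExp_mul_wienerIntegral_mul (k k' p q : L2Unit) :
    (fun ω => wickExp hW k ω * wienerIntegral hW p ω *
      (wickExp hW k' ω * wienerIntegral hW q ω)) =ᵐ[P] fun ω => Real.exp (inner ℝ k k') *
        (wickExp hW (k + k') ω * (wienerIntegral hW p ω * wienerIntegral hW q ω)) := by
  filter_upwards [wickExp_mul hW k k'] with ω hω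
  rw [← mul_assoc (Real.exp _), ← hω]
  ring

theorem memLp_wickExp_mul_wienerIntegral (k q : L2Unit) :
    MemLp (fun ω => wickExp hW k ω * wienerIntegral hW q ω) 2 P := by
  have hm : AEStronglyMeasurable (fun ω => wickExp hW k ω * wienerIntegral hW q ω) P :=
    (aestronglyMeasurable_wickExp hW k).mul (Lp.aestronglyMeasurable _)
  rw [memLp_two_iff_integrable_sq hm]
  simp_rw [sq]
  exact ((integral_wienerIntegral_mul_wienerIntegral_mul_wickExp hW (k + k) q q).1.const_mul
    _).congr (wickExp_mul_wienerIntegral_mul hW k k q q).symm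

/-- The random variable `e^{◇ I(k)} I(q)` as an element of `L²(Ω)`. -/
noncomputable def wickMulLp (k q : L2Unit) : Lp ℝ 2 P :=
  (memLp_wickExp_mul_wienerIntegral hW k q).toLp _

theorem wickMulLp_coeFn (k q : L2Unit) :
    wickMulLp hW k q =ᵐ[P] fun ω => wickExp hW k ω * wienerIntegral hW q ω :=
  MemLp.coeFn_toLp _

theorem inner_wickMulLp (k k' p q : L2Unit) :
    inner ℝ (wickMulLp hW k p) (wickMulLp hW k' q) = Real.exp (inner ℝ k k') *
      (inner ℝ p q + inner ℝ (k + k') p * inner ℝ (k + k') q) := by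
  rw [wickMulLp, wickMulLp, inner_toLp, integral_congr_ae
    (wickExp_mul_wienerIntegral_mul hW k k' p q), integral_const_mul,
    (integral_wienerIntegral_mul_wienerIntegral_mul_wickExp hW _ p q).2]

theorem inner_wickMulLp_wickLp (k q g : L2Unit) :
    inner ℝ (wickMulLp hW k q) (wickLp hW g) = Real.exp (inner ℝ k g) * inner ℝ (k + g) q := by
  rw [wickMulLp, wickLp, inner_toLp, ← (integral_wienerIntegral_mul_wickExp hW (k + g) q).2,
    ← integral_const_mul]
  refine integral_congr_ae ?_
  filter_upwards [wickExp_mul hW k g] with ω hω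
  rw [← mul_assoc, ← hω]
  ring

end Moments

/-! ### Measurability of the solution with respect to the past. -/

section Adaptedness

variable {h : ℝ → ℝ} (hh : MemLp h 2 unitMeasure)

theorem inner_initialSegment_cutoff (s : unitInterval) {t : ℝ} (ht : t ∈ Icc (0 : ℝ) 1) :
    inner ℝ (initialSegment s) (cutoff hh t) = ∫ r in (0 : ℝ)..(min (s : ℝ) t), h r := by
  have hm : min (s : ℝ) t ∈ Icc (0 : ℝ) 1 := ⟨le_min s.2.1 ht.1, (min_le_right _ _).trans ht.2⟩
  rw [inner_initialSegment_left, ← integral_indicator_Ico s.2, ← integral_indicator_Ico hm]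
  refine integral_congr_ae ?_
  filter_upwards [cutoff_coeFn hh t] with r hr
  by_cases h1 : r ∈ Ico 0 (s : ℝ)
  · rw [indicator_of_mem h1, hr]
    by_cases h2 : r ∈ Ico 0 t
    · rw [indicator_of_mem h2, indicator_of_mem]
      exact ⟨h1.1, lt_min h1.2 h2.2⟩
    · rw [indicator_of_notMem h2, indicator_of_notMem]
      exact fun h3 => h2 ⟨h3.1, h3.2.trans_le (min_le_right _ _)⟩
  · rw [indicator_of_notMem h1, indicator_of_notMem]
    exact fun h3 => h1 ⟨h3.1, h3.2.trans_le (min_le_left _ _)⟩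

theorem eq_zero_of_inner_initialSegment_eq_zero {w : L2Unit}
    (hw : ∀ s, inner ℝ (initialSegment s) w = 0) : w = 0 := by
  have h := denseRange_stepFunction.equalizer (γ := ℝ) (g := fun g => inner ℝ g w)
    (h := fun _ => 0) (by fun_prop) continuous_const (by
      ext c
      simp only [Function.comp_apply]
      induction c using Finsupp.induction_linear with
      | zero => simp
      | add c d hc hd => rw [map_add, inner_add_left, hc, hd, add_zero]
      | single s x => rw [stepFunction_single, real_inner_smul_left, hw, mul_zero])
  exact inner_self_eq_zero.1 (congrFun h w)

/-- If `w` is orthogonal to all `1_{(0,s]}` with `s ≤ t`, then `1_{[0,t)} w` is orthogonal to every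
initial segment and so is zero, which forces `⟨w, 1_{[0,t)} h⟩ = 0`. -/
theorem cutoff_mem_closure_span {t : ℝ} (ht : t ∈ Icc (0 : ℝ) 1) :
    cutoff hh t ∈ (Submodule.span ℝ
      (initialSegment '' {s : unitInterval | (s : ℝ) ≤ t})).topologicalClosure := by
  rw [← Submodule.orthogonal_orthogonal_eq_closure, Submodule.mem_orthogonal]
  intro w hw
  have hz : cutoff (Lp.memLp w) t = 0 := by
    refine eq_zero_of_inner_initialSegment_eq_zero fun s => ?_
    have hm : min (s : ℝ) t ∈ Icc (0 : ℝ) 1 := ⟨le_min s.2.1 ht.1, (min_le_right _ _).trans ht.2⟩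
    rw [inner_initialSegment_cutoff _ s ht, ← inner_initialSegment_left ⟨_, hm⟩]
    exact (Submodule.mem_orthogonal _ w).1 hw _
      (Submodule.subset_span ⟨⟨_, hm⟩, min_le_right (s : ℝ) t, rfl⟩)
  have h := inner_cutoff_cutoff hh (Lp.memLp w) ht le_rfl
  rw [hz, inner_zero_left] at h
  rw [inner_cutoff hh w ht, ← h]

variable {Ω : Type*} [MeasurableSpace Ω] {P : Measure Ω} [IsProbabilityMeasure P]
  {W : ℝ → Ω → ℝ} (hW : IsBrownianMotion W P)

theorem aestronglyMeasurable_wickExp_cutoff {t : ℝ} (ht : t ∈ Icc (0 : ℝ) 1) :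
    AEStronglyMeasurable[pastSigma W t] (wickExp hW (cutoff hh t)) P := by
  refine aestronglyMeasurable_wickExp_of_wienerIntegral hW
    (aestronglyMeasurable_wienerIntegral hW (hW.pastSigma_le ht.2) ?_
      (cutoff_mem_closure_span hh ht))
  rintro _ ⟨s, hs, rfl⟩
  refine aestronglyMeasurable_wienerIntegral_initialSegment hW ?_
  exact (comap_measurable (W s)).mono
    (le_iSup₂_of_le (s : ℝ) ⟨s.2.1, hs⟩ le_rfl) le_rfl

end Adaptedness

/-! ### The Itô isometry for elementary Wick exponential processes. -/

section Isometry

/-- The indicator function of `(a, b]` in `L²([0,1])`. -/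
noncomputable def increment (a b : unitInterval) : L2Unit := initialSegment b - initialSegment a

theorem increment_coeFn {a b : unitInterval} (hab : a ≤ b) :
    increment a b =ᵐ[unitMeasure] (Ioc (a : ℝ) b).indicator fun _ => 1 := by
  filter_upwards [Lp.coeFn_sub (initialSegment b) (initialSegment a),
    indicatorConstLp_coeFn (p := 2) (hs := measurableSet_Ioc (a := (0 : ℝ)) (b := (b : ℝ)))
      (hμs := measure_ne_top unitMeasure _) (c := (1 : ℝ)),
    indicatorConstLp_coeFn (p := 2) (hs := measurableSet_Ioc (a := (0 : ℝ)) (b := (a : ℝ)))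
      (hμs := measure_ne_top unitMeasure _) (c := (1 : ℝ))] with s h1 h2 h3
  have hab' : (a : ℝ) ≤ b := hab
  have ha := a.2.1
  rw [increment, h1, Pi.sub_apply, initialSegment, initialSegment, h2, h3]
  simp only [indicator_apply, mem_Ioc]
  grind

theorem inner_cutoff_increment {h : ℝ → ℝ} (hh : MemLp h 2 unitMeasure) {a b : unitInterval}
    (hab : a ≤ b) {s : ℝ} (hs : s ∈ Icc (0 : ℝ) 1) (hsa : s ≤ a) :
    inner ℝ (cutoff hh s) (increment a b) = 0 := by
  have hab' : (a : ℝ) ≤ b := hab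
  rw [real_inner_comm, increment, inner_sub_left, inner_initialSegment_cutoff hh _ hs,
    inner_initialSegment_cutoff hh _ hs, min_eq_right hsa, min_eq_right (hsa.trans hab'), sub_self]

variable {Ω : Type*} [MeasurableSpace Ω] {P : Measure Ω} [IsProbabilityMeasure P]
  {W : ℝ → Ω → ℝ} (hW : IsBrownianMotion W P) {h : ℝ → ℝ} (hh : MemLp h 2 unitMeasure)
  {ι κ : Type*} [Fintype ι] [Fintype κ]

/-- The elementary process `∑ᵢ cᵢ e^{◇ I(1_{[0,aᵢ)} h)} 1_{(aᵢ, bᵢ]}` with values in `L²(Ω)`. -/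
noncomputable def wickStep (c : ι → ℝ) (a b : ι → unitInterval) (s : ℝ) : Lp ℝ 2 P :=
  ∑ i, (Ioc (a i : ℝ) (b i)).indicator (fun _ => c i • wickLp hW (cutoff hh (a i))) s

/-- The stochastic integral `∑ᵢ cᵢ e^{◇ I(1_{[0,aᵢ)} h)} (W_{bᵢ} - W_{aᵢ})`. -/
noncomputable def wickStepIntegral (c : ι → ℝ) (a b : ι → unitInterval) : Lp ℝ 2 P :=
  ∑ i, c i • wickMulLp hW (cutoff hh (a i)) (increment (a i) (b i))

/-- Intervals may overlap and the index type is arbitrary, so a difference over two partitions is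
again of the same form on the sum type, without a common refinement. -/
theorem wickStep_sub (c : ι → ℝ) (a b : ι → unitInterval) (c' : κ → ℝ) (a' b' : κ → unitInterval)
    (s : ℝ) : wickStep hW hh c a b s - wickStep hW hh c' a' b' s =
      wickStep hW hh (Sum.elim c (-c')) (Sum.elim a a') (Sum.elim b b') s := by
  simp only [wickStep, Fintype.sum_sum_type, Sum.elim_inl, Sum.elim_inr, Pi.neg_apply, neg_smul,
    sub_eq_add_neg, ← Finset.sum_neg_distrib]
  congr 1
  refine Finset.sum_congr rfl fun i _ => ?_
  by_cases hs : s ∈ Ioc (a' i : ℝ) (b' i) <;> simp [hs]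

theorem wickStepIntegral_sub (c : ι → ℝ) (a b : ι → unitInterval) (c' : κ → ℝ)
    (a' b' : κ → unitInterval) :
    wickStepIntegral hW hh c a b - wickStepIntegral hW hh c' a' b' =
      wickStepIntegral hW hh (Sum.elim c (-c')) (Sum.elim a a') (Sum.elim b b') := by
  simp [wickStepIntegral, Fintype.sum_sum_type, sub_eq_add_neg]

theorem wickStep_ae_eq (c : ι → ℝ) {a b : ι → unitInterval} (hab : ∀ i, a i ≤ b i) :
    ∀ᵐ s ∂unitMeasure, wickStep hW hh c a b s =
      ∑ i, (increment (a i) (b i) s * c i) • wickLp hW (cutoff hh (a i)) := by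
  have h1 : ∀ᵐ s ∂unitMeasure, ∀ i, increment (a i) (b i) s =
      (Ioc (a i : ℝ) (b i)).indicator (fun _ => 1) s :=
    ae_all_iff.2 fun i => increment_coeFn (hab i)
  filter_upwards [h1] with s hs
  refine Finset.sum_congr rfl fun i _ => ?_
  rw [hs i]
  by_cases hsi : s ∈ Ioc (a i : ℝ) (b i) <;> simp [hsi]

/-- The correction term in `inner_wickMulLp` is a product whose two factors pair each cut-off with
the other increment. The increment that starts later is orthogonal to both cut-offs, so one factor
vanishes. -/
theorem inner_wickMulLp_increment {a b a' b' : unitInterval} (hab : a ≤ b) (hab' : a' ≤ b') :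
    inner ℝ (wickMulLp hW (cutoff hh a) (increment a b))
      (wickMulLp hW (cutoff hh a') (increment a' b')) =
      inner ℝ (wickLp hW (cutoff hh a)) (wickLp hW (cutoff hh a')) *
        inner ℝ (increment a b) (increment a' b') := by
  rw [inner_wickMulLp, inner_wickLp, inner_add_left, inner_add_left,
    inner_cutoff_increment hh hab a.2 le_rfl, inner_cutoff_increment hh hab' a'.2 le_rfl]
  rcases le_total a a' with h1 | h1
  · rw [inner_cutoff_increment hh hab' a.2 h1]
    ring
  · rw [inner_cutoff_increment hh hab a'.2 h1]
    ring

/-- The Itô isometry. -/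
theorem norm_wickStepIntegral_sq (c : ι → ℝ) {a b : ι → unitInterval} (hab : ∀ i, a i ≤ b i) :
    ‖wickStepIntegral hW hh c a b‖ ^ 2 = ∫ s, ‖wickStep hW hh c a b s‖ ^ 2 ∂unitMeasure := by
  have h1 : ∀ᵐ s ∂unitMeasure, ‖wickStep hW hh c a b s‖ ^ 2 = ∑ i, ∑ j,
      c i * c j * inner ℝ (wickLp hW (cutoff hh (a i))) (wickLp hW (cutoff hh (a j))) *
        (increment (a i) (b i) s * increment (a j) (b j) s) := by
    filter_upwards [wickStep_ae_eq hW hh c hab] with s hs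
    rw [hs, ← real_inner_self_eq_norm_sq, sum_inner]
    refine Finset.sum_congr rfl fun i _ => ?_
    rw [inner_sum]
    refine Finset.sum_congr rfl fun j _ => ?_
    rw [real_inner_smul_left, real_inner_smul_right]
    ring
  have hi : ∀ i j, Integrable (fun s =>
      c i * c j * inner ℝ (wickLp hW (cutoff hh (a i))) (wickLp hW (cutoff hh (a j))) *
        (increment (a i) (b i) s * increment (a j) (b j) s)) unitMeasure := fun i j =>
    ((Lp.memLp (increment (a i) (b i))).integrable_mul
      (Lp.memLp (increment (a j) (b j)))).const_mul _
  rw [integral_congr_ae h1,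
    integral_finsetSum _ fun i _ => integrable_finsetSum _ fun j _ => hi i j,
    wickStepIntegral, ← real_inner_self_eq_norm_sq, sum_inner]
  refine Finset.sum_congr rfl fun i _ => ?_
  rw [integral_finsetSum _ fun j _ => hi i j, inner_sum]
  refine Finset.sum_congr rfl fun j _ => ?_
  rw [real_inner_smul_left, real_inner_smul_right,
    inner_wickMulLp_increment hW hh (hab i) (hab j), integral_const_mul,
    L2.inner_def (increment _ _)]
  simp only [RCLike.inner_apply, conj_trivial]
  simp_rw [mul_comm (increment (a j) (b j) _)]
  ring

/-- Elementary integrals satisfy the S-transform identity that characterises the Skorohod integral;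
this is the link between the two integrals. -/
theorem inner_wickStepIntegral (c : ι → ℝ) {a b : ι → unitInterval} (hab : ∀ i, a i ≤ b i)
    (g : L2Unit) : inner ℝ (wickStepIntegral hW hh c a b) (wickLp hW g) =
      ∫ s, inner ℝ (wickStep hW hh c a b s) (wickLp hW g) * g s ∂unitMeasure := by
  have h1 : ∀ᵐ s ∂unitMeasure, inner ℝ (wickStep hW hh c a b s) (wickLp hW g) * g s = ∑ i,
      c i * inner ℝ (wickLp hW (cutoff hh (a i))) (wickLp hW g) *
        (increment (a i) (b i) s * g s) := by
    filter_upwards [wickStep_ae_eq hW hh c hab] with s hs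
    rw [hs, sum_inner, Finset.sum_mul]
    refine Finset.sum_congr rfl fun i _ => ?_
    rw [real_inner_smul_left]
    ring
  have hi : ∀ i, Integrable (fun s => c i * inner ℝ (wickLp hW (cutoff hh (a i))) (wickLp hW g) *
      (increment (a i) (b i) s * g s)) unitMeasure := fun i =>
    ((Lp.memLp (increment (a i) (b i))).integrable_mul (Lp.memLp g)).const_mul _
  rw [integral_congr_ae h1, integral_finsetSum _ fun i _ => hi i, wickStepIntegral, sum_inner]
  refine Finset.sum_congr rfl fun i _ => ?_
  rw [real_inner_smul_left, inner_wickMulLp_wickLp, inner_add_left,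
    inner_cutoff_increment hh (hab i) (a i).2 le_rfl, zero_add, inner_wickLp, integral_const_mul,
    L2.inner_def g]
  simp only [RCLike.inner_apply, conj_trivial]
  simp_rw [mul_assoc]

theorem norm_wickStepIntegral_sub_le (c : ι → ℝ) {a b : ι → unitInterval} (hab : ∀ i, a i ≤ b i)
    (c' : κ → ℝ) {a' b' : κ → unitInterval} (hab' : ∀ i, a' i ≤ b' i) {C : ℝ} (hC0 : 0 ≤ C)
    (hC : ∀ᵐ s ∂unitMeasure,
      ‖wickStep hW hh c a b s - wickStep hW hh c' a' b' s‖ ≤ C) :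
    ‖wickStepIntegral hW hh c a b - wickStepIntegral hW hh c' a' b'‖ ≤ C := by
  rw [← sq_le_sq₀ (norm_nonneg _) hC0, wickStepIntegral_sub, norm_wickStepIntegral_sq hW hh _ (by
    rintro (i | i)
    · exact hab i
    · exact hab' i)]
  refine (integral_mono_of_nonneg (g := fun _ => C ^ 2) (ae_of_all _ fun _ => sq_nonneg _)
    (integrable_const _) ?_).trans (by simp)
  filter_upwards [hC] with s hs
  rw [← wickStep_sub]
  gcongr

end Isometry

/-! ### Identification of Skorohod integrals with Itô integrals. -/

section Ito

variable {Ω : Type*} [MeasurableSpace Ω] {P : Measure Ω} [IsProbabilityMeasure P]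
  {W : ℝ → Ω → ℝ} (hW : IsBrownianMotion W P) {h : ℝ → ℝ} (hh : MemLp h 2 unitMeasure)

/-- The points `i t / (n + 1)`, `0 ≤ i ≤ n + 1`, of `[0, t]`. -/
noncomputable def partitionPoint (t : unitInterval) (n : ℕ) (i : Fin (n + 1 + 1)) : unitInterval :=
  ⟨t * (i / (n + 1 : ℕ)), mul_nonneg t.2.1 (by positivity), mul_le_one₀ t.2.2 (by positivity)
    (div_le_one_of_le₀ (Nat.cast_le.2 (Nat.lt_succ_iff.1 i.2)) (Nat.cast_nonneg _))⟩

theorem partitionPoint_monotone (t : unitInterval) (n : ℕ) : Monotone (partitionPoint t n) := by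
  intro i j hij
  have : ((i : ℕ) : ℝ) ≤ (j : ℕ) := Nat.cast_le.2 hij
  have ht := t.2.1
  change (t : ℝ) * _ ≤ t * _
  gcongr

theorem partitionPoint_sub (t : unitInterval) (n : ℕ) (i : Fin (n + 1)) :
    (partitionPoint t n i.succ : ℝ) - partitionPoint t n i.castSucc ≤ 1 / (n + 1 : ℕ) := by
  have h : (partitionPoint t n i.succ : ℝ) - partitionPoint t n i.castSucc =
      t * (1 / (n + 1 : ℕ)) := by
    simp only [partitionPoint, Fin.val_succ, Fin.val_castSucc]
    push_cast
    ring
  rw [h]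
  exact mul_le_of_le_one_left (by positivity) t.2.2

theorem partitionPoint_zero (t : unitInterval) (n : ℕ) : (partitionPoint t n 0 : ℝ) = 0 := by
  simp [partitionPoint]

theorem partitionPoint_last (t : unitInterval) (n : ℕ) :
    (partitionPoint t n (Fin.last _) : ℝ) = t := by
  simp only [partitionPoint, Fin.val_last]
  rw [div_self (by positivity), mul_one]

theorem sum_succ_sub_castSucc {m : ℕ} (f : Fin (m + 1) → ℝ) :
    ∑ i : Fin m, (f i.succ - f i.castSucc) = f (Fin.last m) - f 0 := by
  have h1 := Fin.sum_univ_succ f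
  have h2 := Fin.sum_univ_castSucc f
  rw [Finset.sum_sub_distrib]
  linarith

theorem sum_indicator_partition {m : ℕ} {τ : Fin (m + 1) → ℝ} (hτ : Monotone τ) (s : ℝ) :
    ∑ i : Fin m, (Ioc (τ i.castSucc) (τ i.succ)).indicator (fun _ => (1 : ℝ)) s =
      (Ioc (τ 0) (τ (Fin.last m))).indicator (fun _ => 1) s := by
  have h : ∀ a b : ℝ, a ≤ b → (Ioc a b).indicator (fun _ => (1 : ℝ)) s =
      (if s ≤ b then 1 else 0) - if s ≤ a then 1 else 0 := by
    intro a b hab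
    simp only [indicator_apply, mem_Ioc]
    grind
  rw [h _ _ (hτ (Fin.zero_le _)), ← sum_succ_sub_castSucc (fun i => if s ≤ τ i then (1 : ℝ) else 0)]
  exact Finset.sum_congr rfl fun i _ => h _ _ (hτ (Fin.castSucc_le_succ i))

theorem norm_sum_indicator_partition_sub_le {E : Type*} [NormedAddCommGroup E] [NormedSpace ℝ E]
    {m : ℕ} {τ : Fin (m + 1) → ℝ} (hτ : Monotone τ) (G : ℝ → E) (s : ℝ) {ε : ℝ} (hε0 : 0 ≤ ε)
    (hε : ∀ i : Fin m, s ∈ Ioc (τ i.castSucc) (τ i.succ) → ‖G (τ i.castSucc) - G s‖ ≤ ε) :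
    ‖∑ i : Fin m, (Ioc (τ i.castSucc) (τ i.succ)).indicator (fun _ => G (τ i.castSucc)) s -
      (Ioc (τ 0) (τ (Fin.last m))).indicator G s‖ ≤ ε := by
  have h1 : (Ioc (τ 0) (τ (Fin.last m))).indicator G s =
      ∑ i : Fin m, (Ioc (τ i.castSucc) (τ i.succ)).indicator (fun _ => (1 : ℝ)) s • G s := by
    rw [← Finset.sum_smul, sum_indicator_partition hτ]
    by_cases hs : s ∈ Ioc (τ 0) (τ (Fin.last m)) <;> simp [hs]
  rw [h1, ← Finset.sum_sub_distrib]
  calc _ ≤ ∑ i : Fin m, (Ioc (τ i.castSucc) (τ i.succ)).indicator (fun _ => (1 : ℝ)) s * ε := by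
        refine norm_sum_le_of_le _ fun i _ => ?_
        by_cases hsi : s ∈ Ioc (τ i.castSucc) (τ i.succ)
        · simpa only [indicator_of_mem hsi, one_smul, one_mul] using hε i hsi
        · simp [indicator_of_notMem hsi]
    _ = (Ioc (τ 0) (τ (Fin.last _))).indicator (fun _ => (1 : ℝ)) s * ε := by
        rw [← Finset.sum_mul, sum_indicator_partition hτ]
    _ ≤ ε := mul_le_of_le_one_left hε0 (indicator_le_self' (by simp) s)

/-- The elementary approximations of a continuous `L²(Ω)`-valued function. -/
theorem norm_wickStep_partition_sub_le {c : ℝ → ℝ} (t : unitInterval) (n : ℕ) {ε : ℝ}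
    (hε0 : 0 ≤ ε)
    (hε : ∀ r ∈ Icc (0 : ℝ) 1, ∀ s ∈ Icc (0 : ℝ) 1, |r - s| ≤ 1 / (n + 1 : ℕ) →
      ‖c r • wickLp hW (cutoff hh r) - c s • wickLp hW (cutoff hh s)‖ ≤ ε) :
    ∀ᵐ s ∂unitMeasure, ‖wickStep hW hh (fun i : Fin (n + 1) => c (partitionPoint t n i.castSucc))
      (fun i => partitionPoint t n i.castSucc) (fun i => partitionPoint t n i.succ) s -
        (Ico (0 : ℝ) t).indicator (fun s => c s • wickLp hW (cutoff hh s)) s‖ ≤ ε := by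
  -- The equation is cut off at `[0,t)`, whereas the partition covers `(0,t]`; they differ only at
  -- the null points `0` and `t`.
  have hne : ∀ᵐ s ∂unitMeasure, s ≠ (t : ℝ) := ae_restrict_of_ae (Measure.ae_ne volume (t : ℝ))
  filter_upwards [ae_mem_Ioc, hne] with s hs hst
  have hτm : Monotone fun i => (partitionPoint t n i : ℝ) :=
    fun i j hij => partitionPoint_monotone t n hij
  have h1 : (Ico (0 : ℝ) t).indicator (fun s => c s • wickLp hW (cutoff hh s)) s =
      (Ioc (partitionPoint t n 0 : ℝ) (partitionPoint t n (Fin.last _))).indicator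
        (fun s => c s • wickLp hW (cutoff hh s)) s := by
    rw [partitionPoint_zero, partitionPoint_last]
    refine indicator_eq_indicator ?_ rfl
    exact ⟨fun h => ⟨hs.1, h.2.le⟩, fun h => ⟨hs.1.le, lt_of_le_of_ne h.2 hst⟩⟩
  rw [h1]
  refine norm_sum_indicator_partition_sub_le hτm _ s hε0 fun i hsi => ?_
  refine hε _ (partitionPoint t n _).2 s ⟨hs.1.le, hs.2⟩ ?_
  rw [abs_sub_comm, abs_of_pos (sub_pos.2 hsi.1)]
  exact (sub_le_sub_right hsi.2 _).trans (partitionPoint_sub t n i)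

theorem exists_uniform_modulus {F : ℝ → Lp ℝ 2 P} (hF : ContinuousOn F (Icc 0 1)) :
    ∃ ε : ℕ → ℝ, (∀ n, 0 ≤ ε n) ∧ Tendsto ε atTop (𝓝 0) ∧ ∀ n, ∀ r ∈ Icc (0 : ℝ) 1,
      ∀ s ∈ Icc (0 : ℝ) 1, |r - s| ≤ 1 / (n + 1 : ℕ) → ‖F r - F s‖ ≤ ε n := by
  have huc := isCompact_Icc.uniformContinuousOn_of_continuous hF
  rw [Metric.uniformContinuousOn_iff] at huc
  obtain ⟨C, hC⟩ := isCompact_Icc.exists_bound_of_continuousOn hF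
  let S : ℕ → Set ℝ := fun n => {x | ∃ r ∈ Icc (0 : ℝ) 1, ∃ s ∈ Icc (0 : ℝ) 1,
    |r - s| ≤ 1 / (n + 1 : ℕ) ∧ ‖F r - F s‖ = x}
  have hbdd : ∀ n, BddAbove (S n) := by
    rintro n
    refine ⟨C + C, ?_⟩
    rintro _ ⟨r, hr, s, hs, -, rfl⟩
    exact (norm_sub_le _ _).trans (add_le_add (hC r hr) (hC s hs))
  have hnn : ∀ n, 0 ≤ sSup (S n) := fun n =>
    Real.sSup_nonneg (by rintro _ ⟨r, -, s, -, -, rfl⟩; exact norm_nonneg _)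
  refine ⟨fun n => sSup (S n), hnn, ?_,
    fun n r hr s hs hrs => le_csSup (hbdd n) ⟨r, hr, s, hs, hrs, rfl⟩⟩
  rw [Metric.tendsto_atTop]
  intro e he
  obtain ⟨δ, hδ, h⟩ := huc (e / 2) (half_pos he)
  obtain ⟨N, hN⟩ := exists_nat_one_div_lt hδ
  refine ⟨N, fun n hn => ?_⟩
  rw [Real.dist_eq, sub_zero, abs_of_nonneg (hnn n)]
  refine (Real.sSup_le ?_ (half_pos he).le).trans_lt (half_lt_self he)
  rintro _ ⟨r, hr, s, hs, hrs, rfl⟩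
  rw [← dist_eq_norm]
  refine (h r hr s hs ?_).le
  rw [Real.dist_eq]
  refine (hrs.trans ?_).trans_lt hN
  rw [Nat.cast_add_one]
  gcongr

/-- The elementary process with the values `c(tᵢ) e^{◇ I(1_{[0,tᵢ)} h)}` on `(tᵢ, tᵢ₊₁]`. -/
noncomputable def wickElementary (c : ℝ → ℝ) (t : unitInterval) (n : ℕ) :
    ElementaryProcess W P where
  m := n + 1
  t := fun i => partitionPoint t n i
  mono := fun _ _ hij => partitionPoint_monotone t n hij
  mem := fun i => (partitionPoint t n i).2
  -- Elementary processes require genuine measurability with respect to the past, so a measurable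
  -- representative replaces the Wick exponential.
  ξ := fun i ω => c (partitionPoint t n i.castSucc) *
    (aestronglyMeasurable_wickExp_cutoff hh hW (partitionPoint t n i.castSucc).2).mk _ ω
  memLp := fun i => ((memLp_wickExp hW _).ae_eq
    (aestronglyMeasurable_wickExp_cutoff hh hW
      (partitionPoint t n i.castSucc).2).ae_eq_mk).const_mul _
  adapted := fun i => ((aestronglyMeasurable_wickExp_cutoff hh hW
    (partitionPoint t n i.castSucc).2).stronglyMeasurable_mk.measurable).const_mul _

theorem wickElementary_ξ_ae_eq (c : ℝ → ℝ) (t : unitInterval) (n : ℕ) (i : Fin (n + 1)) :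
    (wickElementary hW hh c t n).ξ i =ᵐ[P] fun ω => c (partitionPoint t n i.castSucc) *
      wickExp hW (cutoff hh (partitionPoint t n i.castSucc)) ω := by
  filter_upwards [(aestronglyMeasurable_wickExp_cutoff hh hW
    (partitionPoint t n i.castSucc).2).ae_eq_mk] with ω hω
  rw [hω]
  rfl

theorem wickElementary_eval_ae_eq (c : ℝ → ℝ) (t : unitInterval) (n : ℕ) (s : ℝ) :
    (wickElementary hW hh c t n).eval s =ᵐ[P]
      wickStep hW hh (fun i : Fin (n + 1) => c (partitionPoint t n i.castSucc))
        (fun i => partitionPoint t n i.castSucc) (fun i => partitionPoint t n i.succ) s := by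
  have h1 : ∀ᵐ ω ∂P, ∀ i : Fin (n + 1), (wickElementary hW hh c t n).ξ i ω =
      c (partitionPoint t n i.castSucc) *
        wickExp hW (cutoff hh (partitionPoint t n i.castSucc)) ω :=
    ae_all_iff.2 fun i => wickElementary_ξ_ae_eq hW hh c t n i
  have h2 : ∀ᵐ ω ∂P, ∀ i : Fin (n + 1),
      (Ioc (partitionPoint t n i.castSucc : ℝ) (partitionPoint t n i.succ)).indicator
        (fun _ => c (partitionPoint t n i.castSucc) •
          wickLp hW (cutoff hh (partitionPoint t n i.castSucc))) s ω =
      (Ioc (partitionPoint t n i.castSucc : ℝ) (partitionPoint t n i.succ)).indicator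
        (fun _ => c (partitionPoint t n i.castSucc) *
          wickExp hW (cutoff hh (partitionPoint t n i.castSucc)) ω) s := by
    refine ae_all_iff.2 fun i => ?_
    by_cases hs : s ∈ Ioc (partitionPoint t n i.castSucc : ℝ) (partitionPoint t n i.succ)
    · simp only [indicator_of_mem hs]
      filter_upwards [Lp.coeFn_smul (c (partitionPoint t n i.castSucc))
        (wickLp hW (cutoff hh (partitionPoint t n i.castSucc))), wickLp_coeFn hW
          (cutoff hh (partitionPoint t n i.castSucc))] with ω h3 h4
      rw [h3, Pi.smul_apply, h4, smul_eq_mul]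
    · simp only [indicator_of_notMem hs]
      exact Lp.coeFn_zero _ _ _
  have h3 := Lp.coeFn_finsetSum Finset.univ (fun i : Fin (n + 1) =>
      (Ioc (partitionPoint t n i.castSucc : ℝ) (partitionPoint t n i.succ)).indicator
        (fun _ => c (partitionPoint t n i.castSucc) •
          wickLp hW (cutoff hh (partitionPoint t n i.castSucc))) s)
  filter_upwards [h1, h2, h3] with ω h1 h2 h3
  rw [wickStep, h3, Finset.sum_apply]
  refine Finset.sum_congr rfl fun i _ => ?_
  refine Eq.trans ?_ (h2 i).symm
  exact congrArg (fun x => (Ioc (partitionPoint t n i.castSucc : ℝ)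
    (partitionPoint t n i.succ)).indicator (fun _ => x) s) (h1 i)

theorem wickElementary_integral_ae_eq (c : ℝ → ℝ) (t : unitInterval) (n : ℕ) :
    (wickElementary hW hh c t n).integral =ᵐ[P]
      wickStepIntegral hW hh (fun i : Fin (n + 1) => c (partitionPoint t n i.castSucc))
        (fun i => partitionPoint t n i.castSucc) (fun i => partitionPoint t n i.succ) := by
  have h1 : ∀ᵐ ω ∂P, ∀ i : Fin (n + 1), (wickElementary hW hh c t n).ξ i ω *
      (W (partitionPoint t n i.succ) ω - W (partitionPoint t n i.castSucc) ω) =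
      (c (partitionPoint t n i.castSucc) • wickMulLp hW
        (cutoff hh (partitionPoint t n i.castSucc))
        (increment (partitionPoint t n i.castSucc) (partitionPoint t n i.succ)) : Lp ℝ 2 P) ω := by
    refine ae_all_iff.2 fun i => ?_
    have h2 := Lp.coeFn_sub (wienerIntegral hW (initialSegment (partitionPoint t n i.succ)))
      (wienerIntegral hW (initialSegment (partitionPoint t n i.castSucc)))
    rw [← map_sub, wienerIntegral_initialSegment, wienerIntegral_initialSegment] at h2
    filter_upwards [wickElementary_ξ_ae_eq hW hh c t n i, wickMulLp_coeFn hW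
        (cutoff hh (partitionPoint t n i.castSucc))
        (increment (partitionPoint t n i.castSucc) (partitionPoint t n i.succ)),
      Lp.coeFn_smul (c (partitionPoint t n i.castSucc)) (wickMulLp hW
        (cutoff hh (partitionPoint t n i.castSucc))
        (increment (partitionPoint t n i.castSucc) (partitionPoint t n i.succ))), h2,
      (hW.memLp (partitionPoint t n i.succ)).coeFn_toLp,
      (hW.memLp (partitionPoint t n i.castSucc)).coeFn_toLp] with ω h3 h4 h5 h6 h7 h8
    rw [h3, h5, Pi.smul_apply, h4, increment, h6, Pi.sub_apply, h7, h8, smul_eq_mul, mul_assoc]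
  filter_upwards [h1, Lp.coeFn_finsetSum Finset.univ (fun i : Fin (n + 1) =>
    c (partitionPoint t n i.castSucc) • wickMulLp hW
        (cutoff hh (partitionPoint t n i.castSucc))
        (increment (partitionPoint t n i.castSucc) (partitionPoint t n i.succ)))] with ω h1 h2
  rw [wickStepIntegral, h2, Finset.sum_apply]
  exact Finset.sum_congr rfl fun i _ => h1 i

theorem measurable_wickElementary_eval (c : ℝ → ℝ) (t : unitInterval) (n : ℕ) :
    AEStronglyMeasurable (fun p : ℝ × Ω => (wickElementary hW hh c t n).eval p.1 p.2)
      (unitMeasure.prod P) := by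
  unfold ElementaryProcess.eval
  refine Finset.aestronglyMeasurable_fun_sum _ fun i _ => ?_
  have h1 := ((wickElementary hW hh c t n).memLp i).1.comp_snd (μ := unitMeasure)
  refine (h1.indicator (measurable_fst (measurableSet_Ioc
    (a := (wickElementary hW hh c t n).t i.castSucc)
    (b := (wickElementary hW hh c t n).t i.succ)))).congr (ae_of_all _ fun p => rfl)

/-- Integrals of adapted Wick exponentials: the Skorohod integral is an Itô integral. -/
theorem IsSkorohodIntegral.isItoIntegral (hgen : IsGeneratedBy W P) {c : ℝ → ℝ}
    (hc : ContinuousOn c (Icc 0 1)) (t : unitInterval) {u : ℝ → Ω → ℝ} {Y : Ω → ℝ}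
    (hY : IsSkorohodIntegral hW u Y)
    (hu : ∀ s ∈ Icc (0 : ℝ) 1, u s =ᵐ[P]
      ((Ico (0 : ℝ) t).indicator (fun s => c s • wickLp hW (cutoff hh s)) s : Lp ℝ 2 P)) :
    IsItoIntegral W P u Y := by
  set G : ℝ → Lp ℝ 2 P := fun s => c s • wickLp hW (cutoff hh s)
  have hGc : ContinuousOn G (Icc 0 1) :=
    hc.smul ((continuous_wickLp hW).comp_continuousOn (continuousOn_cutoff hh))
  obtain ⟨ε, hε0, hε, hεG⟩ := exists_uniform_modulus hGc
  let F : ℕ → ℝ → Lp ℝ 2 P := fun n =>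
    wickStep hW hh (fun i : Fin (n + 1) => c (partitionPoint t n i.castSucc))
      (fun i => partitionPoint t n i.castSucc) (fun i => partitionPoint t n i.succ)
  let S : ℕ → Lp ℝ 2 P := fun n =>
    wickStepIntegral hW hh (fun i : Fin (n + 1) => c (partitionPoint t n i.castSucc))
      (fun i => partitionPoint t n i.castSucc) (fun i => partitionPoint t n i.succ)
  have hle : ∀ n (i : Fin (n + 1)), partitionPoint t n i.castSucc ≤ partitionPoint t n i.succ :=
    fun n i => partitionPoint_monotone t n (Fin.castSucc_le_succ i)
  have hF : ∀ n, ∀ᵐ s ∂unitMeasure, ‖F n s - (Ico (0 : ℝ) t).indicator G s‖ ≤ ε n := fun n =>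
    norm_wickStep_partition_sub_le hW hh t n (hε0 n) (hεG n)
  -- Both approximations are uniformly close to the same integrand, and the isometry passes this on
  -- to the integrals.
  have hFS : ∀ n m, dist (S n) (S m) ≤ ε n + ε m := by
    intro n m
    rw [dist_eq_norm]
    refine norm_wickStepIntegral_sub_le hW hh _ (hle n) _ (hle m) (add_nonneg (hε0 n) (hε0 m)) ?_
    filter_upwards [hF n, hF m] with s hn hm
    have : F n s - F m s = (F n s - (Ico (0 : ℝ) t).indicator G s) -
      (F m s - (Ico (0 : ℝ) t).indicator G s) := by abel
    change ‖F n s - F m s‖ ≤ _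
    rw [this]
    exact (norm_sub_le _ _).trans (add_le_add hn hm)
  have hcauchy : CauchySeq S := by
    rw [Metric.cauchySeq_iff]
    intro e he
    obtain ⟨N, hN⟩ := (Metric.tendsto_atTop.1 hε) (e / 2) (half_pos he)
    refine ⟨N, fun m hm n hn => (hFS m n).trans_lt ?_⟩
    have h1 := hN m hm
    have h2 := hN n hn
    rw [Real.dist_eq, sub_zero, abs_of_nonneg (hε0 _)] at h1 h2
    linarith
  obtain ⟨L, hL⟩ := cauchySeq_tendsto_of_complete hcauchy
  -- The S-transform identity holds for the elementary integrals and survives the limit by dominated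
  -- convergence, with dominating function a multiple of `|g|`.
  have hSL : ∀ g : L2Unit, sTransform hW L g =
      ∫ s, sTransform hW (u s) g * g s ∂unitMeasure := by
    intro g
    have hgi : Integrable g unitMeasure := (Lp.memLp g).integrable (by norm_num)
    have h1 : Tendsto (fun n => inner ℝ (S n) (wickLp hW g)) atTop
        (𝓝 (inner ℝ L (wickLp hW g))) := hL.inner tendsto_const_nhds
    rw [sTransform_coeFn]
    refine tendsto_nhds_unique h1 ?_
    have h2 : ∀ᵐ s ∂unitMeasure, sTransform hW (u s) g =
        inner ℝ ((Ico (0 : ℝ) t).indicator G s) (wickLp hW g) := by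
      filter_upwards [ae_restrict_mem measurableSet_Icc] with s hs
      rw [sTransform_congr hW (hu s hs), sTransform_coeFn]
    have h3 : AEStronglyMeasurable (fun s => inner ℝ ((Ico (0 : ℝ) t).indicator G s) (wickLp hW g))
        unitMeasure :=
      ((hGc.aestronglyMeasurable measurableSet_Icc).indicator measurableSet_Ico).inner
        aestronglyMeasurable_const
    simp_rw [S, inner_wickStepIntegral hW hh _ (hle _)]
    rw [integral_congr_ae (g := fun s =>
      inner ℝ ((Ico (0 : ℝ) t).indicator G s) (wickLp hW g) * g s) (by
        filter_upwards [h2] with s hs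
        rw [hs])]
    obtain ⟨K, hK⟩ := isCompact_Icc.exists_bound_of_continuousOn hGc
    obtain ⟨E, hE⟩ := hε.bddAbove_range
    have hmeas : ∀ n, AEStronglyMeasurable (fun s => inner ℝ (F n s) (wickLp hW g))
        unitMeasure := by
      intro n
      refine AEStronglyMeasurable.inner (Finset.aestronglyMeasurable_fun_sum _ fun i _ => ?_)
        aestronglyMeasurable_const
      exact (aestronglyMeasurable_const).indicator measurableSet_Ioc
    refine tendsto_integral_of_dominated_convergence
      (fun s => (K + E) * ‖wickLp hW g‖ * ‖g s‖)
      (fun n => (hmeas n).mul (Lp.aestronglyMeasurable _))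
      (hgi.norm.const_mul _) (fun n => ?_) ?_
    · filter_upwards [hF n, ae_restrict_mem measurableSet_Icc] with s hs hs1
      rw [norm_mul]
      gcongr
      refine (norm_inner_le_norm _ _).trans ?_
      gcongr
      have h5 : ‖(Ico (0 : ℝ) t).indicator G s‖ ≤ K :=
        (norm_indicator_le_norm_self _ _).trans (hK s hs1)
      have h6 := norm_le_norm_add_norm_sub' (F n s) ((Ico (0 : ℝ) t).indicator G s)
      exact h6.trans (add_le_add h5 (hs.trans (hE (mem_range_self n))))
    · filter_upwards [ae_all_iff.2 hF] with s hs
      refine Tendsto.mul_const _ (Tendsto.inner ?_ tendsto_const_nhds)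
      exact tendsto_iff_norm_sub_tendsto_zero.2
        (squeeze_zero (fun _ => norm_nonneg _) hs hε)
  have hLY : L =ᵐ[P] Y := by
    have h1 : ∀ g, Integrable (fun ω => L ω * wickExp hW g ω) P := fun g =>
      (Lp.memLp L).integrable_mul (memLp_wickExp hW g)
    have h2 : ∀ g, Integrable (fun ω => Y ω * wickExp hW g ω) P := fun g =>
      hY.2.1.integrable_mul (memLp_wickExp hW g)
    have h0 := ae_eq_zero_of_sTransform_eq_zero hW hgen (D := fun ω => L ω - Y ω)
      (fun g => by
        simp_rw [sub_mul]
        exact (h1 g).sub (h2 g))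
      (fun g => by
        simp_rw [sTransform, sub_mul]
        rw [integral_sub (h1 g) (h2 g), sub_eq_zero]
        exact (hSL g).trans (hY.2.2 g).symm)
    filter_upwards [h0] with ω hω
    exact sub_eq_zero.1 hω
  refine ⟨hY.1, hY.2.1, wickElementary hW hh c t, ?_, ?_⟩
  · refine tendsto_of_tendsto_of_tendsto_of_le_of_le tendsto_const_nhds
      (h := fun n => ENNReal.ofReal (ε n)) ?_ (fun _ => bot_le) fun n => ?_
    · simpa using ENNReal.tendsto_ofReal hε
    · refine eLpNorm_uncurry_le
        (u := fun s ω => (wickElementary hW hh c t n).eval s ω - u s ω)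
        ((measurable_wickElementary_eval hW hh c t n).sub hY.1.1) ?_
      filter_upwards [hF n, ae_restrict_mem measurableSet_Icc] with s hs hs1
      refine le_trans (le_of_eq ?_) (ENNReal.ofReal_le_ofReal hs)
      rw [← eLpNorm_coeFn]
      refine eLpNorm_congr_ae ?_
      filter_upwards [wickElementary_eval_ae_eq hW hh c t n s, hu s hs1,
        Lp.coeFn_sub (F n s) ((Ico (0 : ℝ) t).indicator G s)] with ω h1 h2 h3
      rw [h3, Pi.sub_apply, h1, h2]
  · have h1 : ∀ n, eLpNorm (fun ω => (wickElementary hW hh c t n).integral ω - Y ω) 2 P =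
        ENNReal.ofReal ‖S n - L‖ := by
      intro n
      rw [← eLpNorm_coeFn]
      refine eLpNorm_congr_ae ?_
      filter_upwards [wickElementary_integral_ae_eq hW hh c t n, hLY, Lp.coeFn_sub (S n) L]
        with ω h1 h2 h3
      rw [h3, Pi.sub_apply, h1, h2]
    simp_rw [h1]
    simpa using ENNReal.tendsto_ofReal (tendsto_iff_norm_sub_tendsto_zero.1 hL)

end Ito

/-! ### The Itô equation and assembly of the limit theorem. -/

section Main

variable {Ω : Type*} [MeasurableSpace Ω] {P : Measure Ω} [IsProbabilityMeasure P]
  {W : ℝ → Ω → ℝ} (hW : IsBrownianMotion W P)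

/-- The Skorohod solution started from `e^{◇I(0)} = 1` involves only `1_{[0,t)} h` at time `t` and
is therefore adapted. Its integrand is `c(s) e^{◇I(1_{[0,s)} h)}` with the continuous factor `c(s) =
h(s) exp ∫_0^s a`. -/
theorem exists_isItoSolution (hgen : IsGeneratedBy W P) {h a : ℝ → ℝ}
    (hh : MemLp h 2 unitMeasure) (hc : ContinuousOn h (Icc 0 1)) (ha : Integrable a unitMeasure) :
    ∃ Z : ℝ → Ω → ℝ, IsItoSolution W P a h (fun _ => 1) Z ∧
      ∀ t ∈ Icc (0 : ℝ) 1, Z t =ᵐ[P] wickSolution hW 0 hh a t := by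
  obtain ⟨C, hC⟩ := isCompact_Icc.exists_bound_of_continuousOn hc
  obtain ⟨Z, hZ, hZt⟩ := exists_isSkorohodSolution hW 0 hh hC ha
  have hcc : ContinuousOn (fun s => h s * Real.exp (∫ r in (0 : ℝ)..s, a r)) (Icc 0 1) :=
    hc.mul (continuousOn_integral ha).rexp
  refine ⟨Z, ⟨⟨hZ.memLp, hZ.drift, fun t ht => ?_⟩, fun t ht => ?_⟩, hZt⟩
  · obtain ⟨Y, hY, hYt⟩ := hZ.eqn t ht
    refine ⟨Y, hY.isItoIntegral hW hh hgen hcc ⟨t, ht⟩ fun s hs => ?_, ?_⟩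
    · dsimp only
      by_cases hst : s ∈ Ico 0 t
      · rw [indicator_of_mem hst, indicator_of_mem hst]
        filter_upwards [hZt s hs, Lp.coeFn_smul (h s * Real.exp (∫ r in (0 : ℝ)..s, a r))
          (wickLp hW (cutoff hh s)), Lp.coeFn_smul (Real.exp (∫ r in (0 : ℝ)..s, a r))
          (wickLp hW (0 + cutoff hh s))] with ω h1 h2 h3
        rw [h1, wickSolution, h2, h3, zero_add, Pi.smul_apply, Pi.smul_apply, smul_eq_mul,
          smul_eq_mul, mul_assoc]
      · rw [indicator_of_notMem hst, indicator_of_notMem hst]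
        filter_upwards [Lp.coeFn_zero ℝ 2 P] with ω hω
        rw [hω, zero_mul, Pi.zero_apply]
    · filter_upwards [hYt, wickExp_zero hW] with ω h1 h2
      rw [h1, h2]
  · refine ((aestronglyMeasurable_wickExp_cutoff hh hW ht).mul_const
      (Real.exp (∫ s in (0 : ℝ)..t, a s))).congr ?_
    have h1 := wickSolution_coeFn hW 0 hh (a := a) t
    rw [zero_add] at h1
    exact ((hZt t ht).trans h1).symm

theorem BoundedVariationOn.add {f g : ℝ → ℝ} {s : Set ℝ} (hf : BoundedVariationOn f s)
    (hg : BoundedVariationOn g s) : BoundedVariationOn (fun x => f x + g x) s := by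
  refine ne_top_of_le_ne_top (ENNReal.add_ne_top.2 ⟨hf, hg⟩) (iSup_le fun p => ?_)
  refine (Finset.sum_le_sum fun i _ => edist_add_add_le _ _ _ _).trans ?_
  rw [Finset.sum_add_distrib]
  exact add_le_add (eVariationOn.sum_le p.2.2.1 p.2.2.2) (eVariationOn.sum_le p.2.2.1 p.2.2.2)

theorem HasBVDeriv.derivWithin_add {f g : ℝ → ℝ} (hf : HasBVDeriv f) (hg : HasBVDeriv g) :
    EqOn (derivWithin (fun s => f s + g s) (Icc 0 1))
      (fun s => derivWithin f (Icc 0 1) s + derivWithin g (Icc 0 1) s) (Icc 0 1) := fun s hs =>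
  derivWithin_fun_add (hf.differentiableOn s hs) (hg.differentiableOn s hs)

theorem HasBVDeriv.add {f g : ℝ → ℝ} (hf : HasBVDeriv f) (hg : HasBVDeriv g) :
    HasBVDeriv fun s => f s + g s where
  memLp := hf.memLp.add hg.memLp
  differentiableOn := hf.differentiableOn.add hg.differentiableOn
  boundedVariationOn := by
    rw [BoundedVariationOn, eVariationOn.eq_of_eqOn (hf.derivWithin_add hg)]
    exact BoundedVariationOn.add hf.boundedVariationOn hg.boundedVariationOn

theorem normL2_congr {φ ψ : ℝ → ℝ} (h : EqOn φ ψ (Icc 0 1)) : normL2 φ = normL2 ψ := by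
  rw [normL2, normL2]
  congr 1
  refine intervalIntegral.integral_congr fun s hs => ?_
  rw [uIcc_of_le zero_le_one] at hs
  simp only [h hs]

theorem cutoff_one {h : ℝ → ℝ} (hh : MemLp h 2 unitMeasure) : cutoff hh 1 = hh.toLp h := by
  refine (MemLp.toLp_eq_toLp_iff _ _).2 ?_
  have h1 : ∀ᵐ s ∂unitMeasure, s ≠ 1 := ae_restrict_of_ae (Measure.ae_ne volume 1)
  filter_upwards [ae_restrict_mem measurableSet_Icc, h1] with s hs hs1
  exact indicator_of_mem (s := Ico (0 : ℝ) 1) ⟨hs.1, lt_of_le_of_ne hs.2 hs1⟩ _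

theorem tendsto_optimalError {h : ℝ → ℝ} (hh : HasBVDeriv h) {b : ℝ} {Y : Ω → ℝ}
    (hY : Y =ᵐ[P] fun ω => Real.exp b * wickExp hW (hh.memLp.toLp h) ω) :
    Tendsto (fun n : ℕ => (n : ℝ) * optimalError W P n Y) atTop
      (𝓝 (normL2 (derivWithin h (Icc 0 1)) * Real.exp (normL2 h ^ 2 / 2 + b) /
        Real.sqrt 12)) := by
  have h1 := (tendsto_mul_sqrt_exp_sub (A := ‖hh.memLp.toLp h‖ ^ 2) (fun _ => norm_nonneg _)
    (tendsto_mul_norm_sub_starProjection hh)).const_mul (Real.exp b)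
  have h2 : Real.exp b * (normL2 (derivWithin h (Icc 0 1)) / Real.sqrt 12 *
      Real.exp (‖hh.memLp.toLp h‖ ^ 2 / 2)) =
      normL2 (derivWithin h (Icc 0 1)) * Real.exp (normL2 h ^ 2 / 2 + b) / Real.sqrt 12 := by
    rw [norm_toLp, Real.exp_add]
    ring
  rw [h2] at h1
  refine h1.congr fun n => ?_
  rw [optimalError_eq hW n _ (Real.exp_pos b).le hY, ← norm_starProjection_sq]
  ring

end Main

end SkorohodSDE

open SkorohodSDE in
theorem mainTheorem8 {Ω : Type*} [MeasurableSpace Ω] {P : Measure Ω} [IsProbabilityMeasure P]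
    {W : ℝ → Ω → ℝ} (hW : IsBrownianMotion W P) (hgen : IsGeneratedBy W P)
    (f σ a : ℝ → ℝ) (hf : HasBVDeriv f) (hσ : HasBVDeriv σ) (ha : IntegrableOn a (Icc 0 1)) :
    (∃ X : ℝ → Ω → ℝ, IsSkorohodSolution hW a σ (wickExp hW (hf.memLp.toLp f)) X) ∧
    ∀ X : ℝ → Ω → ℝ, IsSkorohodSolution hW a σ (wickExp hW (hf.memLp.toLp f)) X →
      (∀ t ∈ Icc (0 : ℝ) 1,
        IsWickProduct hW (wickExp hW (hf.memLp.toLp f))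
          (wickExp hW ((memLp_restrict hσ.memLp t).toLp ((Ico 0 t).indicator σ)))
          (wickExp hW (hf.memLp.toLp f +
            (memLp_restrict hσ.memLp t).toLp ((Ico 0 t).indicator σ))) ∧
        ∀ᵐ ω ∂P, X t ω =
          wickExp hW (hf.memLp.toLp f +
            (memLp_restrict hσ.memLp t).toLp ((Ico 0 t).indicator σ)) ω *
          Real.exp (∫ s in (0 : ℝ)..t, a s)) ∧
      Tendsto (fun n : ℕ => (n : ℝ) * optimalError W P n (X 1)) atTop
        (𝓝 (normL2 (fun s => derivWithin f (Icc 0 1) s + derivWithin σ (Icc 0 1) s) *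
          Real.exp (normL2 (fun s => f s + σ s) ^ 2 / 2 + ∫ s in (0 : ℝ)..1, a s) /
          Real.sqrt 12)) ∧
      (∃ Z : ℝ → Ω → ℝ, IsItoSolution W P a (fun s => f s + σ s) (fun _ => 1) Z ∧
        ∀ᵐ ω ∂P, X 1 ω = Z 1 ω) := by
  obtain ⟨C, hC⟩ := isCompact_Icc.exists_bound_of_continuousOn hσ.differentiableOn.continuousOn
  obtain ⟨X₀, hX₀, -⟩ := exists_isSkorohodSolution hW (hf.memLp.toLp f) hσ.memLp hC ha
  refine ⟨⟨X₀, hX₀⟩, fun X hX => ?_⟩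
  have hXt : ∀ t ∈ Icc (0 : ℝ) 1, X t =ᵐ[P] fun ω =>
      wickExp hW (hf.memLp.toLp f + cutoff hσ.memLp t) ω *
        Real.exp (∫ s in (0 : ℝ)..t, a s) := fun t ht =>
    (hX.ae_eq hW _ hσ.memLp hgen ha ht).trans (wickSolution_coeFn hW _ hσ.memLp t)
  have h1 : (1 : ℝ) ∈ Icc (0 : ℝ) 1 := by simp
  have hfσ := hf.add hσ
  -- At time 1 the cut-off is void up to a null set, so `X 1` depends on `f` and `σ` only through
  -- their sum. Both the error asymptotics and the Itô representation rest on this.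
  have hsum : hf.memLp.toLp f + cutoff hσ.memLp 1 = hfσ.memLp.toLp _ := by
    rw [cutoff_one]
    exact (MemLp.toLp_add hf.memLp hσ.memLp).symm
  refine ⟨fun t ht => ⟨isWickProduct_wickExp hW _ _, hXt t ht⟩, ?_, ?_⟩
  · have h := tendsto_optimalError hW hfσ (b := ∫ s in (0 : ℝ)..1, a s) (Y := X 1) (by
      filter_upwards [hXt 1 h1] with ω hω
      rw [hω, hsum, mul_comm])
    rwa [normL2_congr (hf.derivWithin_add hσ)] at h
  · obtain ⟨Z, hZ, hZt⟩ :=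
      exists_isItoSolution hW hgen hfσ.memLp hfσ.differentiableOn.continuousOn ha
    refine ⟨Z, hZ, ?_⟩
    have h2 := (hZt 1 h1).trans (wickSolution_coeFn hW 0 hfσ.memLp 1)
    filter_upwards [hXt 1 h1, h2] with ω h3 h4
    rw [h3, h4, hsum, cutoff_one, zero_add]
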